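/- There is an algorithm which, given a finite simple connected chordal graph $G=(V,E)$ with $n$ vertices (chordal: every induced cycle is a triangle), computes in time polynomial in $n$ a rooted clique-tree $T$ of $G$ with the two properties below. Here a rooted clique-tree of $G$ is a tree $T$ whose nodes are the (inclusion-)maximal cliques of $G$, with one node $K_0$ chosen as the root, such that for every $v\in V$ the maximal cliques containing $v$ induce a subtree of $T$. For a node $K_i$ other than the root, let $K_{p(i)}$ be its father node, let $S_i:=K_i\cap K_{p(i)}$, and let $G_i$ be the subgraph of $G$ induced by the union of all maximal cliques in the subtree of $T$ rooted at $K_i$. A minimal separator of a graph $H$ is a vertex set $S$ such that, for some vertices $u,v\notin S$, the set $S$ disconnects $u$ from $v$ in $H$ and no strict subset of $S$ does. A vertex set $S$ is weakly $T$-convergent if some maximal clique $K_S$ is an endpoint of every edge $KL$ of $T$ with $K\cap L\supsetneq S$; it is $T$-convergent if some maximal clique $K_S$ is an endpoint of all these edges and also of every edge $KL$ of $T$ with $K\cap L=S$. For every node $K_i$ of $T$ other than the root: 1. if $S_i$ is weakly $T$-convergent and $|S_i|\ge 3$, then $S_i$ is $T$-convergent; 2. every minimal separator $S$ of $G_i$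 with $S\subseteq S_i$ is $T$-convergent, has at least three vertices, and is strictly contained in some minimal separator of $G_i$. -/

import Mathlib

/-! ## A machine model with a step count

Values are binary trees, and programs are those of a Turing-complete while language on such trees.
Every construct is charged the full size of the value to which it is applied, so that all copying
is paid for; consequently running times in this model and on multitape Turing machines agree up to
a polynomial. -/

namespace TreeMachine

inductive Data : Type
  | nil : Data
  | cons : Data → Data → Data

/-- The number of nodes of a tree, the leaves included. -/
def Data.size : Data → ℕ
  | .nil => 1
  | .cons a b => a.size + b.size + 1

inductive Prog : Type
  /-- return the input -/
  | id : Prog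
  /-- return `nil` -/
  | nil : Prog
  /-- return the left part of the input (`nil` on `nil`) -/
  | fst : Prog
  /-- return the right part of the input (`nil` on `nil`) -/
  | snd : Prog
  /-- run both programs on the input and pair the results -/
  | cons : Prog → Prog → Prog
  /-- run the first program on the input and then the second one on its result -/
  | seq : Prog → Prog → Prog
  /-- run the first program on the input; if it returns `nil`, run the third program on the input,
  and otherwise the second -/
  | ite : Prog → Prog → Prog → Prog
  /-- as long as the left part of the current value is not `nil`, apply the program to it -/
  | loop : Prog → Prog

/-- `Runs p x y t`: on input `x`, the program `p` halts with output `y` after `t` steps. -/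
inductive Runs : Prog → Data → Data → ℕ → Prop
  | id (x : Data) : Runs .id x x x.size
  | nil (x : Data) : Runs .nil x .nil x.size
  | fst_nil : Runs .fst .nil .nil Data.nil.size
  | fst_cons (a b : Data) : Runs .fst (.cons a b) a (Data.cons a b).size
  | snd_nil : Runs .snd .nil .nil Data.nil.size
  | snd_cons (a b : Data) : Runs .snd (.cons a b) b (Data.cons a b).size
  | cons {p q : Prog} {x a b : Data} {s t : ℕ} :
      Runs p x a s → Runs q x b t → Runs (.cons p q) x (.cons a b) (x.size + s + t)
  | seq {p q : Prog} {x y z : Data} {s t : ℕ} :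
      Runs p x y s → Runs q y z t → Runs (.seq p q) x z (x.size + s + t)
  | ite_true {c p q : Prog} {x a b y : Data} {s t : ℕ} :
      Runs c x (.cons a b) s → Runs p x y t → Runs (.ite c p q) x y (x.size + s + t)
  | ite_false {c p q : Prog} {x y : Data} {s t : ℕ} :
      Runs c x .nil s → Runs q x y t → Runs (.ite c p q) x y (x.size + s + t)
  | loop_nil {p : Prog} : Runs (.loop p) .nil .nil Data.nil.size
  | loop_stop {p : Prog} (b : Data) :
      Runs (.loop p) (.cons .nil b) (.cons .nil b) (Data.cons .nil b).size
  | loop_step {p : Prog} {a₁ a₂ b y z : Data} {s t : ℕ} :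
      Runs p (.cons (.cons a₁ a₂) b) y s → Runs (.loop p) y z t →
      Runs (.loop p) (.cons (.cons a₁ a₂) b) z ((Data.cons (.cons a₁ a₂) b).size + s + t)

def encodeList : List Data → Data
  | [] => .nil
  | a :: l => .cons a (encodeList l)

def encodeBool : Bool → Data
  | false => .nil
  | true => .cons .nil .nil

open Classical in
/-- A set of vertices, encoded as its characteristic 0-1-sequence of length `n`. -/
noncomputable def encodeSet {n : ℕ} (K : Set (Fin n)) : Data :=
  encodeList ((List.finRange n).map fun j => encodeBool (decide (j ∈ K)))

/-- A graph with vertices `0, …, n - 1`, encoded as its adjacency matrix, row by row. -/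
noncomputable def encodeGraph {n : ℕ} (G : SimpleGraph (Fin n)) : Data :=
  encodeList ((List.finRange n).map fun i => encodeSet (G.neighborSet i))

end TreeMachine

/-! ## Chordal graphs, minimal separators, rooted clique-trees -/

namespace ChordalGraph

/-- Every induced cycle is a triangle. -/
def IsChordal {V : Type*} (G : SimpleGraph V) : Prop :=
  ∀ k : ℕ, 4 ≤ k → ¬ (SimpleGraph.cycleGraph k).IsIndContained G

/-- `S` contains neither `u` nor `v`, and `u`, `v` are disconnected in `G \ S`. -/
def IsSeparator {V : Type*} (G : SimpleGraph V) (u v : V) (S : Set V) : Prop :=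
  ∃ (hu : u ∈ Sᶜ) (hv : v ∈ Sᶜ), ¬ (G.induce Sᶜ).Reachable ⟨u, hu⟩ ⟨v, hv⟩

/-- `S` is an inclusion-minimal `uv`-separator for some vertices `u`, `v`. -/
def IsMinimalSeparator {V : Type*} (G : SimpleGraph V) (S : Set V) : Prop :=
  ∃ u v : V, Minimal (IsSeparator G u v) S

/-- `S` is a minimal separator of the induced subgraph `G[U]`. -/
def IsMinimalSeparatorOn {V : Type*} (G : SimpleGraph V) (U S : Set V) : Prop :=
  ∃ S' : Set U, IsMinimalSeparator (G.induce U) S' ∧ Subtype.val '' S' = S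

abbrev MaxClique {V : Type*} (G : SimpleGraph V) : Type _ :=
  {K : Set V // Maximal G.IsClique K}

/-- A tree on the maximal cliques of `G`, with a distinguished root, such that for every vertex
the maximal cliques containing it induce a subtree. -/
structure RootedCliqueTree {V : Type*} (G : SimpleGraph V) where
  tree : SimpleGraph (MaxClique G)
  isTree : tree.IsTree
  connected_of_mem : ∀ v : V, (tree.induce {K | v ∈ K.1}).Connected
  root : MaxClique G

namespace RootedCliqueTree

variable {V : Type*} {G : SimpleGraph V} (T : RootedCliqueTree G)

/-- `P` is the father node of `K`. -/
def IsParent (P K : MaxClique G) : Prop :=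
  T.tree.Adj P K ∧ T.tree.dist T.root K = T.tree.dist T.root P + 1

/-- The union of the maximal cliques in the subtree rooted at `K`. -/
def below (K : MaxClique G) : Set V :=
  {v | ∃ L : MaxClique G, Relation.ReflTransGen T.IsParent K L ∧ v ∈ L.1}

/-- Some maximal clique is incident to all the edges of the tree whose label (the intersection of
the two ends) strictly contains `S`. -/
def WeaklyConvergent (S : Set V) : Prop :=
  ∃ C : MaxClique G, ∀ K L : MaxClique G, T.tree.Adj K L → S ⊂ K.1 ∩ L.1 → C = K ∨ C = L

/-- Some maximal clique is incident to all the edges of the tree whose label strictly contains `S`,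
and also to all the edges with label `S`. -/
def Convergent (S : Set V) : Prop :=
  ∃ C : MaxClique G,
    (∀ K L : MaxClique G, T.tree.Adj K L → S ⊂ K.1 ∩ L.1 → C = K ∨ C = L) ∧
    (∀ K L : MaxClique G, T.tree.Adj K L → K.1 ∩ L.1 = S → C = K ∨ C = L)

end RootedCliqueTree

/-- `d` encodes the rooted clique-tree `T`: it consists of the root and of a list, in some order and
without repetition, of all the pairs formed by a node other than the root and its father. -/
def RootedCliqueTree.IsEncodedBy {n : ℕ} {G : SimpleGraph (Fin n)} (T : RootedCliqueTree G)
    (d : TreeMachine.Data) : Prop :=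
  ∃ arcs : List (MaxClique G × MaxClique G),
    arcs.Nodup ∧ (∀ K P : MaxClique G, (K, P) ∈ arcs ↔ T.IsParent P K) ∧
    d = .cons (TreeMachine.encodeSet T.root.1)
      (TreeMachine.encodeList (arcs.map fun a =>
        .cons (TreeMachine.encodeSet a.1.1) (TreeMachine.encodeSet a.2.1)))

end ChordalGraph

/-! The tree comes from a greedy search on the list of maximal cliques. Each step takes an
inclusion-maximal intersection `S` of a visited and an unvisited clique, visits an unvisited clique
containing `S`, and gives it as father a visited clique containing `S`. Two preferences produce the
required properties. The new clique should be a hub: it should contain every intersection of two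
unvisited cliques that is strictly larger than `S`. The father is the earliest clique containing
`S`, except when `|S| ≥ 3` and no two unvisited cliques have a larger intersection; then it is, if
possible, the earliest one incident to all existing arcs with label larger than `S` (a center).

Chordality makes the result a clique-tree. The visited neighbors of a component outside the visited
union form a clique, some vertex of the component is adjacent to all of them
(`IsChordal.exists_forall_adj`), and maximality of `S` then forces them to be exactly `S`
(`Explored.exists_component`). Each visit also adds a vertex, so there are at most `n + 1` maximal
cliques; this keeps the enumeration of the cliques, one vertex at a time, polynomial.

Property 1 is `SearchOrder.exists_center`. If all arcs with larger label precede the first arc with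
label `S`, the preference for centers attaches every arc with label `S` to the same center.
Otherwise they all come after it, because larger labels are used up before the search leaves along
`S`. The center of their star is then a hub, so the first node `z` reached along `S` is a hub too;
all larger arcs start from `z`, and the later arcs with label `S` are attached to `z`.

For property 2, a minimal separator of `G_i` is the label of an arc `j` strictly inside the subtree
(`SearchOrder.exists_label_eq`). If it lies in the label of `i`, the father of `i` contains it and
precedes the father of `j`. So the latter was not chosen as the earliest candidate: the label has
three vertices and the father of `j` is a center. The earliest clique containing the label was not a
center, which yields an arc with larger label inside the subtree
(`SearchOrder.exists_center_of_label_subset`). -/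

/-! ## Polynomial-time functions on encoded data -/

namespace TreeMachine

/-- Types whose elements are encoded as trees. -/
class Enc (α : Type*) where
  enc : α → Data

open Enc (enc)

instance : Enc Bool := ⟨encodeBool⟩
instance {α β : Type*} [Enc α] [Enc β] : Enc (α × β) := ⟨fun p => .cons (enc p.1) (enc p.2)⟩
instance {α : Type*} [Enc α] : Enc (List α) := ⟨fun l => encodeList (l.map enc)⟩

/-- The size of the encoding. -/
def sz {α : Type*} [Enc α] (a : α) : ℕ := (enc a).size

/-! ### Sizes of encodings. -/

section Size

variable {α β : Type*} [Enc α] [Enc β]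

theorem Data.one_le_size (d : Data) : 1 ≤ d.size := by
  cases d <;> simp [Data.size]

theorem one_le_sz (a : α) : 1 ≤ sz a := Data.one_le_size _

theorem sz_prod (p : α × β) : sz p = sz p.1 + sz p.2 + 1 := rfl

theorem sz_nil : sz ([] : List α) = 1 := rfl

theorem sz_cons (a : α) (l : List α) : sz (a :: l) = sz a + sz l + 1 := rfl

theorem sz_bool_le (b : Bool) : sz b ≤ 3 := by cases b <;> decide

theorem sz_append (l m : List α) : sz (l ++ m) + 1 = sz l + sz m := by
  induction l with
  | nil => simp [sz_nil]; omega
  | cons a l ih => simp only [List.cons_append, sz_cons]; omega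

theorem sz_sublist {l m : List α} (h : l.Sublist m) : sz l ≤ sz m := by
  induction h with
  | slnil => rfl
  | cons a _ ih => simp only [sz_cons]; omega
  | cons_cons a _ ih => simp only [sz_cons]; omega

theorem sz_le_of_mem {l : List α} {a : α} (h : a ∈ l) : sz a ≤ sz l := by
  induction l with
  | nil => simp at h
  | cons b l ih =>
    simp only [sz_cons]
    rcases List.mem_cons.1 h with rfl | h
    · omega
    · have := ih h; omega

theorem length_le_sz (l : List α) : l.length ≤ sz l := by
  induction l with
  | nil => simp
  | cons b l ih => simp only [sz_cons, List.length_cons]; omega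

theorem sz_le_of_forall {l : List α} {M : ℕ} (h : ∀ a ∈ l, sz a ≤ M) :
    sz l ≤ l.length * (M + 1) + 1 := by
  induction l with
  | nil => simp [sz_nil]
  | cons b l ih =>
    have h1 := h b (by simp)
    have h2 := ih fun a ha => h a (by simp [ha])
    simp only [sz_cons, List.length_cons, Nat.succ_mul]; omega

end Size

theorem eval_mono (p : Polynomial ℕ) {m n : ℕ} (h : m ≤ n) : p.eval m ≤ p.eval n := by
  simp only [Polynomial.eval_eq_sum, Polynomial.sum]
  gcongr

/-- Every construct is charged the size of its argument, so a value cannot grow faster than the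
clock. Hence time bounds are also size bounds, which makes composition polynomial. -/
theorem Runs.size_le {A : Prog} {x y : Data} {t : ℕ} (h : Runs A x y t) : y.size ≤ t := by
  induction h with
  | cons _ _ ih₁ ih₂ =>
    rename_i x _ _ _ _ _ _
    have := x.one_le_size
    simp only [Data.size]; omega
  | nil x => exact x.one_le_size
  | id => exact le_rfl
  | seq _ _ ih₁ ih₂ => omega
  | ite_true _ _ ih₁ ih₂ => omega
  | ite_false _ _ ih₁ ih₂ => omega
  | loop_step _ _ ih₁ ih₂ => omega
  | _ => simp only [Data.size]; omega

/-- `f` is computed by a program whose running time on all inputs in `D` is bounded by a polynomial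
in the size of the input. -/
def PolyTimeOn {α β : Type*} [Enc α] [Enc β] (D : α → Prop) (f : α → β) : Prop :=
  ∃ (A : Prog) (p : Polynomial ℕ), ∀ a, D a →
    ∃ t, Runs A (enc a) (enc (f a)) t ∧ t ≤ p.eval (sz a)

/-- `f` is computable in polynomial time. -/
abbrev PolyTime {α β : Type*} [Enc α] [Enc β] (f : α → β) : Prop := PolyTimeOn (fun _ => True) f

/-! ### Closure properties of polynomial-time functions. -/

namespace PolyTimeOn

variable {α β γ : Type*} [Enc α] [Enc β] [Enc γ] {D : α → Prop}

theorem congr {f g : α → β} (hf : PolyTimeOn D f) (h : ∀ a, D a → f a = g a) :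
    PolyTimeOn D g := by
  obtain ⟨A, p, hA⟩ := hf
  exact ⟨A, p, fun a ha => h a ha ▸ hA a ha⟩

theorem exists_sz_le {f : α → β} (hf : PolyTimeOn D f) :
    ∃ p : Polynomial ℕ, ∀ a, D a → sz (f a) ≤ p.eval (sz a) := by
  obtain ⟨A, p, hA⟩ := hf
  refine ⟨p, fun a ha => ?_⟩
  obtain ⟨t, h, ht⟩ := hA a ha
  exact h.size_le.trans ht

theorem id : PolyTimeOn D (fun a => a) :=
  ⟨.id, .X, fun a _ => ⟨_, .id _, by simp [sz]⟩⟩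

theorem comp_on {E : β → Prop} {g : β → γ} {f : α → β} (hg : PolyTimeOn E g)
    (hf : PolyTimeOn D f) (h : ∀ a, D a → E (f a)) : PolyTimeOn D (fun a => g (f a)) := by
  obtain ⟨A, p, hA⟩ := hf
  obtain ⟨B, q, hB⟩ := hg
  refine ⟨.seq A B, .X + p + q.comp p, fun a ha => ?_⟩
  obtain ⟨s, hs, hsp⟩ := hA a ha
  obtain ⟨t, ht, htq⟩ := hB _ (h a ha)
  refine ⟨_, .seq hs ht, ?_⟩
  have := htq.trans (eval_mono q (hs.size_le.trans hsp))
  simp only [Polynomial.eval_add, Polynomial.eval_X, Polynomial.eval_comp]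
  unfold sz at *
  omega

theorem comp {g : β → γ} {f : α → β} (hg : PolyTime g) (hf : PolyTimeOn D f) :
    PolyTimeOn D (fun a => g (f a)) :=
  hg.comp_on hf fun _ _ => trivial

theorem prod {f : α → β} {g : α → γ} (hf : PolyTimeOn D f) (hg : PolyTimeOn D g) :
    PolyTimeOn D (fun a => (f a, g a)) := by
  obtain ⟨A, p, hA⟩ := hf
  obtain ⟨B, q, hB⟩ := hg
  refine ⟨.cons A B, .X + p + q, fun a ha => ?_⟩
  obtain ⟨s, hs, hsp⟩ := hA a ha
  obtain ⟨t, ht, htq⟩ := hB a ha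
  refine ⟨_, .cons hs ht, ?_⟩
  simp only [Polynomial.eval_add, Polynomial.eval_X]
  unfold sz at *
  omega

/-- The encoding of `a :: l` is literally that of the pair `(a, l)`. -/
theorem cons {f : α → β} {g : α → List β} (hf : PolyTimeOn D f) (hg : PolyTimeOn D g) :
    PolyTimeOn D (fun a => f a :: g a) := by
  obtain ⟨A, p, h⟩ := hf.prod hg
  exact ⟨A, p, h⟩

theorem fst {f : α → β × γ} (hf : PolyTimeOn D f) : PolyTimeOn D (fun a => (f a).1) :=
  comp (g := Prod.fst) ⟨.fst, .X, fun a _ => ⟨_, .fst_cons _ _, by simp [sz, enc]⟩⟩ hf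

theorem snd {f : α → β × γ} (hf : PolyTimeOn D f) : PolyTimeOn D (fun a => (f a).2) :=
  comp (g := Prod.snd) ⟨.snd, .X, fun a _ => ⟨_, .snd_cons _ _, by simp [sz, enc]⟩⟩ hf

theorem nil : PolyTimeOn D (fun _ => ([] : List β)) :=
  ⟨.nil, .X, fun a _ => ⟨_, .nil _, by simp [sz]⟩⟩

theorem false : PolyTimeOn D (fun _ => false) :=
  ⟨.nil, .X, fun a _ => ⟨_, .nil _, by simp [sz]⟩⟩

theorem true : PolyTimeOn D (fun _ => true) := by
  obtain ⟨A, p, h⟩ := PolyTimeOn.false.prod (.false (D := D))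
  exact ⟨A, p, h⟩

/-- The default `[]` is encoded by `nil`, which is what the machine returns as the left part of
`nil`. -/
theorem headD_nil {f : α → List (List β)} (hf : PolyTimeOn D f) :
    PolyTimeOn D (fun a => (f a).headD []) := by
  refine comp (g := fun l : List (List β) => l.headD []) ⟨.fst, .X, fun a _ => ?_⟩ hf
  cases a with
  | nil => exact ⟨_, .fst_nil, by simp [sz_nil, Data.size]⟩
  | cons a l => exact ⟨_, .fst_cons _ _, by simp [sz, enc, encodeList]⟩

theorem tail {f : α → List β} (hf : PolyTimeOn D f) : PolyTimeOn D (fun a => (f a).tail) := by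
  refine comp (g := fun l : List β => l.tail) ⟨.snd, .X, fun a _ => ?_⟩ hf
  cases a with
  | nil => exact ⟨_, .snd_nil, by simp [sz_nil, Data.size]⟩
  | cons a l => exact ⟨_, .snd_cons _ _, by simp [sz, enc, encodeList]⟩

theorem headD_false {f : α → List Bool} (hf : PolyTimeOn D f) :
    PolyTimeOn D (fun a => (f a).headD Bool.false) := by
  refine comp (g := fun l : List Bool => l.headD Bool.false) ⟨.fst, .X, fun a _ => ?_⟩ hf
  cases a with
  | nil => exact ⟨_, .fst_nil, by simp [sz_nil, Data.size]⟩
  | cons a l => exact ⟨_, .fst_cons _ _, by simp [sz, enc, encodeList]⟩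

theorem ite {c : α → Bool} {f g : α → β} (hc : PolyTimeOn D c) (hf : PolyTimeOn D f)
    (hg : PolyTimeOn D g) : PolyTimeOn D (fun a => if c a then f a else g a) := by
  obtain ⟨C, r, hC⟩ := hc
  obtain ⟨A, p, hA⟩ := hf
  obtain ⟨B, q, hB⟩ := hg
  refine ⟨.ite C A B, .X + r + p + q, fun a ha => ?_⟩
  obtain ⟨u, hu, hur⟩ := hC a ha
  obtain ⟨s, hs, hsp⟩ := hA a ha
  obtain ⟨t, ht, htq⟩ := hB a ha
  simp only [Polynomial.eval_add, Polynomial.eval_X]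
  cases hca : c a <;> rw [hca] at hu
  · exact ⟨_, .ite_false hu ht, by unfold sz at *; omega⟩
  · exact ⟨_, .ite_true hu hs, by unfold sz at *; omega⟩

theorem isEmpty {f : α → List β} (hf : PolyTimeOn D f) :
    PolyTimeOn D (fun a => (f a).isEmpty) := by
  refine comp (g := fun l : List β => l.isEmpty)
    ⟨.ite .id .nil (.cons .nil .nil), .X + .X + .X + .X + .X, fun l _ => ?_⟩ hf
  simp only [Polynomial.eval_add, Polynomial.eval_X]
  cases l with
  | nil =>
    exact ⟨_, .ite_false (.id _) (.cons (.nil _) (.nil _)), by unfold sz; omega⟩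
  | cons a l => exact ⟨_, .ite_true (.id _) (.nil _), by unfold sz; omega⟩

/-- Bounded iteration over a list. -/
theorem foldl {l : α → List γ} {b₀ : α → β} {s : α → β → γ → β} (hl : PolyTimeOn D l)
    (hb : PolyTimeOn D b₀) (hs : PolyTime (fun z : α × β × γ => s z.1 z.2.1 z.2.2))
    (q : Polynomial ℕ)
    (hq : ∀ a, D a → ∀ m, m <+: l a → sz (m.foldl (s a) (b₀ a)) ≤ q.eval (sz a)) :
    PolyTimeOn D (fun a => (l a).foldl (s a) (b₀ a)) := by
  -- the body of the loop, on values of the form `(x :: rest, a, b)`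
  obtain ⟨B, p, hB⟩ : PolyTime (fun z : (γ × List γ) × α × β =>
      (z.1.2, z.2.1, s z.2.1 z.2.2 z.1.1)) :=
    id.fst.snd.prod (id.snd.fst.prod
      (hs.comp (id.snd.fst.prod (id.snd.snd.prod id.fst.fst))))
  have hloop : ∀ (M : ℕ) (a : α) (m : List γ) (b : β),
      (∀ m₁ m₂, m = m₁ ++ m₂ → sz (m₂, a, m₁.foldl (s a) b) ≤ M) →
      ∃ t, Runs (.loop B) (enc (m, a, b)) (enc (([] : List γ), a, m.foldl (s a) b)) t ∧
        t ≤ (m.length + 1) * (M + p.eval M) := by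
    intro M a m
    induction m with
    | nil =>
      intro b hM
      refine ⟨_, Runs.loop_stop _, ?_⟩
      have : sz (([] : List γ), a, b) ≤ M := by simpa using hM [] []
      change sz (([] : List γ), a, b) ≤ _
      simp only [List.length_nil, zero_add, one_mul]
      omega
    | cons x m ih =>
      intro b hM
      have h0 : sz (x :: m, a, b) ≤ M := by simpa using hM [] (x :: m)
      obtain ⟨t, ht, htp⟩ := hB ((x, m), a, b) trivial
      obtain ⟨u, hu, hup⟩ := ih (s a b x) fun m₁ m₂ e => by
        simpa using hM (x :: m₁) m₂ (by simp [e])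
      refine ⟨_, .loop_step ht hu, ?_⟩
      have h1 : t ≤ p.eval M := htp.trans (eval_mono p h0)
      change sz (x :: m, a, b) + t + u ≤ _
      rw [List.length_cons, Nat.succ_mul (m.length + 1)]
      omega
  obtain ⟨I, r, hI⟩ := hl.prod (id.prod hb)
  refine ⟨.seq I (.seq (.loop B) (.seq .snd .snd)),
    -- `M` bounds every value met by the loop: `r` for the remaining list, `.X` for the parameter,
    -- `q` for the accumulator, and `4` for the pairing nodes and a final `nil`.
    let M := r + .X + q + 4
    .X + r + r + (r + 1) * (M + p.comp M) + 4 * M, fun a ha => ?_⟩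
  obtain ⟨t, ht, htr⟩ := hI a ha
  have hin : sz (l a, a, b₀ a) ≤ r.eval (sz a) := ht.size_le.trans htr
  set M := (r + .X + q + 4).eval (sz a) with hMdef
  have hM' : M = r.eval (sz a) + sz a + q.eval (sz a) + 4 := by
    simp [hMdef]
  have hlsz : sz (l a) ≤ r.eval (sz a) := by
    rw [sz_prod] at hin; exact le_trans (by simp; omega) hin
  obtain ⟨u, hu, huM⟩ := hloop M a (l a) (b₀ a) fun m₁ m₂ e => by
    have h1 := hq a ha m₁ (e ▸ List.prefix_append _ _)
    have h2 : sz m₂ ≤ sz (l a) := sz_sublist (e ▸ List.sublist_append_right _ _)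
    simp only [sz_prod]
    omega
  have hout : sz (([] : List γ), a, (l a).foldl (s a) (b₀ a)) ≤ M := by
    have h1 := hq a ha (l a) List.prefix_rfl
    simp only [sz_prod, sz_nil]
    omega
  have hlen := (length_le_sz (l a)).trans hlsz
  refine ⟨_, .seq ht (.seq hu (.seq (.snd_cons _ _) (.snd_cons _ _))), ?_⟩
  have h3 : u ≤ (r.eval (sz a) + 1) * (M + p.eval M) :=
    huM.trans (Nat.mul_le_mul_right _ (by omega))
  simp only [sz_prod] at hin hout
  simp only [Polynomial.eval_add, Polynomial.eval_mul, Polynomial.eval_comp, Polynomial.eval_X,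
    Polynomial.eval_one, Polynomial.eval_ofNat] at *
  rw [← hMdef]
  simp only [enc, Data.size]
  simp only [sz, enc, Data.size] at *
  simp only [encodeList, List.map_nil, Data.size] at *
  omega

/-- Iteration over a list when each step adds a bounded amount to the result. -/
theorem foldl_of_add {l : α → List γ} {b₀ : α → β} {s : α → β → γ → β} (hl : PolyTimeOn D l)
    (hb : PolyTimeOn D b₀) (hs : PolyTime (fun z : α × β × γ => s z.1 z.2.1 z.2.2))
    (q : Polynomial ℕ) (hq : ∀ a b x, sz (s a b x) ≤ sz b + q.eval (sz (a, x))) :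
    PolyTimeOn D (fun a => (l a).foldl (s a) (b₀ a)) := by
  obtain ⟨p, hp⟩ := hl.exists_sz_le
  obtain ⟨r, hr⟩ := hb.exists_sz_le
  refine foldl hl hb hs (r + p * q.comp (.X + p + 1)) fun a ha m hm => ?_
  have key : ∀ (m : List γ) (b : β), (∀ x ∈ m, sz x ≤ sz (l a)) →
      sz (m.foldl (s a) b) ≤ sz b + m.length * q.eval (sz a + sz (l a) + 1) := by
    intro m
    induction m with
    | nil => intro b _; simp
    | cons x m ih =>
      intro b hm
      have h1 := ih (s a b x) fun y hy => hm y (by simp [hy])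
      have h2 := hq a b x
      have h3 : q.eval (sz (a, x)) ≤ q.eval (sz a + sz (l a) + 1) := by
        have := hm x (by simp)
        refine eval_mono q ?_
        simp only [sz_prod]; omega
      simp only [List.foldl_cons, List.length_cons, Nat.succ_mul]
      omega
  have h1 := key m (b₀ a) fun x hx => sz_le_of_mem (hm.subset hx)
  have h2 : m.length ≤ p.eval (sz a) :=
    hm.length_le.trans ((length_le_sz _).trans (hp a ha))
  have h3 : q.eval (sz a + sz (l a) + 1) ≤ q.eval (sz a + p.eval (sz a) + 1) :=
    eval_mono q (by have := hp a ha; omega)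
  have h4 := Nat.mul_le_mul h2 h3
  have h5 := hr a ha
  simp only [Polynomial.eval_add, Polynomial.eval_mul, Polynomial.eval_comp, Polynomial.eval_X,
    Polynomial.eval_one]
  omega

theorem reverse {f : α → List β} (hf : PolyTimeOn D f) : PolyTimeOn D (fun a => (f a).reverse) := by
  refine congr (foldl_of_add (s := fun _ b x => x :: b) hf nil (id.snd.snd.cons id.snd.fst)
    (.X + 1) fun a b x => ?_) fun a _ => ?_
  · simp only [sz_cons, sz_prod, Polynomial.eval_add, Polynomial.eval_X, Polynomial.eval_one]
    omega
  · simp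

theorem map {l : α → List γ} {f : α → γ → β} (hl : PolyTimeOn D l)
    (hf : PolyTime (fun z : α × γ => f z.1 z.2)) :
    PolyTimeOn D (fun a => (l a).map (f a)) := by
  obtain ⟨p, hp⟩ := hf.exists_sz_le
  refine congr (reverse (foldl_of_add (s := fun a b x => f a x :: b) hl nil
    ((hf.comp (id.fst.prod id.snd.snd)).cons id.snd.fst)
    (p + 1) fun a b x => ?_)) fun a _ => ?_
  · have := hp (a, x) trivial
    simp only [sz_cons, Polynomial.eval_add, Polynomial.eval_one]
    simp only at this
    omega
  · have key : ∀ (m : List γ) (b : List β),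
        m.foldl (fun b x => f a x :: b) b = (m.map (f a)).reverse ++ b := by
      intro m
      induction m with
      | nil => simp
      | cons x m ih => intro b; simp [ih]
    simp [key]

theorem append {f g : α → List β} (hf : PolyTimeOn D f) (hg : PolyTimeOn D g) :
    PolyTimeOn D (fun a => f a ++ g a) := by
  refine congr (foldl_of_add (s := fun _ b x => x :: b) hf.reverse hg (id.snd.snd.cons id.snd.fst)
    (.X + 1) fun a b x => ?_) fun a _ => ?_
  · simp only [sz_cons, sz_prod, Polynomial.eval_add, Polynomial.eval_X, Polynomial.eval_one]
    omega
  · simp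

theorem flatMap {l : α → List γ} {f : α → γ → List β} (hl : PolyTimeOn D l)
    (hf : PolyTime (fun z : α × γ => f z.1 z.2)) :
    PolyTimeOn D (fun a => (l a).flatMap (f a)) := by
  obtain ⟨p, hp⟩ := hf.exists_sz_le
  refine congr (foldl_of_add (s := fun a b x => b ++ f a x) hl nil
    (id.snd.fst.append (hf.comp (id.fst.prod id.snd.snd))) p fun a b x => ?_) fun a _ => ?_
  · have := hp (a, x) trivial
    have := sz_append b (f a x)
    simp only at *
    omega
  · have key : ∀ (m : List γ) (b : List β),
        m.foldl (fun b x => b ++ f a x) b = b ++ m.flatMap (f a) := by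
      intro m
      induction m with
      | nil => simp
      | cons x m ih => intro b; simp [ih]
    simp [key]

theorem not {f : α → Bool} (hf : PolyTimeOn D f) : PolyTimeOn D (fun a => !f a) :=
  (ite hf false true).congr fun a _ => by cases f a <;> rfl

theorem and {f g : α → Bool} (hf : PolyTimeOn D f) (hg : PolyTimeOn D g) :
    PolyTimeOn D (fun a => f a && g a) :=
  (ite hf hg false).congr fun a _ => by cases f a <;> rfl

theorem or {f g : α → Bool} (hf : PolyTimeOn D f) (hg : PolyTimeOn D g) :
    PolyTimeOn D (fun a => f a || g a) :=
  (ite hf true hg).congr fun a _ => by cases f a <;> rfl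

theorem filter {l : α → List γ} {f : α → γ → Bool} (hl : PolyTimeOn D l)
    (hf : PolyTime (fun z : α × γ => f z.1 z.2)) :
    PolyTimeOn D (fun a => (l a).filter (f a)) := by
  refine (hl.flatMap (f := fun a x => if f a x then [x] else [])
    (ite hf (id.snd.cons nil) nil)).congr fun a _ => ?_
  induction l a with
  | nil => rfl
  | cons x m ih => by_cases h : f a x <;> simp [h, ih]

theorem all {l : α → List γ} {f : α → γ → Bool} (hl : PolyTimeOn D l)
    (hf : PolyTime (fun z : α × γ => f z.1 z.2)) :
    PolyTimeOn D (fun a => (l a).all (f a)) :=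
  (hl.filter (f := fun a x => !f a x) hf.not).isEmpty.congr fun a _ => by
    rw [Bool.eq_iff_iff]; simp [List.filter_eq_nil_iff]

theorem any {l : α → List γ} {f : α → γ → Bool} (hl : PolyTimeOn D l)
    (hf : PolyTime (fun z : α × γ => f z.1 z.2)) :
    PolyTimeOn D (fun a => (l a).any (f a)) :=
  (hl.filter hf).isEmpty.not.congr fun a _ => by
    rw [Bool.eq_iff_iff]; simp

/-- A fold over the first list carries the unread rest of the second. A pair of bits has size at
most `7 = 3 + 3 + 1`, so each new entry has bounded size. -/
theorem zipWith_bool {l m : α → List Bool} {f : Bool → Bool → β}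
    (hf : PolyTime (fun z : Bool × Bool => f z.1 z.2)) (hl : PolyTimeOn D l)
    (hm : PolyTimeOn D m) : PolyTimeOn D (fun a => List.zipWith f (l a) (m a)) := by
  obtain ⟨p, hp⟩ := hf.exists_sz_le
  refine congr (foldl_of_add (l := l) (b₀ := fun a => (m a, ([] : List β)))
    (s := fun _ b x => (b.1.tail, if b.1.isEmpty then b.2 else f x (b.1.headD Bool.false) :: b.2))
    hl (hm.prod nil)
    (id.snd.fst.fst.tail.prod (ite id.snd.fst.fst.isEmpty id.snd.fst.snd
      ((hf.comp (id.snd.snd.prod id.snd.fst.fst.headD_false)).cons id.snd.fst.snd)))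
    (p.comp 7 + 1) fun a b x => ?_).snd.reverse fun a _ => ?_
  · have h1 := hp (x, b.1.headD Bool.false) trivial
    have h2 : sz (x, b.1.headD Bool.false) ≤ 7 := by
      have := sz_bool_le x
      have := sz_bool_le (b.1.headD Bool.false)
      simp only [sz_prod]; omega
    have h3 := eval_mono p h2
    have h4 : sz b.1.tail ≤ sz b.1 := sz_sublist (List.tail_sublist _)
    simp only [sz_prod, Polynomial.eval_add, Polynomial.eval_comp, Polynomial.eval_ofNat,
      Polynomial.eval_one] at *
    split
    · omega
    · simp only [sz_cons]; omega
  · have key : ∀ (l m : List Bool) (b : List β),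
        (l.foldl (fun (b : List Bool × List β) x => (b.1.tail,
          if b.1.isEmpty then b.2 else f x (b.1.headD Bool.false) :: b.2)) (m, b)).2
          = (List.zipWith f l m).reverse ++ b := by
      intro l
      induction l with
      | nil => simp
      | cons x l ih =>
        intro m b
        cases m with
        | nil => exact (ih [] b).trans (by simp)
        | cons y m => exact (ih m (f x y :: b)).trans (by simp)
    rw [key, List.append_nil, List.reverse_reverse]

end PolyTimeOn

end TreeMachine

/-! ## The algorithm

Sets of vertices are represented by their characteristic sequences. -/

namespace CliqueTreeAlgorithm

open TreeMachine

abbrev BSet : Type := List Bool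

/-- The result is cut to the shorter sequence; `extend` relies on this when it intersects a clique
of a smaller graph with a full row of the matrix. -/
def inter (s t : BSet) : BSet := List.zipWith (· && ·) s t

/-- Only common positions are compared, so `[]` is contained in everything; `maxLabel` uses it as
its starting value. -/
def sub (s t : BSet) : Bool := (List.zipWith (fun a b => !a || b) s t).all id

def ssub (s t : BSet) : Bool := sub s t && !sub t s

def eqv (s t : BSet) : Bool := sub s t && sub t s

/-- Does the set have at least three elements? -/
def big (s : BSet) : Bool := !(s.filter id).tail.tail.isEmpty

/-- Adds a set to an antichain and restores the antichain. -/
def insertMaximal (acc : List BSet) (K : BSet) : List BSet :=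
  if acc.any (fun L => sub K L) then acc else K :: acc.filter (fun L => !sub L K)

/-- The maximal cliques of a graph, given those of the graph without its last vertex and the
neighbors of that vertex. -/
def extend (cl : List BSet) (row : BSet) : List BSet :=
  (cl.map (fun K => K ++ [false]) ++ cl.map (fun K => inter K row ++ [true])).foldl
    insertMaximal []

/-- The graph without vertices has one maximal clique, the empty one, with characteristic sequence
`[]`. -/
def maxCliques (g : List BSet) : List BSet := g.foldl extend [[]]

/-- A maximal one among the intersections of a visited and an unvisited clique. -/
def maxLabel (V U : List BSet) : BSet :=
  (V.flatMap fun P => U.map fun K => inter P K).foldl (fun c x => if sub c x then x else c) []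

/-- Do all intersections of distinct unvisited cliques that strictly contain `S` lie in `C`? -/
def hub (U : List BSet) (S C : BSet) : Bool :=
  U.all fun L => U.all fun L' => eqv L L' || (!ssub S (inter L L') || sub (inter L L') C)

/-- Hubs stand first in the concatenation; the second filter matters only if there is no hub. -/
def next (U : List BSet) (S : BSet) : BSet :=
  (U.filter (fun K => sub S K && hub U S K) ++ U.filter (fun K => sub S K)).headD []

/-- Is no intersection of distinct unvisited cliques strictly larger than `S`? -/
def exhausted (U : List BSet) (S : BSet) : Bool :=
  U.all fun L => U.all fun L' => eqv L L' || !ssub S (inter L L')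

/-- Does `C` contain `S`, and is it incident to all the arcs with a label strictly larger
than `S`? -/
def center (E : List (BSet × BSet)) (S C : BSet) : Bool :=
  sub S C && E.all fun e => !ssub S (inter e.1 e.2) || (eqv C e.1 || eqv C e.2)

/-- As `V` is in the order of the visits, the head of a filtered list is the earliest candidate.
Centers come first when they are wanted; the second filter is the fallback. -/
def father (V : List BSet) (E : List (BSet × BSet)) (U : List BSet) (S : BSet) : BSet :=
  ((if big S && exhausted U S then V.filter (fun C => center E S C) else []) ++
    V.filter (fun C => sub S C)).headD []

/-- The visited cliques in the order of their visits, the arcs, and the unvisited cliques. -/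
abbrev State : Type := List BSet × List (BSet × BSet) × List BSet

def visit (V : List BSet) (E : List (BSet × BSet)) (U : List BSet) (S K : BSet) : State :=
  (V ++ [K], (K, father V E U S) :: E, U.filter fun L => !eqv L K)

def step (st : State) : State :=
  visit st.1 st.2.1 st.2.2 (maxLabel st.1 st.2.2) (next st.2.2 (maxLabel st.1 st.2.2))

def init (cl : List BSet) : State := ([cl.headD []], [], cl.tail)

/-- The list `cl.tail` serves only as a counter: there is one step for each clique other than the
root. -/
def search (cl : List BSet) : State := cl.tail.foldl (fun st _ => step st) (init cl)

def treeOf (cl : List BSet) : BSet × List (BSet × BSet) := (cl.headD [], (search cl).2.1)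

/-! ### Running time of the enumeration and of the search. -/

section PolyTime

variable {α : Type*} [Enc α] {D : α → Prop}

open PolyTimeOn

theorem inter_poly {f g : α → BSet} (hf : PolyTimeOn D f) (hg : PolyTimeOn D g) :
    PolyTimeOn D (fun a => inter (f a) (g a)) :=
  zipWith_bool (f := (· && ·)) (.and (.fst .id) (.snd .id)) hf hg

theorem sub_poly {f g : α → BSet} (hf : PolyTimeOn D f) (hg : PolyTimeOn D g) :
    PolyTimeOn D (fun a => sub (f a) (g a)) :=
  .all (f := fun _ b => b) (zipWith_bool (f := fun a b => !a || b)
    (.or (.not (.fst .id)) (.snd .id)) hf hg) (.snd .id)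

theorem ssub_poly {f g : α → BSet} (hf : PolyTimeOn D f) (hg : PolyTimeOn D g) :
    PolyTimeOn D (fun a => ssub (f a) (g a)) :=
  (sub_poly hf hg).and (sub_poly hg hf).not

theorem eqv_poly {f g : α → BSet} (hf : PolyTimeOn D f) (hg : PolyTimeOn D g) :
    PolyTimeOn D (fun a => eqv (f a) (g a)) :=
  (sub_poly hf hg).and (sub_poly hg hf)

theorem big_poly {f : α → BSet} (hf : PolyTimeOn D f) : PolyTimeOn D (fun a => big (f a)) :=
  (PolyTimeOn.filter (f := fun _ b => b) hf (.snd .id)).tail.tail.isEmpty.not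

theorem insertMaximal_poly {f : α → List BSet} {g : α → BSet} (hf : PolyTimeOn D f)
    (hg : PolyTimeOn D g) : PolyTimeOn D (fun a => insertMaximal (f a) (g a)) :=
  comp (g := fun z : List BSet × BSet => insertMaximal z.1 z.2)
    (.ite (.any (f := fun z L => sub z.2 L) (.fst .id) (sub_poly (.snd (.fst .id)) (.snd .id)))
      (.fst .id) (.cons (.snd .id) (.filter (f := fun z L => !sub L z.2) (.fst .id)
        (.not (sub_poly (.snd .id) (.snd (.fst .id))))))) (hf.prod hg)

theorem sz_insertMaximal_le (acc : List BSet) (K : BSet) :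
    sz (insertMaximal acc K) ≤ sz acc + sz K + 1 := by
  unfold insertMaximal
  split
  · omega
  · rw [sz_cons]
    have := sz_sublist (List.filter_sublist (l := acc) (p := fun L => !sub L K))
    omega

theorem extend_poly {f : α → List BSet} {g : α → BSet} (hf : PolyTimeOn D f)
    (hg : PolyTimeOn D g) : PolyTimeOn D (fun a => extend (f a) (g a)) :=
  comp (g := fun z : List BSet × BSet => extend z.1 z.2)
    (.foldl_of_add (s := fun _ => insertMaximal)
      (.append (.map (f := fun _ K => K ++ [false]) (.fst .id)
          (.append (.snd .id) (.cons .false .nil)))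
        (.map (f := fun z K => inter K z.2 ++ [true]) (.fst .id)
          (.append (inter_poly (.snd .id) (.snd (.fst .id))) (.cons .true .nil))))
      .nil (insertMaximal_poly (.fst (.snd .id)) (.snd (.snd .id))) (.X + 1) fun a b x => by
        have := sz_insertMaximal_le b x
        simp only [sz_prod, Polynomial.eval_add, Polynomial.eval_X, Polynomial.eval_one] at *
        omega) (hf.prod hg)

/-- The maximal cliques are listed in polynomial time as long as the intermediate lists are
small. -/
theorem maxCliques_poly {D : List BSet → Prop} (q : Polynomial ℕ)
    (hq : ∀ g, D g → ∀ m, m <+: g → sz (maxCliques m) ≤ q.eval (sz g)) :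
    PolyTimeOn D maxCliques :=
  .foldl (s := fun _ => extend) .id (.cons .nil .nil)
    (extend_poly (.fst (.snd .id)) (.snd (.snd .id))) q hq

theorem maxLabel_poly {f g : α → List BSet} (hf : PolyTimeOn D f) (hg : PolyTimeOn D g) :
    PolyTimeOn D (fun a => maxLabel (f a) (g a)) :=
  comp (g := fun z : List BSet × List BSet => maxLabel z.1 z.2)
    (.foldl_of_add (s := fun _ c x => if sub c x then x else c)
      (.flatMap (f := fun (z : List BSet × List BSet) P => z.2.map fun K => inter P K) (.fst .id)
        (.map (f := fun z K => inter z.2 K) (.snd (.fst .id))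
          (inter_poly (.snd (.fst .id)) (.snd .id))))
      .nil (.ite (sub_poly (.fst (.snd .id)) (.snd (.snd .id))) (.snd (.snd .id))
        (.fst (.snd .id))) .X fun a b x => by
        simp only [sz_prod, Polynomial.eval_X]
        split <;> omega) (hf.prod hg)

theorem hub_poly {u : α → List BSet} {s c : α → BSet} (hu : PolyTimeOn D u) (hs : PolyTimeOn D s)
    (hc : PolyTimeOn D c) : PolyTimeOn D (fun a => hub (u a) (s a) (c a)) := by
  have hL : PolyTime (fun z : ((List BSet × BSet × BSet) × BSet) × BSet => z.1.2) := .snd (.fst .id)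
  have hL' : PolyTime (fun z : ((List BSet × BSet × BSet) × BSet) × BSet => z.2) := .snd .id
  have hz : PolyTime (fun z : ((List BSet × BSet × BSet) × BSet) × BSet => z.1.1) := .fst (.fst .id)
  have h1 : PolyTime (fun z : (List BSet × BSet × BSet) × BSet => z.1.1.all fun L' =>
      eqv z.2 L' || (!ssub z.1.2.1 (inter z.2 L') || sub (inter z.2 L') z.1.2.2)) :=
    .all (.fst (.fst .id)) (.or (eqv_poly hL hL')
      (.or (.not (ssub_poly hz.snd.fst (inter_poly hL hL')))
        (sub_poly (inter_poly hL hL') hz.snd.snd)))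
  have h2 : PolyTime (fun z : List BSet × BSet × BSet => hub z.1 z.2.1 z.2.2) :=
    .all (f := fun (z : List BSet × BSet × BSet) L => z.1.all fun L' =>
      eqv L L' || (!ssub z.2.1 (inter L L') || sub (inter L L') z.2.2)) (.fst .id) h1
  exact h2.comp (hu.prod (hs.prod hc))

theorem next_poly {u : α → List BSet} {s : α → BSet} (hu : PolyTimeOn D u)
    (hs : PolyTimeOn D s) : PolyTimeOn D (fun a => next (u a) (s a)) := by
  have hS : PolyTime (fun z : (List BSet × BSet) × BSet => sub z.1.2 z.2) :=
    sub_poly (.snd (.fst .id)) (.snd .id)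
  have hH : PolyTime (fun z : (List BSet × BSet) × BSet => hub z.1.1 z.1.2 z.2) :=
    hub_poly (.fst (.fst .id)) (.snd (.fst .id)) (.snd .id)
  have h : PolyTime (fun z : List BSet × BSet => next z.1 z.2) :=
    .headD_nil (.append (.filter (f := fun z K => sub z.2 K && hub z.1 z.2 K) (.fst .id) (hS.and hH))
      (.filter (f := fun z K => sub z.2 K) (.fst .id) hS))
  exact h.comp (hu.prod hs)

theorem exhausted_poly {u : α → List BSet} {s : α → BSet} (hu : PolyTimeOn D u)
    (hs : PolyTimeOn D s) : PolyTimeOn D (fun a => exhausted (u a) (s a)) := by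
  have hL : PolyTime (fun z : ((List BSet × BSet) × BSet) × BSet => z.1.2) := .snd (.fst .id)
  have hL' : PolyTime (fun z : ((List BSet × BSet) × BSet) × BSet => z.2) := .snd .id
  have hz : PolyTime (fun z : ((List BSet × BSet) × BSet) × BSet => z.1.1) := .fst (.fst .id)
  have h1 : PolyTime (fun z : (List BSet × BSet) × BSet => z.1.1.all fun L' =>
      eqv z.2 L' || !ssub z.1.2 (inter z.2 L')) :=
    .all (.fst (.fst .id)) (.or (eqv_poly hL hL') (.not (ssub_poly hz.snd (inter_poly hL hL'))))
  have h2 : PolyTime (fun z : List BSet × BSet => exhausted z.1 z.2) :=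
    .all (f := fun z L => z.1.all fun L' => eqv L L' || !ssub z.2 (inter L L')) (.fst .id) h1
  exact h2.comp (hu.prod hs)

theorem center_poly {e : α → List (BSet × BSet)} {s c : α → BSet} (he : PolyTimeOn D e)
    (hs : PolyTimeOn D s) (hc : PolyTimeOn D c) :
    PolyTimeOn D (fun a => center (e a) (s a) (c a)) := by
  have hS : PolyTime (fun z : (List (BSet × BSet) × BSet × BSet) × BSet × BSet => z.1.2.1) :=
    .fst (.snd (.fst .id))
  have hC : PolyTime (fun z : (List (BSet × BSet) × BSet × BSet) × BSet × BSet => z.1.2.2) :=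
    .snd (.snd (.fst .id))
  have hE : PolyTime (fun z : (List (BSet × BSet) × BSet × BSet) × BSet × BSet => z.2) := .snd .id
  have h : PolyTime (fun z : List (BSet × BSet) × BSet × BSet => center z.1 z.2.1 z.2.2) :=
    .and (sub_poly (.fst (.snd .id)) (.snd (.snd .id)))
      (.all (f := fun (z : List (BSet × BSet) × BSet × BSet) (e : BSet × BSet) =>
          !ssub z.2.1 (inter e.1 e.2) || (eqv z.2.2 e.1 || eqv z.2.2 e.2)) (.fst .id)
        (.or (.not (ssub_poly hS (inter_poly hE.fst hE.snd)))
          (.or (eqv_poly hC hE.fst) (eqv_poly hC hE.snd))))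
  exact h.comp (he.prod (hs.prod hc))

theorem father_poly {v : α → List BSet} {e : α → List (BSet × BSet)} {u : α → List BSet}
    {s : α → BSet} (hv : PolyTimeOn D v) (he : PolyTimeOn D e) (hu : PolyTimeOn D u)
    (hs : PolyTimeOn D s) : PolyTimeOn D (fun a => father (v a) (e a) (u a) (s a)) := by
  have hE : PolyTime (fun z : List (BSet × BSet) × BSet => z.1) := .fst .id
  have hC : PolyTime (fun z : (List (BSet × BSet) × BSet) × BSet => center z.1.1 z.1.2 z.2) :=
    center_poly (.fst (.fst .id)) (.snd (.fst .id)) (.snd .id)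
  have hS : PolyTime (fun z : BSet × BSet => sub z.1 z.2) := sub_poly (.fst .id) (.snd .id)
  have h1 : PolyTime (fun z : List BSet × List (BSet × BSet) × BSet =>
      z.1.filter fun C => center z.2.1 z.2.2 C) :=
    .filter (f := fun (z : List BSet × List (BSet × BSet) × BSet) C => center z.2.1 z.2.2 C)
      (.fst .id) (hC.comp (.prod (.snd (.fst .id)) (.snd .id)))
  have h2 : PolyTime (fun z : List BSet × BSet => z.1.filter fun C => sub z.2 C) :=
    .filter (f := fun (z : List BSet × BSet) C => sub z.2 C)
      (.fst .id) (hS.comp (.prod (.snd (.fst .id)) (.snd .id)))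
  exact .headD_nil (.append (.ite (.and (big_poly hs) (exhausted_poly hu hs))
    (h1.comp (hv.prod (he.prod hs))) .nil) (h2.comp (hv.prod hs)))

theorem step_poly {f : α → State} (hf : PolyTimeOn D f) : PolyTimeOn D (fun a => step (f a)) := by
  have hV : PolyTime (fun st : State => st.1) := .fst .id
  have hE : PolyTime (fun st : State => st.2.1) := .fst (.snd .id)
  have hU : PolyTime (fun st : State => st.2.2) := .snd (.snd .id)
  have hS := maxLabel_poly hV hU
  have hK := next_poly hU hS
  have hF : PolyTime (fun z : List BSet × BSet => z.1.filter fun L => !eqv L z.2) :=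
    .filter (f := fun (z : List BSet × BSet) L => !eqv L z.2) (.fst .id)
      (.not (eqv_poly (.snd .id) (.snd (.fst .id))))
  have h : PolyTime step :=
    .prod (.append hV (.cons hK .nil)) (.prod (.cons (.prod hK (father_poly hV hE hU hS)) hE)
      (hF.comp (hU.prod hK)))
  exact h.comp hf

theorem sz_headD_le (l : List BSet) : sz (l.headD []) ≤ sz l := by
  cases l with
  | nil => exact le_rfl
  | cons a l => simp only [List.headD_cons, sz_cons]; omega

theorem sz_next_le (U : List BSet) (S : BSet) : sz (next U S) ≤ 2 * sz U := by
  refine (sz_headD_le _).trans ?_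
  have h1 := sz_append (U.filter (fun K => sub S K && hub U S K)) (U.filter (fun K => sub S K))
  have h2 := sz_sublist (List.filter_sublist (l := U) (p := fun K => sub S K && hub U S K))
  have h3 := sz_sublist (List.filter_sublist (l := U) (p := fun K => sub S K))
  omega

theorem sz_father_le (V : List BSet) (E : List (BSet × BSet)) (U : List BSet) (S : BSet) :
    sz (father V E U S) ≤ 2 * sz V := by
  refine (sz_headD_le _).trans ?_
  have h2 := sz_sublist (List.filter_sublist (l := V) (p := fun C => center E S C))
  have h3 := sz_sublist (List.filter_sublist (l := V) (p := fun K => sub S K))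
  have h4 := one_le_sz V
  split
  · have h1 := sz_append (V.filter (fun C => center E S C)) (V.filter (fun K => sub S K))
    omega
  · have h1 := sz_append ([] : List BSet) (V.filter (fun K => sub S K))
    rw [sz_nil] at h1
    omega

/-- The growth in one step depends on the state, so the three components are bounded in turn. The
unvisited list only shrinks and stays below `n`. Hence a newly visited clique has size at most `2 *
n` and the visited list is quadratic. An arc costs one such clique and a father of at most twice the
size of the visited list, so the arcs are cubic. -/
theorem search_poly : PolyTime search := by
  refine .foldl (s := fun _ st _ => step st) (.tail .id)
    (.prod (.cons (.headD_nil .id) .nil) (.prod .nil (.tail .id)))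
    (step_poly (.fst (.snd .id)))
    ((.X + 2 + .X * (2 * .X + 2)) + (1 + .X * (2 * .X + 2 + 2 * (.X + 2 + .X * (2 * .X + 2)) + 2))
      + .X + 2) fun cl _ m hm => ?_
  set n := sz cl with hn
  have hlen : m.length ≤ n :=
    hm.length_le.trans ((length_le_sz _).trans (sz_sublist (List.tail_sublist _)))
  have key : ∀ m : List BSet, m.length ≤ n →
      sz (m.foldl (fun st _ => step st) (init cl)).2.2 ≤ n ∧
      sz (m.foldl (fun st _ => step st) (init cl)).1 ≤ n + 2 + m.length * (2 * n + 2) ∧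
      sz (m.foldl (fun st _ => step st) (init cl)).2.1 ≤
        1 + m.length * (2 * n + 2 + 2 * (n + 2 + n * (2 * n + 2)) + 2) := by
    intro m
    induction m using List.reverseRecOn with
    | nil =>
      intro _
      have h1 := sz_headD_le cl
      have h2 := sz_sublist (List.tail_sublist cl)
      simp only [List.foldl_nil, init, sz_cons, sz_nil, List.length_nil]
      omega
    | append_singleton m x ih =>
      intro hm
      rw [List.length_append, List.length_singleton] at hm ⊢
      obtain ⟨h1, h2, h3⟩ := ih (by omega)
      rw [List.foldl_append, List.foldl_cons, List.foldl_nil]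
      set st := m.foldl (fun st _ => step st) (init cl)
      have hmul : m.length * (2 * n + 2) ≤ n * (2 * n + 2) := Nat.mul_le_mul_right _ (by omega)
      have hK := sz_next_le st.2.2 (maxLabel st.1 st.2.2)
      have hP := sz_father_le st.1 st.2.1 st.2.2 (maxLabel st.1 st.2.2)
      have hU := sz_sublist (List.filter_sublist (l := st.2.2)
        (p := fun L => !eqv L (next st.2.2 (maxLabel st.1 st.2.2))))
      have hV := sz_append st.1 [next st.2.2 (maxLabel st.1 st.2.2)]
      simp only [step, visit, sz_cons, sz_prod, sz_nil, Nat.succ_mul] at *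
      omega
  obtain ⟨h1, h2, h3⟩ := key m hlen
  have h4 : m.length * (2 * n + 2) ≤ n * (2 * n + 2) := Nat.mul_le_mul_right _ hlen
  have h5 : m.length * (2 * n + 2 + 2 * (n + 2 + n * (2 * n + 2)) + 2) ≤
    n * (2 * n + 2 + 2 * (n + 2 + n * (2 * n + 2)) + 2) := Nat.mul_le_mul_right _ hlen
  change sz (m.foldl (fun st _ => step st) (init cl)) ≤ _
  rw [sz_prod, sz_prod]
  simp only [Polynomial.eval_add, Polynomial.eval_mul, Polynomial.eval_X, Polynomial.eval_one,
    Polynomial.eval_ofNat]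
  omega

theorem treeOf_poly : PolyTime treeOf :=
  .prod (.headD_nil .id) (.fst (.snd (search_poly.comp .id)))

end PolyTime

end CliqueTreeAlgorithm

/-! ## Chordal graphs and families of visited cliques -/

namespace ChordalGraph

variable {V : Type*} {G : SimpleGraph V}

theorem exists_chain_of_reflTransGen {α : Type*} {r : α → α → Prop} {a b : α}
    (h : Relation.ReflTransGen r a b) :
    ∃ (n : ℕ) (p : ℕ → α), p 0 = a ∧ p n = b ∧ ∀ i < n, r (p i) (p (i + 1)) := by
  induction h using Relation.ReflTransGen.head_induction_on with
  | refl => exact ⟨0, fun _ => b, rfl, rfl, by simp⟩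
  | head hac _ ih =>
    rename_i a c _
    obtain ⟨n, p, h0, hn, hp⟩ := ih
    refine ⟨n + 1, fun i => i.casesOn a p, rfl, hn, fun i hi => ?_⟩
    cases i with
    | zero => simpa [h0] using hac
    | succ i => exact hp i (by omega)

/-- In a chordal graph, an induced path of positive length cannot be closed to an induced cycle by
an edge whose ends are adjacent to one end of the path each. -/
theorem IsChordal.not_induced_path (hG : IsChordal G) {m : ℕ} (hm : 1 ≤ m) {p : ℕ → V} {a c : V}
    (hadj : ∀ i < m, G.Adj (p i) (p (i + 1)))
    (hind : ∀ i j, i + 1 < j → j ≤ m → ¬ G.Adj (p i) (p j) ∧ p i ≠ p j)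
    (hac : G.Adj a c) (ha : G.Adj a (p 0)) (ha' : ∀ i, 0 < i → i ≤ m → ¬ G.Adj a (p i))
    (hap : ∀ i ≤ m, a ≠ p i) (hc : G.Adj c (p m)) (hc' : ∀ i < m, ¬ G.Adj c (p i))
    (hcp : ∀ i ≤ m, c ≠ p i) : False := by
  classical
  -- The cycle is `p 0, …, p m, c, a`, of length `m + 3 ≥ 4`.
  set f : ℕ → V := fun t => if t ≤ m then p t else if t = m + 1 then c else a with hf
  have hfp : ∀ t, t ≤ m → f t = p t := fun t ht => if_pos ht
  have hfc : f (m + 1) = c := by simp [hf]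
  have hfa : f (m + 2) = a := by simp [hf]
  have key : ∀ u v : ℕ, u < v → v < m + 3 →
      (f u ≠ f v ∧ (G.Adj (f u) (f v) ↔ v = u + 1 ∨ (u = 0 ∧ v = m + 2))) := by
    intro u v huv hv
    rcases Nat.lt_or_ge v (m + 1) with h1 | h1
    · rw [hfp u (by omega), hfp v (by omega)]
      rcases Nat.lt_or_ge (u + 1) v with h2 | h2
      · have := hind u v h2 (by omega)
        refine ⟨this.2, iff_of_false this.1 (by omega)⟩
      · obtain rfl : v = u + 1 := by omega
        have := hadj u (by omega)
        exact ⟨this.ne, iff_of_true this (by omega)⟩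
    · rcases Nat.lt_or_ge v (m + 2) with h2 | h2
      · obtain rfl : v = m + 1 := by omega
        rw [hfc, hfp u (by omega)]
        refine ⟨(hcp u (by omega)).symm, ?_⟩
        rw [G.adj_comm]
        rcases Nat.lt_or_ge u m with h3 | h3
        · exact iff_of_false (hc' u h3) (by omega)
        · obtain rfl : u = m := by omega
          exact iff_of_true hc (by omega)
      · obtain rfl : v = m + 2 := by omega
        rw [hfa]
        rcases Nat.lt_or_ge u (m + 1) with h3 | h3
        · rw [hfp u (by omega)]
          refine ⟨(hap u (by omega)).symm, ?_⟩
          rw [G.adj_comm]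
          rcases Nat.eq_zero_or_pos u with rfl | h4
          · exact iff_of_true ha (by omega)
          · exact iff_of_false (ha' u h4 (by omega)) (by omega)
        · obtain rfl : u = m + 1 := by omega
          rw [hfc]
          exact ⟨hac.ne', iff_of_true hac.symm (by omega)⟩
  have hinj : Function.Injective (fun t : Fin (m + 3) => f t) := by
    intro u v huv
    rcases lt_trichotomy u.1 v.1 with h | h | h
    · exact ((key u v h v.2).1 huv).elim
    · exact Fin.ext h
    · exact ((key v u h u.2).1 huv.symm).elim
  refine hG (m + 3) (by omega) ⟨⟨⟨_, hinj⟩, fun {u v} => ?_⟩⟩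
  simp only [Function.Embedding.coeFn_mk]
  have hcyc : ∀ u v : Fin (m + 3), u.1 < v.1 → ((SimpleGraph.cycleGraph (m + 3)).Adj u v ↔
      v.1 = u.1 + 1 ∨ (u.1 = 0 ∧ v.1 = m + 2)) := by
    intro u v huv
    rw [SimpleGraph.cycleGraph_adj', Fin.val_sub, Fin.val_sub]
    have hu := u.2
    have hv := v.2
    have e1 : m + 3 - v.1 + u.1 = m + 3 - (v.1 - u.1) := by omega
    have e2 : (m + 3 - u.1 + v.1) % (m + 3) = v.1 - u.1 := by
      rw [show m + 3 - u.1 + v.1 = (v.1 - u.1) + (m + 3) by omega, Nat.add_mod_right,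
        Nat.mod_eq_of_lt (by omega)]
    rw [e1, e2, Nat.mod_eq_of_lt (by omega)]
    omega
  rcases lt_trichotomy u.1 v.1 with h | h | h
  · rw [hcyc u v h, (key u v h v.2).2]
  · obtain rfl := Fin.ext h
    simp
  · rw [G.adj_comm, (SimpleGraph.cycleGraph (m + 3)).adj_comm u v, hcyc v u h, (key v u h u.2).2]

/-- `D` induces a connected (or empty) subgraph. -/
def ConnectedOn (G : SimpleGraph V) (D : Set V) : Prop :=
  ∀ x ∈ D, ∀ y ∈ D, Relation.ReflTransGen (fun a b => G.Adj a b ∧ b ∈ D) x y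

/-- If each vertex of a clique has a neighbor in a connected set, then some vertex of that set is
adjacent to the whole clique. -/
theorem IsChordal.exists_forall_adj [Finite V] (hG : IsChordal G) {C D : Set V}
    (hC : G.IsClique C) (hD : ConnectedOn G D) (hne : D.Nonempty) (hdisj : Disjoint C D)
    (hCD : ∀ c ∈ C, ∃ d ∈ D, G.Adj c d) : ∃ y ∈ D, ∀ c ∈ C, G.Adj c y := by
  classical
  -- Extremal choice: `y` has the most neighbors in `C`. A vertex `c` of `C` not adjacent to `y`
  -- will lead to a vertex of `D` with strictly more.
  obtain ⟨y, hy, hmax⟩ := Set.exists_max_image D (fun y => (C ∩ {c | G.Adj c y}).ncard)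
    D.toFinite hne
  refine ⟨y, hy, fun c hc => ?_⟩
  by_contra hcy
  -- a shortest path in `D` from `y` to a neighbor of `c`
  have hex : ∃ n, ∃ p : ℕ → V, p 0 = y ∧ G.Adj c (p n) ∧ (∀ i ≤ n, p i ∈ D) ∧
      ∀ i < n, G.Adj (p i) (p (i + 1)) := by
    obtain ⟨z, hz, hcz⟩ := hCD c hc
    obtain ⟨n, p, h0, hn, hp⟩ := exists_chain_of_reflTransGen (hD y hy z hz)
    refine ⟨n, p, h0, hn ▸ hcz, fun i hi => ?_, fun i hi => (hp i hi).1⟩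
    cases i with
    | zero => exact h0 ▸ hy
    | succ i => exact (hp i (by omega)).2
  obtain ⟨p, h0, hcn, hpD, hadj⟩ := Nat.find_spec hex
  set n := Nat.find hex
  have hmin : ∀ k < n, ¬ ∃ p : ℕ → V, p 0 = y ∧ G.Adj c (p k) ∧ (∀ i ≤ k, p i ∈ D) ∧
      ∀ i < k, G.Adj (p i) (p (i + 1)) := fun k hk => Nat.find_min hex hk
  have hnpos : 0 < n := by
    rcases Nat.eq_zero_or_pos n with h | h
    · rw [h, h0] at hcn; exact (hcy hcn).elim
    · exact h
  have hcp : ∀ i < n, ¬ G.Adj c (p i) := fun i hi hci =>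
    hmin i hi ⟨p, h0, hci, fun j hj => hpD j (by omega), fun j hj => hadj j (by omega)⟩
  -- A chord from `p i` to `p j` would save `j - i - 1` steps, and an equality `j - i` steps.
  have hind : ∀ i j, i + 1 < j → j ≤ n → ¬ G.Adj (p i) (p j) ∧ p i ≠ p j := by
    intro i j hij hj
    constructor
    · intro hadj'
      refine hmin (n - (j - i - 1)) (by omega)
        ⟨fun t => if t ≤ i then p t else p (t + (j - i - 1)), by simpa, ?_, ?_, ?_⟩
      · dsimp only
        rw [if_neg (by omega), show n - (j - i - 1) + (j - i - 1) = n by omega]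
        exact hcn
      · intro t ht
        dsimp only
        split
        · exact hpD _ (by omega)
        · exact hpD _ (by omega)
      · intro t ht
        dsimp only
        rcases lt_trichotomy t i with h | h | h
        · rw [if_pos (by omega), if_pos (by omega)]
          exact hadj t (by omega)
        · rw [if_pos (by omega), if_neg (by omega), show t + 1 + (j - i - 1) = j by omega, h]
          exact hadj'
        · rw [if_neg (by omega), if_neg (by omega),
            show t + 1 + (j - i - 1) = t + (j - i - 1) + 1 by omega]
          exact hadj _ (by omega)
    · intro heq
      rcases Nat.lt_or_ge j n with h | h
      · refine hmin (n - (j - i)) (by omega)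
          ⟨fun t => if t ≤ i then p t else p (t + (j - i)), by simpa, ?_, ?_, ?_⟩
        · dsimp only
          rw [if_neg (by omega), show n - (j - i) + (j - i) = n by omega]
          exact hcn
        · intro t ht
          dsimp only
          split
          · exact hpD _ (by omega)
          · exact hpD _ (by omega)
        · intro t ht
          dsimp only
          rcases lt_trichotomy t i with h | h | h
          · rw [if_pos (by omega), if_pos (by omega)]
            exact hadj t (by omega)
          · rw [if_pos (by omega), if_neg (by omega), h, heq,
              show i + 1 + (j - i) = j + 1 by omega]
            exact hadj j (by omega)
          · rw [if_neg (by omega), if_neg (by omega),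
              show t + 1 + (j - i) = t + (j - i) + 1 by omega]
            exact hadj _ (by omega)
      · obtain rfl : j = n := by omega
        exact hcp i (by omega) (heq ▸ hcn)
  have hne' : ∀ c ∈ C, ∀ i ≤ n, c ≠ p i := fun c hc i hi e =>
    Set.disjoint_left.1 hdisj hc (e ▸ hpD i hi)
  -- the last vertex of the path is adjacent to more vertices of the clique
  have hsub : ∀ a ∈ C, G.Adj a y → G.Adj a (p n) := by
    intro a ha hay
    by_contra han
    -- From the last neighbor of `a` on the path, the rest of the path closes through `c` and `a` to
    -- an induced cycle of length at least four.
    set i := Nat.findGreatest (fun i => G.Adj a (p i)) n with hi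
    have hai : G.Adj a (p i) :=
      Nat.findGreatest_spec (P := fun i => G.Adj a (p i)) (Nat.zero_le n) (by rwa [h0])
    have hin : i ≤ n := Nat.findGreatest_le n
    have hin' : i ≠ n := fun e => han (e ▸ hai)
    have hlast : ∀ j, i < j → j ≤ n → ¬ G.Adj a (p j) := fun j hj hjn =>
      Nat.findGreatest_is_greatest hj hjn
    refine hG.not_induced_path (m := n - i) (p := fun t => p (i + t)) (a := a) (c := c)
      (by omega) (fun t ht => hadj (i + t) (by omega))
      (fun t u htu hu => hind (i + t) (i + u) (by omega) (by omega))
      (hC ha hc fun e => hcy (e ▸ hay)) hai (fun t ht ht' => hlast _ (by omega) (by omega))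
      (fun t ht => hne' a ha _ (by omega)) ?_ (fun t ht => hcp _ (by omega))
      (fun t ht => hne' c hc _ (by omega))
    simpa [Nat.add_sub_cancel' hin] using hcn
  have hlt : (C ∩ {c | G.Adj c y}).ncard < (C ∩ {c | G.Adj c (p n)}).ncard :=
    Set.ncard_lt_ncard ⟨fun a ha => ⟨ha.1, hsub a ha.1 ha.2⟩, fun h => hcy (h ⟨hc, hcn⟩).2⟩
      (Set.toFinite _)
  exact absurd (hmax (p n) (hpD n le_rfl)) (not_le.2 hlt)

/-! ### Explored families and their extension by one clique. -/

theorem exists_maximal_clique [Finite V] {Q : Set V} (hQ : G.IsClique Q) :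
    ∃ K, Q ⊆ K ∧ Maximal G.IsClique K :=
  (Set.toFinite {K | G.IsClique K}).exists_le_maximal hQ

/-- A family of cliques that a search may have visited: every clique in its union lies in a member,
and so do the neighbors in the union of each connected set outside the union. -/
structure Explored (G : SimpleGraph V) (A : Set (Set V)) : Prop where
  nonempty : A.Nonempty
  maximal : ∀ X ∈ A, Maximal G.IsClique X
  subset : ∀ Q, G.IsClique Q → Q ⊆ ⋃₀ A → ∃ X ∈ A, Q ⊆ X
  neighbors : ∀ D, ConnectedOn G D → Disjoint D (⋃₀ A) →
    ∃ X ∈ A, ∀ u ∈ ⋃₀ A, (∃ d ∈ D, G.Adj u d) → u ∈ X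

theorem explored_singleton {K : Set V} (hK : Maximal G.IsClique K) : Explored G {K} where
  nonempty := Set.singleton_nonempty K
  maximal := by rintro X rfl; exact hK
  subset := by simp
  neighbors D _ _ := ⟨K, rfl, fun u hu _ => by simpa using hu⟩

theorem Explored.not_subset {A : Set (Set V)} (hA : Explored G A) {K : Set V}
    (hK : Maximal G.IsClique K) (hKA : K ∉ A) : ¬ K ⊆ ⋃₀ A := by
  intro hsub
  obtain ⟨X, hX, hKX⟩ := hA.subset K hK.prop hsub
  exact hKA (hK.eq_of_subset (hA.maximal X hX).prop hKX ▸ hX)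

/-- The neighbors in the union of the visited cliques of the component that contains the new part
of a clique `K` are exactly the intersection of `K` with a visited clique `P`, if the latter is
maximal. -/
theorem Explored.exists_component [Finite V] (hG : IsChordal G) {A : Set (Set V)}
    (hA : Explored G A) {K P : Set V} (hK : Maximal G.IsClique K) (hKA : K ∉ A) (hP : P ∈ A)
    (hmax : ∀ X ∈ A, ∀ Y, Maximal G.IsClique Y → Y ∉ A → ¬ P ∩ K ⊂ X ∩ Y) :
    ∃ D, K \ ⋃₀ A ⊆ D ∧ (∀ u ∈ ⋃₀ A, (∃ d ∈ D, G.Adj u d) ↔ u ∈ P ∩ K) ∧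
      Disjoint D (⋃₀ A) ∧ ∀ u ∈ D, ∀ v, v ∉ ⋃₀ A → G.Adj u v → v ∈ D := by
  obtain ⟨d, hdK, hdA⟩ := Set.not_subset.1 (hA.not_subset hK hKA)
  -- The component, outside the visited union, of a new vertex `d` of `K`.
  set D : Set V := {x | Relation.ReflTransGen (fun a b => G.Adj a b ∧ b ∉ ⋃₀ A) d x} with hDdef
  have hdisj : Disjoint D (⋃₀ A) := by
    refine Set.disjoint_left.2 fun x hx => ?_
    rcases Relation.ReflTransGen.cases_tail hx with h | ⟨_, _, h⟩
    · rwa [h]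
    · exact h.2
  have hclosed : ∀ u ∈ D, ∀ v, v ∉ ⋃₀ A → G.Adj u v → v ∈ D := fun u hu v hv huv =>
    Relation.ReflTransGen.tail hu ⟨huv, hv⟩
  have hfrom : ∀ x ∈ D, Relation.ReflTransGen (fun a b => G.Adj a b ∧ b ∈ D) d x := by
    intro x hx
    induction hx with
    | refl => exact .refl
    | tail h₁ h₂ ih => exact ih.tail ⟨h₂.1, hclosed _ h₁ _ h₂.2 h₂.1⟩
  have hto : ∀ x ∈ D, Relation.ReflTransGen (fun a b => G.Adj a b ∧ b ∈ D) x d := by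
    intro x hx
    induction hx with
    | refl => exact .refl
    | tail h₁ h₂ ih => exact .head ⟨h₂.1.symm, h₁⟩ ih
  have hconn : ConnectedOn G D := fun x hx y hy => (hto x hx).trans (hfrom y hy)
  have hdD : d ∈ D := .refl
  obtain ⟨X, hX, hNX⟩ := hA.neighbors D hconn hdisj
  set N : Set V := {u | u ∈ ⋃₀ A ∧ ∃ x ∈ D, G.Adj u x} with hN
  have hNclique : G.IsClique N := (hA.maximal X hX).prop.subset fun u hu => hNX u hu.1 hu.2
  -- Chordality gives `y ∈ D` adjacent to all of `N`. A maximal clique `Y` containing `N` and `y` is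
  -- unvisited, and `P ∩ K ⊆ N ⊆ X ∩ Y`; maximality of `P ∩ K` turns both inclusions into
  -- equalities.
  obtain ⟨y, hy, hyN⟩ := hG.exists_forall_adj hNclique hconn ⟨d, hdD⟩
    (Set.disjoint_left.2 fun u hu hu' => Set.disjoint_left.1 hdisj hu' hu.1) fun u hu => hu.2
  have hQ : G.IsClique (insert y N) := hNclique.insert fun u hu _ => (hyN u hu).symm
  obtain ⟨Y, hQY, hY⟩ := exists_maximal_clique hQ
  have hyA : y ∉ ⋃₀ A := Set.disjoint_left.1 hdisj hy
  have hYA : Y ∉ A := fun h => hyA ⟨Y, h, hQY (Set.mem_insert y N)⟩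
  have hNXY : N ⊆ X ∩ Y := fun u hu => ⟨hNX u hu.1 hu.2, hQY (Set.mem_insert_of_mem y hu)⟩
  have hPN : P ∩ K ⊆ N := fun u hu => ⟨⟨P, hP, hu.1⟩, d, hdD, hK.prop hu.2 hdK
    (fun e => hdA (e ▸ ⟨P, hP, hu.1⟩))⟩
  have heq : P ∩ K = X ∩ Y := by
    by_contra hne
    exact hmax X hX Y hY hYA ((hPN.trans hNXY).ssubset_of_ne hne)
  refine ⟨D, fun x hx => ?_, fun u hu => ⟨fun h => ?_, fun h => (hPN h).2⟩, hdisj, hclosed⟩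
  · rcases eq_or_ne d x with rfl | hne
    · exact hdD
    · exact hclosed d hdD x hx.2 (hK.prop hdK hx.1 hne)
  · rw [heq]
    exact hNXY ⟨hu, h⟩

/-- A vertex common to `K` and a visited clique is adjacent to a new vertex of `K`, hence is a
visited neighbor of the component. This is the running intersection property behind the clique-tree.
-/
theorem Explored.inter_subset [Finite V] (hG : IsChordal G) {A : Set (Set V)}
    (hA : Explored G A) {K P : Set V} (hK : Maximal G.IsClique K) (hKA : K ∉ A) (hP : P ∈ A)
    (hmax : ∀ X ∈ A, ∀ Y, Maximal G.IsClique Y → Y ∉ A → ¬ P ∩ K ⊂ X ∩ Y) {X : Set V}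
    (hX : X ∈ A) : X ∩ K ⊆ P ∩ K := by
  obtain ⟨D, hD, hN, hdisj, -⟩ := hA.exists_component hG hK hKA hP hmax
  obtain ⟨d, hdK, hdA⟩ := Set.not_subset.1 (hA.not_subset hK hKA)
  exact fun u hu => (hN u ⟨X, hX, hu.1⟩).1
    ⟨d, hD ⟨hdK, hdA⟩, hK.prop hu.2 hdK fun e => hdA (e ▸ ⟨X, hX, hu.1⟩)⟩

/-- A clique using a new vertex of `K` has its old vertices among the neighbors of the component
`D`, hence in `K`. A connected set outside the new union either lies in `D`, and then `K` contains
its neighbors, or avoids `D`, and then it has no neighbor among the new vertices. -/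
theorem Explored.insert [Finite V] (hG : IsChordal G) {A : Set (Set V)}
    (hA : Explored G A) {K P : Set V} (hK : Maximal G.IsClique K) (hKA : K ∉ A) (hP : P ∈ A)
    (hmax : ∀ X ∈ A, ∀ Y, Maximal G.IsClique Y → Y ∉ A → ¬ P ∩ K ⊂ X ∩ Y) :
    Explored G (insert K A) := by
  obtain ⟨D, hKD, hN, hdisj, hclosed⟩ := hA.exists_component hG hK hKA hP hmax
  refine ⟨Set.insert_nonempty K A, ?_, fun Q hQ hQA => ?_, fun D' hD' hdisj' => ?_⟩
  · rintro X (rfl | hX)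
    exacts [hK, hA.maximal X hX]
  · rw [Set.sUnion_insert] at hQA
    by_cases hsub : Q ⊆ ⋃₀ A
    · obtain ⟨X, hX, hQX⟩ := hA.subset Q hQ hsub
      exact ⟨X, Set.mem_insert_of_mem K hX, hQX⟩
    · obtain ⟨q, hq, hqA⟩ := Set.not_subset.1 hsub
      have hqD := hKD ⟨(hQA hq).resolve_right hqA, hqA⟩
      refine ⟨K, Set.mem_insert K A, fun u hu => ?_⟩
      rcases hQA hu with h | h
      · exact h
      · exact ((hN u h).1 ⟨q, hqD, hQ hu hq fun e => hqA (e ▸ h)⟩).2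
  · rw [Set.sUnion_insert, Set.disjoint_union_right] at hdisj'
    rw [Set.sUnion_insert]
    by_cases hDD : ∃ x ∈ D', x ∈ D
    · obtain ⟨x, hx, hxD⟩ := hDD
      have hsub : ∀ z ∈ D', z ∈ D := by
        intro z hz
        have := hD' x hx z hz
        induction this with
        | refl => exact hxD
        | tail h₁ h₂ ih =>
          rename_i b c
          have hb : b ∈ D' := by
            rcases Relation.ReflTransGen.cases_tail h₁ with h | ⟨_, _, h⟩
            · rwa [h]
            · exact h.2
          exact hclosed _ (ih hb) _ (Set.disjoint_left.1 hdisj'.2 h₂.2) h₂.1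
      refine ⟨K, Set.mem_insert K A, fun u hu ⟨d, hd, hud⟩ => ?_⟩
      rcases hu with h | h
      · exact h
      · exact ((hN u h).1 ⟨d, hsub d hd, hud⟩).2
    · push Not at hDD
      obtain ⟨X, hX, hNX⟩ := hA.neighbors D' hD' hdisj'.2
      refine ⟨X, Set.mem_insert_of_mem K hX, fun u hu ⟨d, hd, hud⟩ => ?_⟩
      by_cases huA : u ∈ ⋃₀ A
      · exact hNX u huA ⟨d, hd, hud⟩
      · have huD := hKD ⟨hu.resolve_right huA, huA⟩
        exact (hDD d hd (hclosed u huD d (Set.disjoint_left.1 hdisj'.2 hd) hud)).elim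

/-- As long as there is an unvisited clique, some intersection of a visited and an unvisited clique
is maximal. -/
theorem exists_maximal_inter [Finite V] {A : Set (Set V)} (hA : A.Nonempty)
    {K : Set V} (hK : Maximal G.IsClique K) (hKA : K ∉ A) :
    ∃ P ∈ A, ∃ K, Maximal G.IsClique K ∧ K ∉ A ∧
      ∀ X ∈ A, ∀ Y, Maximal G.IsClique Y → Y ∉ A → ¬ P ∩ K ⊂ X ∩ Y := by
  obtain ⟨P, hP⟩ := hA
  obtain ⟨S, ⟨P, hP, K, hK, hKA, rfl⟩, hmax⟩ := Set.Finite.exists_maximal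
    (s := {S | ∃ X ∈ A, ∃ Y, Maximal G.IsClique Y ∧ Y ∉ A ∧ S = X ∩ Y}) (Set.toFinite _)
    ⟨_, P, hP, K, hK, hKA, rfl⟩
  exact ⟨P, hP, K, hK, hKA, fun X hX Y hY hYA hlt =>
    hlt.2 (hmax ⟨X, hX, Y, hY, hYA, rfl⟩ hlt.1)⟩

/-- A chordal graph has at most as many maximal cliques as vertices. -/
theorem IsChordal.ncard_maximal_cliques_le [Finite V] (hG : IsChordal G) :
    {K | Maximal G.IsClique K}.ncard ≤ Nat.card V + 1 := by
  obtain ⟨K₀, -, hK₀⟩ := exists_maximal_clique (G := G) (Set.pairwise_empty _)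
  -- An insertion adds one clique and at least one vertex, so it preserves the inequality; a largest
  -- such family therefore contains all maximal cliques.
  obtain ⟨A, ⟨hA, hcard⟩, hmax⟩ := Set.exists_max_image
    {A : Set (Set V) | Explored G A ∧ A.ncard ≤ (⋃₀ A).ncard + 1} Set.ncard (Set.toFinite _)
    ⟨{K₀}, explored_singleton hK₀, by simp⟩
  have hall : ∀ K, Maximal G.IsClique K → K ∈ A := by
    intro K hK
    by_contra hKA
    obtain ⟨P, hP, K, hK, hKA, hm⟩ := exists_maximal_inter hA.nonempty hK hKA
    have h1 := hA.insert hG hK hKA hP hm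
    have h2 := Set.ncard_insert_of_notMem hKA (Set.toFinite A)
    have h3 : (⋃₀ A).ncard < (⋃₀ insert K A).ncard := by
      refine Set.ncard_lt_ncard ⟨Set.sUnion_subset_sUnion (Set.subset_insert K A), fun h => ?_⟩
        (Set.toFinite _)
      exact hA.not_subset hK hKA ((Set.subset_sUnion_of_mem (Set.mem_insert K A)).trans h)
    have := hmax _ ⟨h1, by omega⟩
    omega
  have h1 : {K | Maximal G.IsClique K}.ncard ≤ A.ncard := Set.ncard_le_ncard hall (Set.toFinite A)
  have h2 : (⋃₀ A).ncard ≤ Nat.card V := Set.ncard_le_card _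
  omega

end ChordalGraph

/-! ## Search orders and convergence -/

namespace ChordalGraph

/-- The separator between a node and its father. -/
def label {V X : Type*} (k : X → Set V) (par : X → X) (x : X) : Set V := k x ∩ k (par x)

/-- `b` contains all intersections of distinct nodes, not before `x`, that strictly contain `S`. -/
def IsHub {V X : Type*} (k : X → Set V) (idx : X → ℕ) (x : X) (S : Set V) (b : X) : Prop :=
  ∀ c d : X, idx x ≤ idx c → idx x ≤ idx d → c ≠ d → S ⊂ k c ∩ k d → k c ∩ k d ⊆ k b

/-- No two distinct nodes not before `x` have an intersection that strictly contains `S`. -/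
def Exhausted {V X : Type*} (k : X → Set V) (idx : X → ℕ) (x : X) (S : Set V) : Prop :=
  ∀ c d : X, idx x ≤ idx c → idx x ≤ idx d → c ≠ d → ¬ S ⊂ k c ∩ k d

/-- `c` comes before `x`, contains `S`, and is incident to all the arcs before `x` whose label
strictly contains `S`. -/
def IsCenterBefore {V X : Type*} (k : X → Set V) (idx : X → ℕ) (par : X → X) (root : X)
    (x : X) (S : Set V) (c : X) : Prop :=
  idx c < idx x ∧ S ⊆ k c ∧
    ∀ j : X, j ≠ root → idx j < idx x → S ⊂ label k par j → c = j ∨ c = par j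

/-- The order in which a greedy search visits the nodes, together with the fathers it chooses. -/
structure SearchOrder {V X : Type*} (k : X → Set V) (idx : X → ℕ) (par : X → X) (root : X) :
    Prop where
  idx_injective : Function.Injective idx
  idx_root : idx root = 0
  idx_par_lt : ∀ x, x ≠ root → idx (par x) < idx x
  inter_subset : ∀ x a, x ≠ root → idx a < idx x → k a ∩ k x ⊆ k (par x)
  maximal : ∀ x a b, x ≠ root → idx a < idx x → idx x ≤ idx b → ¬ label k par x ⊂ k a ∩ k b
  isHub : ∀ x b, x ≠ root → idx x ≤ idx b → label k par x ⊆ k b →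
    IsHub k idx x (label k par x) b → IsHub k idx x (label k par x) x
  isCenterBefore : ∀ x c, x ≠ root → 3 ≤ (label k par x).ncard →
    Exhausted k idx x (label k par x) → IsCenterBefore k idx par root x (label k par x) c →
    IsCenterBefore k idx par root x (label k par x) (par x) ∧ idx (par x) ≤ idx c
  isFirst : ∀ x c, x ≠ root →
    ¬ (3 ≤ (label k par x).ncard ∧ Exhausted k idx x (label k par x) ∧
      ∃ c, IsCenterBefore k idx par root x (label k par x) c) →
    label k par x ⊆ k c → idx (par x) ≤ idx c

namespace SearchOrder

variable {V X : Type*} {k : X → Set V} {idx : X → ℕ} {par : X → X} {root : X}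

theorem ne_root_of_lt (h : SearchOrder k idx par root) {x y : X} (hxy : idx x < idx y) :
    y ≠ root := by
  rintro rfl
  have := h.idx_root
  omega

/-- This reduces intersections of arbitrary pairs of nodes to labels of arcs. -/
theorem inter_subset_label (h : SearchOrder k idx par root) {x y : X} (hxy : idx x < idx y) :
    k x ∩ k y ⊆ label k par y :=
  fun _ hv => ⟨hv.2, h.inter_subset y x (h.ne_root_of_lt hxy) hxy hv⟩

theorem ssubset_label (h : SearchOrder k idx par root) {S : Set V} {x y : X}
    (hxy : idx x < idx y) (hS : S ⊂ k x ∩ k y) : S ⊂ label k par y :=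
  hS.trans_subset (h.inter_subset_label hxy)

/-- Both rules for the father take the earliest candidate, and `c` is a candidate under either of
them. -/
theorem par_le_of_subset (h : SearchOrder k idx par root) {x c : X} (hx : x ≠ root)
    (hc : idx c < idx x) (hS : label k par x ⊆ k c)
    (hI : ∀ j, j ≠ root → idx j < idx x → label k par x ⊂ label k par j → c = j ∨ c = par j) :
    idx (par x) ≤ idx c := by
  by_cases hcond : 3 ≤ (label k par x).ncard ∧ Exhausted k idx x (label k par x) ∧
      ∃ c, IsCenterBefore k idx par root x (label k par x) c
  · exact (h.isCenterBefore x c hx hcond.1 hcond.2.1 ⟨hc, hS, hI⟩).2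
  · exact h.isFirst x c hx hcond hS

/-- Arcs with larger label are found before the search leaves along an arc with label `S`. -/
theorem lt_of_ssubset_of_par_lt (h : SearchOrder k idx par root) {x j : X} (hx : x ≠ root)
    (hj : label k par x ⊂ label k par j) (hp : idx (par j) < idx x) : idx j < idx x := by
  by_contra hcon
  refine h.maximal x (par j) j hx hp (not_lt.1 hcon) ?_
  rwa [Set.inter_comm]

theorem exhausted_of_forall_lt (h : SearchOrder k idx par root) {x : X} {S : Set V}
    (H : ∀ j, j ≠ root → S ⊂ label k par j → idx j < idx x) : Exhausted k idx x S := by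
  intro c d hc hd hcd hS
  rcases lt_trichotomy (idx c) (idx d) with hlt | heq | hlt
  · have := H d (h.ne_root_of_lt hlt) (h.ssubset_label hlt hS)
    omega
  · exact hcd (h.idx_injective heq)
  · rw [Set.inter_comm] at hS
    have := H c (h.ne_root_of_lt hlt) (h.ssubset_label hlt hS)
    omega

/-- If `z` is the first node reached along an arc with label `S`, and every arc with larger label
comes later, then all those arcs start from `z`, as soon as `z` is a hub. -/
theorem par_eq_of_isHub (h : SearchOrder k idx par root) {z : X}
    (hub : IsHub k idx z (label k par z) z)
    (hlate : ∀ j, j ≠ root → label k par z ⊂ label k par j → idx z ≤ idx (par j)) :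
    ∀ j, j ≠ root → label k par z ⊂ label k par j → par j = z := by
  suffices H : ∀ n, ∀ j, idx j = n → j ≠ root → label k par z ⊂ label k par j → par j = z from
    fun j => H _ j rfl
  intro n
  induction n using Nat.strong_induction_on with
  | _ n ih =>
    rintro j rfl hj hS
    have hp := h.idx_par_lt j hj
    have hzp := hlate j hj hS
    have hsub : label k par j ⊆ k z :=
      hub j (par j) (by omega) hzp (fun e => by rw [← e] at hp; omega) hS
    refine h.idx_injective (le_antisymm ?_ hzp)
    -- By induction the earlier arcs with label larger than that of `j` start from `z`, so `z` is a
    -- possible father of `j` and the chosen one is not later.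
    refine h.par_le_of_subset hj (by omega) hsub fun j' hj' hlt hS' => ?_
    exact .inr (ih _ hlt j' rfl hj' (hS.trans hS')).symm

/-- If the arcs with larger label than that of some arc form a star, then so do the arcs with the
same or a larger label. -/
theorem exists_center (h : SearchOrder k idx par root) {x c : X} (hx : x ≠ root)
    (hcard : 3 ≤ (label k par x).ncard)
    (hc : ∀ j, j ≠ root → label k par x ⊂ label k par j → c = j ∨ c = par j) :
    ∃ z, (∀ j, j ≠ root → label k par x ⊂ label k par j → z = j ∨ z = par j) ∧
      ∀ j, j ≠ root → label k par j = label k par x → z = j ∨ z = par j := by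
  classical
  -- the first arc with this label
  obtain ⟨z, ⟨hz, hzS⟩, hmin⟩ : ∃ z, (z ≠ root ∧ label k par z = label k par x) ∧
      ∀ j, j ≠ root ∧ label k par j = label k par x → idx z ≤ idx j := by
    have hex : ∃ n, ∃ z, (z ≠ root ∧ label k par z = label k par x) ∧ idx z = n :=
      ⟨_, x, ⟨hx, rfl⟩, rfl⟩
    obtain ⟨z, hz, hzn⟩ := Nat.find_spec hex
    exact ⟨z, hz, fun j hj => hzn ▸ Nat.find_min' hex ⟨j, hj, rfl⟩⟩
  rw [← hzS] at hcard hc hmin ⊢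
  have hpz := h.idx_par_lt z hz
  by_cases hearly : ∀ j, j ≠ root → label k par z ⊂ label k par j → idx j < idx z
  · -- all arcs with larger label come before `z`
    -- For every `y` with this label nothing larger remains and `c'` is a center, so the father of
    -- `y` is a center not later than `c'`.
    have hcenter : ∀ c', (∀ j, j ≠ root → label k par z ⊂ label k par j → c' = j ∨ c' = par j) →
        idx c' < idx z → label k par z ⊆ k c' → ∀ y, y ≠ root → label k par y = label k par z →
        IsCenterBefore k idx par root y (label k par y) (par y) ∧ idx (par y) ≤ idx c' := by
      intro c' hc' hlt hsub y hy hyS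
      have hzy := hmin y ⟨hy, hyS⟩
      refine h.isCenterBefore y c' hy (by rwa [hyS]) ?_ ?_
      · rw [hyS]
        exact h.exhausted_of_forall_lt fun j hj hS => (hearly j hj hS).trans_le hzy
      · rw [hyS]
        exact ⟨by omega, hsub, fun j hj _ hS => hc' j hj hS⟩
    obtain ⟨c', hc', hlt, hsub⟩ : ∃ c', (∀ j, j ≠ root → label k par z ⊂ label k par j →
        c' = j ∨ c' = par j) ∧ idx c' < idx z ∧ label k par z ⊆ k c' := by
      by_cases hex : ∃ j, j ≠ root ∧ label k par z ⊂ label k par j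
      · obtain ⟨j, hj, hS⟩ := hex
        have h1 := hearly j hj hS
        have h2 := h.idx_par_lt j hj
        refine ⟨c, hc, ?_⟩
        rcases hc j hj hS with rfl | rfl
        · exact ⟨h1, hS.subset.trans Set.inter_subset_left⟩
        · exact ⟨h2.trans h1, hS.subset.trans Set.inter_subset_right⟩
      · exact ⟨par z, fun j hj hS => (hex ⟨j, hj, hS⟩).elim, hpz, Set.inter_subset_right⟩
    have hall : ∀ y, y ≠ root → label k par y = label k par z →
        ∀ j, j ≠ root → label k par z ⊂ label k par j → par y = j ∨ par y = par j := by
      intro y hy hyS j hj hS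
      have hzy := hmin y ⟨hy, hyS⟩
      have := hearly j hj hS
      have := (hcenter c' hc' hlt hsub y hy hyS).1.2.2 j hj (by omega)
      rw [hyS] at this
      exact this hS
    refine ⟨par z, hall z hz rfl, fun y hy hyS => .inr ?_⟩
    -- Both fathers are centers available at either step, so neither is later than the other.
    refine h.idx_injective (le_antisymm ?_ ?_)
    · have hs := (hcenter c' hc' hlt hsub y hy hyS).1.2.1
      rw [hyS] at hs
      have hle := (hcenter (par z) (hall z hz rfl) hpz Set.inter_subset_right y hy hyS).2
      exact (hcenter (par y) (hall y hy hyS) (by omega) hs z hz rfl).2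
    · exact (hcenter (par z) (hall z hz rfl) hpz Set.inter_subset_right y hy hyS).2
  · -- some arc with larger label comes after `z`, hence all of them do
    push Not at hearly
    obtain ⟨j₁, hj₁, hS₁, hlt₁⟩ := hearly
    have hp₁ : idx z ≤ idx (par j₁) := by
      by_contra hcon
      have := h.lt_of_ssubset_of_par_lt hz hS₁ (not_le.1 hcon)
      omega
    have hzc : idx z ≤ idx c := by rcases hc j₁ hj₁ hS₁ with rfl | rfl <;> assumption
    have hlate : ∀ j, j ≠ root → label k par z ⊂ label k par j → idx z ≤ idx (par j) := by
      intro j hj hS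
      by_contra hcon
      have h1 := h.lt_of_ssubset_of_par_lt hz hS (not_le.1 hcon)
      rcases hc j hj hS with rfl | rfl <;> omega
    have hSc : label k par z ⊆ k c := by
      rcases hc j₁ hj₁ hS₁ with rfl | rfl
      · exact hS₁.subset.trans Set.inter_subset_left
      · exact hS₁.subset.trans Set.inter_subset_right
    -- The center of the star is an unvisited hub when `z` is chosen, and therefore `z` is itself a
    -- hub.
    have hubc : IsHub k idx z (label k par z) c := by
      have key : ∀ a d, idx a < idx d → label k par z ⊂ k a ∩ k d → k a ∩ k d ⊆ k c := by
        intro a d hlt hS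
        have hsub := h.inter_subset_label hlt
        rcases hc d (h.ne_root_of_lt hlt) (h.ssubset_label hlt hS) with rfl | rfl
        · exact Set.inter_subset_right
        · exact hsub.trans Set.inter_subset_right
      intro a d _ _ had hS
      rcases lt_trichotomy (idx a) (idx d) with hlt | heq | hlt
      · exact key a d hlt hS
      · exact (had (h.idx_injective heq)).elim
      · rw [Set.inter_comm] at hS ⊢
        exact key d a hlt hS
    have hpar := h.par_eq_of_isHub (h.isHub z c hz hzc hSc hubc) hlate
    refine ⟨z, fun j hj hS => .inr (hpar j hj hS).symm, fun y hy hyS => ?_⟩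
    rcases eq_or_ne z y with rfl | hne
    · exact .inl rfl
    right
    have hzy : idx z < idx y := lt_of_le_of_ne (hmin y ⟨hy, hyS⟩) fun e => hne (h.idx_injective e)
    have hbefore : ∀ j, j ≠ root → label k par z ⊂ label k par j → idx j < idx y := by
      intro j hj hS
      have h1 := hpar j hj hS
      exact h.lt_of_ssubset_of_par_lt hy (hyS ▸ hS) (h1 ▸ hzy)
    have hex : Exhausted k idx y (label k par y) := by
      rw [hyS]
      exact h.exhausted_of_forall_lt hbefore
    have hW : IsCenterBefore k idx par root y (label k par y) z := by
      rw [hyS]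
      exact ⟨hzy, Set.inter_subset_left, fun j hj _ hS => .inr (hpar j hj hS).symm⟩
    obtain ⟨hpy, hle⟩ := h.isCenterBefore y z hy (by rwa [hyS]) hex hW
    rw [hyS] at hpy
    -- The father of `y` is an end of the arc from `z` to `j₁` and is not later than `z`, so it is
    -- `z`.
    rcases hpy.2.2 j₁ hj₁ (hbefore j₁ hj₁ hS₁) hS₁ with e | e
    · have := h.idx_par_lt j₁ hj₁
      rw [hpar j₁ hj₁ hS₁, ← e] at this
      omega
    · rw [e, hpar j₁ hj₁ hS₁]

/-- If the label of an arc `j` is contained in that of an arc `i` such that `i` comes not after the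
father of `j`, then the arcs with larger label than that of `j` form a star, and one of them does
not lead from `i` to its father. -/
theorem exists_center_of_label_subset (h : SearchOrder k idx par root) {i j : X}
    (hi : i ≠ root) (hj : j ≠ root) (hij : idx i ≤ idx (par j))
    (hS : label k par j ⊆ label k par i) :
    3 ≤ (label k par j).ncard ∧
      (∀ j', j' ≠ root → label k par j ⊂ label k par j' → par j = j' ∨ par j = par j') ∧
      ∃ j', j' ≠ root ∧ j' ≠ i ∧ label k par j ⊂ label k par j' ∧ (par j' = par j ∨ j' = par j) := by
  classical
  have hpi := h.idx_par_lt i hi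
  have hpj := h.idx_par_lt j hj
  have hSp : label k par j ⊆ k (par i) := hS.trans Set.inter_subset_right
  have hcond : 3 ≤ (label k par j).ncard ∧ Exhausted k idx j (label k par j) ∧
      ∃ c, IsCenterBefore k idx par root j (label k par j) c := by
    -- Otherwise the father of `j` would be the earliest node containing the label, hence not later
    -- than `par i`, which precedes `i`.
    by_contra hcon
    have := h.isFirst j (par i) hj hcon hSp
    omega
  obtain ⟨hcard, hex, c₀, hc₀⟩ := hcond
  have hpar := (h.isCenterBefore j c₀ hj hcard hex hc₀).1
  have hmin := fun c hc => (h.isCenterBefore j c hj hcard hex hc).2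
  have hbefore : ∀ j', j' ≠ root → label k par j ⊂ label k par j' → idx j' < idx j := by
    intro j' hj' hS'
    by_contra hcon
    by_cases hp : idx (par j') < idx j
    · exact hcon (h.lt_of_ssubset_of_par_lt hj hS' hp)
    · refine hex j' (par j') (not_lt.1 hcon) (not_lt.1 hp) (fun e => ?_) hS'
      have := h.idx_par_lt j' hj'
      rw [← e] at this
      omega
  have hcenter : ∀ j', j' ≠ root → label k par j ⊂ label k par j' →
      par j = j' ∨ par j = par j' :=
    fun j' hj' hS' => hpar.2.2 j' hj' (hbefore j' hj' hS') hS'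
  refine ⟨hcard, hcenter, ?_⟩
  -- the first node that contains the label
  obtain ⟨r, hrS, hrmin⟩ : ∃ r, label k par j ⊆ k r ∧ ∀ c, label k par j ⊆ k c → idx r ≤ idx c := by
    have hex : ∃ n, ∃ z, label k par j ⊆ k z ∧ idx z = n := ⟨_, j, Set.inter_subset_left, rfl⟩
    obtain ⟨z, hz, hzn⟩ := Nat.find_spec hex
    exact ⟨z, hz, fun c hc => hzn ▸ Nat.find_min' hex ⟨c, hc, rfl⟩⟩
  have hr := hrmin _ hSp
  -- The node `r` precedes `par j`, the earliest center, so `r` misses some arc with larger label.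
  obtain ⟨j', hj', hlt', hS', hne⟩ : ∃ j', j' ≠ root ∧ idx j' < idx j ∧
      label k par j ⊂ label k par j' ∧ ¬ (r = j' ∨ r = par j') := by
    by_contra hcon
    push Not at hcon
    have := hmin r ⟨by omega, hrS, fun j' hj' hlt hS' => by
      by_contra hne
      exact (hne (by simpa using hcon j' hj' hlt hS')).elim⟩
    omega
  rcases hcenter j' hj' hS' with hpe | hpe
  · by_cases hji : j' = i
    · -- impossible: there would be a path of four arcs
      exfalso
      subst hji
      push Not at hne
      have hqr : idx r < idx (par j') := lt_of_le_of_ne hr fun e => hne.2 (h.idx_injective e)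
      have hq : par j' ≠ root := h.ne_root_of_lt hqr
      have hSq : label k par j ⊆ label k par (par j') :=
        fun v hv => h.inter_subset_label hqr ⟨hrS hv, hSp hv⟩
      have hpq := h.idx_par_lt _ hq
      -- The nodes `par (par j')`, `par j'`, `j' = par j` and `j` form a path. If its first arc has
      -- the same label as `j`, `exists_center` would give a node on all three arcs; if the label is
      -- larger, the center `par j` would be on the first arc.
      rcases hSq.eq_or_ssubset with heq | hss
      · obtain ⟨z, hz₁, hz₂⟩ := h.exists_center hj hcard hcenter
        have e1 := hz₁ j' hj' hS'
        have e2 := hz₂ _ hq heq.symm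
        have e3 := hz₂ j hj rfl
        have e1 := e1.imp (congrArg idx) (congrArg idx)
        have e2 := e2.imp (congrArg idx) (congrArg idx)
        have e3 := e3.imp (congrArg idx) (congrArg idx)
        omega
      · have := (hcenter _ hq hss).imp (congrArg idx) (congrArg idx)
        have := congrArg idx hpe
        omega
    · exact ⟨j', hj', hji, hS', .inr hpe.symm⟩
  · refine ⟨j', hj', ?_, hS', .inl hpe.symm⟩
    rintro rfl
    rw [hpe] at hij
    omega

end SearchOrder

end ChordalGraph

/-! ## Rooted clique-trees from search orders -/

namespace ChordalGraph

/-! ### The tree defined by a father map. -/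

section FatherGraph

variable {X : Type*} {idx : X → ℕ} {par : X → X} {root : X}

/-- The graph whose edges join the nodes other than the root to their fathers. -/
def fatherGraph (par : X → X) (root : X) : SimpleGraph X :=
  SimpleGraph.fromRel fun x y => x ≠ root ∧ par x = y

/-- `p` is the father of `c`. -/
def IsFather (par : X → X) (root p c : X) : Prop := c ≠ root ∧ par c = p

/-- `y` belongs to the subtree rooted at `x`. -/
def IsBelow (par : X → X) (root : X) : X → X → Prop := Relation.ReflTransGen (IsFather par root)

theorem fatherGraph_adj (hlt : ∀ x, x ≠ root → idx (par x) < idx x) {x y : X} :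
    (fatherGraph par root).Adj x y ↔ IsFather par root y x ∨ IsFather par root x y := by
  rw [fatherGraph, SimpleGraph.fromRel_adj]
  refine ⟨fun h => h.2, fun h => ⟨?_, h⟩⟩
  rintro rfl
  rcases h with h | h <;>
  · have := hlt x h.1
    rw [h.2] at this
    omega

theorem IsBelow.idx_le (hlt : ∀ x, x ≠ root → idx (par x) < idx x) {x y : X}
    (h : IsBelow par root x y) : idx x ≤ idx y := by
  induction h with
  | refl => rfl
  | tail _ h ih =>
    have := hlt _ h.1
    rw [h.2] at this
    omega

theorem IsBelow.par_of_ne {x y : X} (h : IsBelow par root x y) (hne : y ≠ x) :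
    y ≠ root ∧ IsBelow par root x (par y) := by
  rcases Relation.ReflTransGen.cases_tail h with rfl | ⟨z, hz, hzy⟩
  · exact (hne rfl).elim
  · exact ⟨hzy.1, by rw [hzy.2]; exact hz⟩

theorem isBelow_of_par {x y : X} (hy : y ≠ root) (h : IsBelow par root x (par y)) :
    IsBelow par root x y :=
  Relation.ReflTransGen.tail h ⟨hy, rfl⟩

theorem not_isBelow_par (hlt : ∀ x, x ≠ root → idx (par x) < idx x) {x : X} (hx : x ≠ root) :
    ¬ IsBelow par root x (par x) := fun h => by
  have := h.idx_le hlt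
  have := hlt x hx
  omega

/-- Passing to fathers decreases `idx`, so every node reaches the root. Every edge is a bridge
because a walk avoiding the edge between `x` and `par x` cannot leave the subtree rooted at `x`. -/
theorem fatherGraph_isTree (hlt : ∀ x, x ≠ root → idx (par x) < idx x) :
    (fatherGraph par root).IsTree := by
  constructor
  · have hroot : ∀ n, ∀ x, idx x = n → (fatherGraph par root).Reachable x root := by
      intro n
      induction n using Nat.strong_induction_on with
      | _ n ih =>
        rintro x rfl
        rcases eq_or_ne x root with rfl | hx
        · rfl
        · have : (fatherGraph par root).Adj x (par x) :=
            (fatherGraph_adj hlt).2 (.inl ⟨hx, rfl⟩)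
          exact this.reachable.trans (ih _ (hlt x hx) _ rfl)
    have : Nonempty X := ⟨root⟩
    exact ⟨fun x y => (hroot _ x rfl).trans (hroot _ y rfl).symm⟩
  · rw [SimpleGraph.isAcyclic_iff_forall_adj_isBridge]
    have key : ∀ x, x ≠ root → (fatherGraph par root).IsBridge s(x, par x) := by
      intro x hx
      rw [SimpleGraph.isBridge_iff]
      rintro ⟨w⟩
      have hw : ∀ {a b : X}, ((fatherGraph par root).deleteEdges {s(x, par x)}).Walk a b →
          IsBelow par root x a → IsBelow par root x b := by
        intro a b w
        induction w with
        | nil => exact fun h => h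
        | cons hadj _ ih =>
          rename_i a b _ _
          intro ha
          refine ih ?_
          rw [SimpleGraph.deleteEdges_adj, fatherGraph_adj hlt] at hadj
          rcases hadj.1 with h | h
          · have hne : a ≠ x := by
              rintro rfl
              exact hadj.2 (by rw [← h.2]; rfl)
            rw [← h.2]
            exact (ha.par_of_ne hne).2
          · exact Relation.ReflTransGen.tail ha h
      exact not_isBelow_par hlt hx (hw w .refl)
    intro x y hxy
    rcases (fatherGraph_adj hlt).1 hxy with h | h
    · rw [← h.2]
      exact key x h.1
    · rw [← h.2, Sym2.eq_swap]
      exact key y h.1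

/-- A walk to the root that starts with a step to a son gains nothing, by induction on the walk.
This identifies `RootedCliqueTree.IsParent`, defined by distances, with `IsFather`. -/
theorem fatherGraph_dist (hlt : ∀ x, x ≠ root → idx (par x) < idx x) {x : X} (hx : x ≠ root) :
    (fatherGraph par root).dist root x = (fatherGraph par root).dist root (par x) + 1 := by
  have hconn := (fatherGraph_isTree hlt).connected
  have hstep : ∀ {a b : X}, (fatherGraph par root).Adj a b →
      (fatherGraph par root).dist root b ≤ (fatherGraph par root).dist root a + 1 := by
    intro a b hab
    have h := hconn.dist_triangle (u := root) (v := a) (w := b)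
    rwa [SimpleGraph.dist_eq_one_iff_adj.2 hab] at h
  have hpar : ∀ {x : X}, x ≠ root → (fatherGraph par root).Adj x (par x) := fun hx =>
    (fatherGraph_adj hlt).2 (.inl ⟨hx, rfl⟩)
  have key : ∀ {a b : X} (w : (fatherGraph par root).Walk a b), b = root → a ≠ root →
      (fatherGraph par root).dist root (par a) + 1 ≤ w.length := by
    intro a b w
    induction w with
    | nil => exact fun h h' => (h' h).elim
    | cons hadj w ih =>
      rename_i a c b
      rintro rfl ha
      rw [SimpleGraph.Walk.length_cons]
      rcases (fatherGraph_adj hlt).1 hadj with h | h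
      · rw [h.2, SimpleGraph.dist_comm]
        have := SimpleGraph.dist_le w
        omega
      · have h1 := ih rfl h.1
        rw [h.2] at h1
        have := hstep (hpar ha)
        omega
  refine le_antisymm (hstep (hpar hx).symm) ?_
  obtain ⟨w, hw⟩ := hconn.exists_walk_length_eq_dist x root
  have := key w rfl hx
  rwa [hw, SimpleGraph.dist_comm (u := x)] at this

theorem fatherGraph_isFather_iff (hlt : ∀ x, x ≠ root → idx (par x) < idx x) {p c : X} :
    (fatherGraph par root).Adj p c ∧
      (fatherGraph par root).dist root c = (fatherGraph par root).dist root p + 1 ↔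
    IsFather par root p c := by
  rw [fatherGraph_adj hlt]
  refine ⟨fun ⟨h, hd⟩ => h.resolve_left fun h' => ?_, fun h => ⟨.inr h, ?_⟩⟩
  · have := fatherGraph_dist hlt h'.1
    rw [h'.2] at this
    omega
  · rw [fatherGraph_dist hlt h.1, h.2]

end FatherGraph

/-! ### Separators as boundaries of closed vertex sets. -/

section Separators

variable {V : Type*} {G : SimpleGraph V}

/-- For `W` one takes the component of `u`. With this form, walks in nested induced subgraphs are no
longer needed. -/
theorem isSeparator_iff {u v : V} {S : Set V} : IsSeparator G u v S ↔
    u ∉ S ∧ v ∉ S ∧ ∃ W : Set V, u ∈ W ∧ v ∉ W ∧ ∀ a ∈ W, ∀ b, G.Adj a b → b ∉ S → b ∈ W := by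
  constructor
  · rintro ⟨hu, hv, h⟩
    refine ⟨hu, hv, {x | ∃ hx : x ∈ Sᶜ, (G.induce Sᶜ).Reachable ⟨u, hu⟩ ⟨x, hx⟩},
      ⟨hu, .refl _⟩, fun ⟨_, h'⟩ => h h', ?_⟩
    rintro a ⟨ha, hua⟩ b hab hb
    exact ⟨hb, hua.trans (SimpleGraph.Adj.reachable (by simpa using hab))⟩
  · rintro ⟨hu, hv, W, huW, hvW, hW⟩
    refine ⟨hu, hv, fun ⟨w⟩ => ?_⟩
    have key : ∀ {a b : ↥Sᶜ}, (G.induce Sᶜ).Walk a b → a.1 ∈ W → b.1 ∈ W := by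
      intro a b w
      induction w with
      | nil => exact fun h => h
      | cons hadj _ ih =>
        rename_i a b _ _
        exact fun h => ih (hW a h b (by simpa using hadj) b.2)
    exact hvW (key w huW)

theorem IsSeparator.symm {u v : V} {S : Set V} (h : IsSeparator G u v S) :
    IsSeparator G v u S :=
  let ⟨hu, hv, h⟩ := h
  ⟨hv, hu, fun h' => h h'.symm⟩

theorem MaxClique.not_subset {K L : MaxClique G} (h : K ≠ L) : ¬ K.1 ⊆ L.1 := fun hs =>
  h (Subtype.ext (K.2.eq_of_subset L.2.prop hs))

end Separators

/-! ### Clique-tree property and minimal separators of the subtrees. -/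

namespace SearchOrder

variable {V : Type*} {G : SimpleGraph V} {idx : MaxClique G → ℕ} {par : MaxClique G → MaxClique G}
  {root : MaxClique G}

/-- `R` is the earliest node containing `v`; by `inter_subset` any later one shares `v` with its
father. So the nodes containing `v` hang together below `R`. -/
theorem exists_first [Finite V] (h : SearchOrder (fun K : MaxClique G => K.1) idx par root) (v : V) :
    ∃ R : MaxClique G, v ∈ R.1 ∧ ∀ K : MaxClique G, v ∈ K.1 → K ≠ R →
      K ≠ root ∧ v ∈ (par K).1 := by
  obtain ⟨K, hvK, hK⟩ := exists_maximal_clique (G := G) (Q := {v}) (Set.pairwise_singleton _ _)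
  have hex : ∃ n, ∃ K : MaxClique G, v ∈ K.1 ∧ idx K = n := ⟨_, ⟨K, hK⟩, hvK rfl, rfl⟩
  classical
  obtain ⟨R, hR, hRn⟩ := Nat.find_spec hex
  refine ⟨R, hR, fun K hK hne => ?_⟩
  have hlt : idx R < idx K := lt_of_le_of_ne (hRn ▸ Nat.find_min' hex ⟨K, hK, rfl⟩)
    fun e => hne (h.idx_injective e.symm)
  exact ⟨h.ne_root_of_lt hlt, h.inter_subset K R (h.ne_root_of_lt hlt) hlt ⟨hR, hK⟩⟩

/-- The rooted clique-tree given by a search order. -/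
def cliqueTree [Finite V] (h : SearchOrder (fun K : MaxClique G => K.1) idx par root) :
    RootedCliqueTree G where
  tree := fatherGraph par root
  isTree := fatherGraph_isTree h.idx_par_lt
  root := root
  connected_of_mem v := by
    obtain ⟨R, hR, hfirst⟩ := h.exists_first v
    have key : ∀ n, ∀ K : ({K : MaxClique G | v ∈ K.1} : Set (MaxClique G)), idx K.1 = n →
        ((fatherGraph par root).induce {K : MaxClique G | v ∈ K.1}).Reachable K ⟨R, hR⟩ := by
      intro n
      induction n using Nat.strong_induction_on with
      | _ n ih =>
        rintro K rfl
        rcases eq_or_ne K.1 R with heq | hne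
        · obtain rfl : K = ⟨R, hR⟩ := Subtype.ext heq
          rfl
        · obtain ⟨hK, hv⟩ := hfirst K.1 K.2 hne
          have : ((fatherGraph par root).induce {K : MaxClique G | v ∈ K.1}).Adj K ⟨par K.1, hv⟩ :=
            (fatherGraph_adj h.idx_par_lt).2 (.inl ⟨hK, rfl⟩)
          exact this.reachable.trans (ih _ (h.idx_par_lt _ hK) ⟨par K.1, hv⟩ rfl)
    have : Nonempty ({K : MaxClique G | v ∈ K.1} : Set (MaxClique G)) := ⟨⟨R, hR⟩⟩
    exact ⟨fun K L => (key _ K rfl).trans (key _ L rfl).symm⟩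

/-- A vertex that occurs both inside and outside a subtree lies in the label of its arc. -/
theorem mem_label [Finite V] (h : SearchOrder (fun K : MaxClique G => K.1) idx par root) {v : V}
    {Y L L' : MaxClique G} (hL : IsBelow par root Y L) (hL' : ¬ IsBelow par root Y L')
    (hv : v ∈ L.1) (hv' : v ∈ L'.1) : v ∈ label (fun K : MaxClique G => K.1) par Y := by
  obtain ⟨R, hR, hfirst⟩ := h.exists_first v
  -- If the earliest node `R` containing `v` is below `Y`, so are all nodes containing `v`.
  -- Otherwise the climb from `L` to `R` crosses the arc of `Y`.
  by_cases hRY : IsBelow par root Y R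
  · exfalso
    have key : ∀ n, ∀ L' : MaxClique G, idx L' = n → v ∈ L'.1 → IsBelow par root Y L' := by
      intro n
      induction n using Nat.strong_induction_on with
      | _ n ih =>
        rintro L' rfl hv'
        rcases eq_or_ne L' R with rfl | hne
        · exact hRY
        · obtain ⟨hK, hv⟩ := hfirst L' hv' hne
          exact isBelow_of_par hK (ih _ (h.idx_par_lt _ hK) _ rfl hv)
    exact hL' (key _ L' rfl hv')
  · have key : ∀ n, ∀ L : MaxClique G, idx L = n → v ∈ L.1 → IsBelow par root Y L →
        v ∈ label (fun K : MaxClique G => K.1) par Y := by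
      intro n
      induction n using Nat.strong_induction_on with
      | _ n ih =>
        rintro L rfl hv hL
        have hne : L ≠ R := by rintro rfl; exact hRY hL
        obtain ⟨hK, hvp⟩ := hfirst L hv hne
        rcases eq_or_ne L Y with rfl | hne'
        · exact ⟨hv, hvp⟩
        · exact ih _ (h.idx_par_lt _ hK) _ rfl hvp (hL.par_of_ne hne').2
    exact key _ L rfl hv hL

/-- The vertices below `Y` and outside its label are not adjacent to other vertices outside the
label. -/
theorem mem_below_of_adj [Finite V] (h : SearchOrder (fun K : MaxClique G => K.1) idx par root)
    {Y : MaxClique G} {a b : V} (ha : ∃ L : MaxClique G, IsBelow par root Y L ∧ a ∈ L.1)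
    (haY : a ∉ label (fun K : MaxClique G => K.1) par Y) (hab : G.Adj a b) :
    ∃ L : MaxClique G, IsBelow par root Y L ∧ b ∈ L.1 := by
  obtain ⟨L, hL, haL⟩ := ha
  obtain ⟨K, habK, hK⟩ := exists_maximal_clique (G := G) (Q := {a, b})
    (SimpleGraph.isClique_pair.2 fun _ => hab)
  have haK : a ∈ K := habK (by simp)
  have hbK : b ∈ K := habK (by simp)
  by_cases hKY : IsBelow par root Y ⟨K, hK⟩
  · exact ⟨_, hKY, hbK⟩
  · exact (haY (h.mem_label hL hKY haL haK)).elim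

/-- The label of an arc separates vertices below it from vertices above it. -/
theorem isSeparator_label [Finite V]
    (h : SearchOrder (fun K : MaxClique G => K.1) idx par root) {U : Set V} {Y L L' : MaxClique G}
    {u v : U} (hL : IsBelow par root Y L) (hL' : ¬ IsBelow par root Y L') (hu : u.1 ∈ L.1)
    (hv : v.1 ∈ L'.1) (huY : u.1 ∉ label (fun K : MaxClique G => K.1) par Y)
    (hvY : v.1 ∉ label (fun K : MaxClique G => K.1) par Y) :
    IsSeparator (G.induce U) u v
      (Subtype.val ⁻¹' label (fun K : MaxClique G => K.1) par Y) := by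
  refine isSeparator_iff.2 ⟨huY, hvY, {a | a.1 ∉ label (fun K : MaxClique G => K.1) par Y ∧
    ∃ L : MaxClique G, IsBelow par root Y L ∧ a.1 ∈ L.1}, ⟨huY, L, hL, hu⟩, ?_, ?_⟩
  · rintro ⟨_, K, hK, hvK⟩
    exact hvY (h.mem_label hK hL' hvK hv)
  · rintro a ⟨haY, ha⟩ b hab hb
    exact ⟨hb, h.mem_below_of_adj ha haY (by simpa using hab)⟩

/-- The label separates some `y ∈ Y \ par Y` from some `x ∈ par Y \ Y`. Each vertex of the label is
adjacent to both, so none can be omitted. -/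
theorem isMinimalSeparatorOn_label [Finite V]
    (h : SearchOrder (fun K : MaxClique G => K.1) idx par root) {K Y : MaxClique G}
    (hY : IsBelow par root K Y) (hne : Y ≠ K) :
    IsMinimalSeparatorOn G {v | ∃ L : MaxClique G, IsBelow par root K L ∧ v ∈ L.1}
      (label (fun K : MaxClique G => K.1) par Y) := by
  obtain ⟨hroot, hpY⟩ := hY.par_of_ne hne
  have hnb := not_isBelow_par h.idx_par_lt hroot
  have hYp : Y ≠ par Y := fun e => hnb (e ▸ .refl)
  obtain ⟨x, hxp, hxY⟩ := Set.not_subset.1 (MaxClique.not_subset hYp.symm)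
  obtain ⟨y, hyY, hyp⟩ := Set.not_subset.1 (MaxClique.not_subset hYp)
  refine ⟨Subtype.val ⁻¹' label (fun K : MaxClique G => K.1) par Y,
    ⟨⟨y, Y, hY, hyY⟩, ⟨x, par Y, hpY, hxp⟩, ?_, fun S hS hle s hs => ?_⟩, ?_⟩
  · exact h.isSeparator_label .refl hnb hyY hxp (fun h => hyp h.2) (fun h => hxY h.1)
  · by_contra hsS
    obtain ⟨-, hxS, W, hyW, hxW, hW⟩ := isSeparator_iff.1 hS
    refine hxW (hW s (hW _ hyW s ?_ hsS) _ ?_ hxS)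
    · exact Y.2.prop hyY hs.1 fun e => hyp (by rw [e]; exact hs.2)
    · exact (par Y).2.prop hs.2 hxp fun e => hxY ((show s.1 = x from e) ▸ (hs.1 : s.1 ∈ Y.1))
  · rw [Subtype.image_preimage_coe, Set.inter_eq_right]
    exact fun v hv => ⟨Y, hY, hv.1⟩

/-- If no arc between two nodes has a label contained in `S`, then the vertices of these nodes
outside `S` are connected outside `S`. -/
theorem exists_mem_of_forall_not_subset
    (h : SearchOrder (fun K : MaxClique G => K.1) idx par root) {K : MaxClique G} {S W : Set V}
    (hW : ∀ a ∈ W, ∀ b ∈ {v | ∃ L : MaxClique G, IsBelow par root K L ∧ v ∈ L.1}, G.Adj a b →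
      b ∉ S → b ∈ W) : ∀ L L' : MaxClique G, IsBelow par root K L → IsBelow par root K L' →
    (∀ Y, Y ≠ K → IsBelow par root K Y → ¬ (IsBelow par root Y L ↔ IsBelow par root Y L') →
      ¬ label (fun K : MaxClique G => K.1) par Y ⊆ S) →
    (∃ a ∈ L.1, a ∉ S ∧ a ∈ W) → ∃ a ∈ L'.1, a ∉ S ∧ a ∈ W := by
  have hall : ∀ L : MaxClique G, IsBelow par root K L → (∃ a ∈ L.1, a ∉ S ∧ a ∈ W) →
      ∀ b ∈ L.1, b ∉ S → b ∈ W := by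
    rintro L hL ⟨a, ha, -, haW⟩ b hb hbS
    rcases eq_or_ne a b with rfl | hne
    · exact haW
    · exact hW a haW b ⟨L, hL, hb⟩ (L.2.prop ha hb hne) hbS
  -- Induction on the sum of the indices: the later node is replaced by its father, and a vertex of
  -- their label outside `S` carries membership in `W` across.
  suffices H : ∀ n, ∀ L L' : MaxClique G, idx L + idx L' = n → IsBelow par root K L →
      IsBelow par root K L' →
      (∀ Y, Y ≠ K → IsBelow par root K Y → ¬ (IsBelow par root Y L ↔ IsBelow par root Y L') →
        ¬ label (fun K : MaxClique G => K.1) par Y ⊆ S) →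
      ((∃ a ∈ L.1, a ∉ S ∧ a ∈ W) ↔ ∃ a ∈ L'.1, a ∉ S ∧ a ∈ W) from
    fun L L' hL hL' hY => (H _ L L' rfl hL hL' hY).1
  intro n
  induction n using Nat.strong_induction_on with
  | _ n ih =>
    have key : ∀ L L' : MaxClique G, idx L + idx L' = n → IsBelow par root K L →
        IsBelow par root K L' → idx L' < idx L →
        (∀ Y, Y ≠ K → IsBelow par root K Y → ¬ (IsBelow par root Y L ↔ IsBelow par root Y L') →
          ¬ label (fun K : MaxClique G => K.1) par Y ⊆ S) →
        ((∃ a ∈ L.1, a ∉ S ∧ a ∈ W) ↔ ∃ a ∈ L'.1, a ∉ S ∧ a ∈ W) := by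
      rintro L L' hn hL hL' hlt hY
      have hLK : L ≠ K := by
        rintro rfl
        have := hL'.idx_le h.idx_par_lt
        omega
      obtain ⟨hroot, hp⟩ := hL.par_of_ne hLK
      have hplt := h.idx_par_lt L hroot
      have hL'L : ¬ IsBelow par root L L' := fun hb => by
        have := hb.idx_le h.idx_par_lt
        omega
      obtain ⟨s, hs, hsS⟩ := Set.not_subset.1
        (hY L hLK hL fun hiff => hL'L (hiff.1 .refl))
      refine Iff.trans ⟨fun ha => ⟨s, hs.2, hsS, hall L hL ha s hs.1 hsS⟩,
        fun ha => ⟨s, hs.1, hsS, hall _ hp ha s hs.2 hsS⟩⟩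
        (ih _ (by omega) (par L) L' rfl hp hL' fun Y hYK hYb hiff => hY Y hYK hYb fun hiff' => ?_)
      refine hiff (Iff.trans ⟨fun hb => isBelow_of_par hroot hb, fun hb => ?_⟩ hiff')
      refine (hb.par_of_ne ?_).2
      rintro rfl
      exact hL'L (hiff'.1 .refl)
    intro L L' hn hL hL' hY
    rcases lt_trichotomy (idx L) (idx L') with hlt | heq | hlt
    · refine (key L' L (by omega) hL' hL hlt fun Y hYK hYb hiff => hY Y hYK hYb ?_).symm
      exact fun hiff' => hiff hiff'.symm
    · rw [h.idx_injective heq]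
    · exact key L L' hn hL hL' hlt hY

/-- Let `S` minimally separate `u` from `v`. Some arc between nodes containing them has its label
inside `S`, since otherwise they would be connected outside `S`. That label also separates them, so
by minimality it is `S`. -/
theorem exists_label_eq [Finite V] (h : SearchOrder (fun K : MaxClique G => K.1) idx par root)
    {K : MaxClique G} {S : Set V}
    (hS : IsMinimalSeparatorOn G {v | ∃ L : MaxClique G, IsBelow par root K L ∧ v ∈ L.1} S) :
    ∃ Y, Y ≠ K ∧ IsBelow par root K Y ∧ label (fun K : MaxClique G => K.1) par Y = S := by
  obtain ⟨S', ⟨u, v, hmin⟩, rfl⟩ := hS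
  obtain ⟨huS, hvS, W, huW, hvW, hW⟩ := isSeparator_iff.1 hmin.prop
  obtain ⟨Lu, hLu, hu⟩ := u.2
  obtain ⟨Lv, hLv, hv⟩ := v.2
  have hnS : ∀ {w : {v | ∃ L : MaxClique G, IsBelow par root K L ∧ v ∈ L.1}}, w ∉ S' →
      w.1 ∉ Subtype.val '' S' := by
    rintro w hw ⟨w', hw', e⟩
    rw [Subtype.ext e] at hw'
    exact hw hw'
  obtain ⟨Y, hYK, hYb, hYL, hYS⟩ : ∃ Y, Y ≠ K ∧ IsBelow par root K Y ∧
      ¬ (IsBelow par root Y Lu ↔ IsBelow par root Y Lv) ∧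
      label (fun K : MaxClique G => K.1) par Y ⊆ Subtype.val '' S' := by
    by_contra hcon
    have hW' : ∀ a ∈ Subtype.val '' W, ∀ b ∈ {v | ∃ L : MaxClique G, IsBelow par root K L ∧ v ∈ L.1},
        G.Adj a b → b ∉ Subtype.val '' S' → b ∈ Subtype.val '' W := by
      rintro _ ⟨a, ha, rfl⟩ b hb hab hbS
      exact ⟨⟨b, hb⟩, hW a ha ⟨b, hb⟩ (by simpa using hab) fun hbS' => hbS ⟨_, hbS', rfl⟩, rfl⟩
    obtain ⟨a, haL, haS, haW⟩ := h.exists_mem_of_forall_not_subset hW' Lu Lv hLu hLv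
      (fun Y hYK hYb hYL hYS => hcon ⟨Y, hYK, hYb, hYL, hYS⟩) ⟨u, hu, hnS huS, u, huW, rfl⟩
    have hvW' : v.1 ∈ Subtype.val '' W := by
      rcases eq_or_ne a v.1 with rfl | hne
      · exact haW
      · exact hW' a haW v.1 v.2 (Lv.2.prop haL hv hne) (hnS hvS)
    obtain ⟨v', hv', e⟩ := hvW'
    rw [Subtype.ext e] at hv'
    exact hvW hv'
  refine ⟨Y, hYK, hYb, hYS.antisymm ?_⟩
  have hsep : IsSeparator (G.induce {v | ∃ L : MaxClique G, IsBelow par root K L ∧ v ∈ L.1}) u v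
      (Subtype.val ⁻¹' label (fun K : MaxClique G => K.1) par Y) := by
    have huY := fun hh => hnS huS (hYS hh)
    have hvY := fun hh => hnS hvS (hYS hh)
    by_cases hb : IsBelow par root Y Lu
    · exact h.isSeparator_label hb (fun hb' => hYL (iff_of_true hb hb')) hu hv huY hvY
    · have hb' : IsBelow par root Y Lv := by
        by_contra hb'
        exact hYL (iff_of_false hb hb')
      exact (h.isSeparator_label hb' hb hv hu hvY huY).symm
  have hle : Subtype.val ⁻¹' label (fun K : MaxClique G => K.1) par Y ≤ S' := fun w hw => by
    by_contra hwS
    exact hnS hwS (hYS hw)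
  rintro _ ⟨w, hw, rfl⟩
  exact hmin.le_of_le hsep hle hw

theorem cliqueTree_isParent_iff [Finite V]
    (h : SearchOrder (fun K : MaxClique G => K.1) idx par root) (P K : MaxClique G) :
    h.cliqueTree.IsParent P K ↔ IsFather par root P K :=
  fatherGraph_isFather_iff h.idx_par_lt

theorem cliqueTree_below [Finite V]
    (h : SearchOrder (fun K : MaxClique G => K.1) idx par root) (K : MaxClique G) :
    h.cliqueTree.below K = {v | ∃ L : MaxClique G, IsBelow par root K L ∧ v ∈ L.1} := by
  have : h.cliqueTree.IsParent = IsFather par root := by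
    ext P K
    exact h.cliqueTree_isParent_iff P K
  rw [RootedCliqueTree.below, this]
  rfl

theorem forall_adj_iff [Finite V] (h : SearchOrder (fun K : MaxClique G => K.1) idx par root)
    (C : MaxClique G) (p : Set V → Prop) :
    (∀ K L : MaxClique G, h.cliqueTree.tree.Adj K L → p (K.1 ∩ L.1) → C = K ∨ C = L) ↔
      ∀ j, j ≠ root → p (label (fun K : MaxClique G => K.1) par j) → C = j ∨ C = par j := by
  constructor
  · exact fun H j hj hp => H j (par j) ((fatherGraph_adj h.idx_par_lt).2 (.inl ⟨hj, rfl⟩)) hp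
  · intro H K L hKL hp
    rcases (fatherGraph_adj h.idx_par_lt).1 hKL with ⟨hr, rfl⟩ | ⟨hr, rfl⟩
    · exact H K hr hp
    · rw [Set.inter_comm] at hp
      exact (H L hr hp).symm

theorem cliqueTree_convergent [Finite V]
    (h : SearchOrder (fun K : MaxClique G => K.1) idx par root) {x c : MaxClique G} (hx : x ≠ root)
    (hcard : 3 ≤ (label (fun K : MaxClique G => K.1) par x).ncard)
    (hc : ∀ j, j ≠ root → label (fun K : MaxClique G => K.1) par x ⊂
      label (fun K : MaxClique G => K.1) par j → c = j ∨ c = par j) :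
    h.cliqueTree.Convergent (label (fun K : MaxClique G => K.1) par x) := by
  obtain ⟨z, hz₁, hz₂⟩ := h.exists_center hx hcard hc
  exact ⟨z, (h.forall_adj_iff z fun S => label (fun K : MaxClique G => K.1) par x ⊂ S).2 hz₁,
    (h.forall_adj_iff z fun S => S = label (fun K : MaxClique G => K.1) par x).2 hz₂⟩

/-- The clique-tree given by a search order has the two properties of the theorem. -/
theorem cliqueTree_spec [Finite V] (h : SearchOrder (fun K : MaxClique G => K.1) idx par root)
    {K P : MaxClique G} (hKP : h.cliqueTree.IsParent P K) :
    (h.cliqueTree.WeaklyConvergent (K.1 ∩ P.1) → 3 ≤ (K.1 ∩ P.1).ncard →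
      h.cliqueTree.Convergent (K.1 ∩ P.1)) ∧
    ∀ S : Set V, IsMinimalSeparatorOn G (h.cliqueTree.below K) S → S ⊆ K.1 ∩ P.1 →
      h.cliqueTree.Convergent S ∧ 3 ≤ S.ncard ∧
      ∃ S' : Set V, IsMinimalSeparatorOn G (h.cliqueTree.below K) S' ∧ S ⊂ S' := by
  obtain ⟨hK, rfl⟩ := (h.cliqueTree_isParent_iff P K).1 hKP
  refine ⟨fun ⟨c, hc⟩ hcard => h.cliqueTree_convergent hK hcard
    ((h.forall_adj_iff c fun S => label (fun K : MaxClique G => K.1) par K ⊂ S).1 hc), ?_⟩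
  intro S hS hSK
  rw [h.cliqueTree_below] at hS ⊢
  obtain ⟨Y, hYK, hYb, rfl⟩ := h.exists_label_eq hS
  obtain ⟨hY, hpY⟩ := hYb.par_of_ne hYK
  obtain ⟨hcard, hc, j, hj, hjK, hSj, hjp⟩ :=
    h.exists_center_of_label_subset hK hY (hpY.idx_le h.idx_par_lt) hSK
  refine ⟨h.cliqueTree_convergent hY hcard hc, hcard, _, h.isMinimalSeparatorOn_label ?_ hjK, hSj⟩
  rcases hjp with e | e
  · exact isBelow_of_par hj (e ▸ hpY)
  · exact e ▸ hpY

end SearchOrder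

end ChordalGraph

/-! ## Correctness of the enumeration of the maximal cliques -/

namespace CliqueTreeAlgorithm

open TreeMachine ChordalGraph

variable {n : ℕ}

open Classical in
/-- The first `k` entries of the characteristic sequence of a set of vertices. -/
noncomputable def charSeq (k : ℕ) (K : Set (Fin n)) : BSet :=
  (List.range k).map fun i => decide (i ∈ Fin.val '' K)

theorem length_charSeq (k : ℕ) (K : Set (Fin n)) : (charSeq k K).length = k := by
  simp [charSeq]

theorem enc_charSeq (K : Set (Fin n)) : Enc.enc (charSeq n K) = encodeSet K := by
  change encodeList (List.map encodeBool (charSeq n K)) = _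
  rw [encodeSet, charSeq, ← List.map_coe_finRange_eq_range, List.map_map, List.map_map]
  congr 1
  exact List.map_congr_left fun j _ =>
    congrArg encodeBool (decide_eq_decide.2 Fin.val_injective.mem_set_image)

theorem charSeq_succ {k : ℕ} (hk : k < n) (K : Set (Fin n)) [Decidable ((⟨k, hk⟩ : Fin n) ∈ K)] :
    charSeq (k + 1) K = charSeq k K ++ [decide (⟨k, hk⟩ ∈ K)] := by
  have : k ∈ Fin.val '' K ↔ (⟨k, hk⟩ : Fin n) ∈ K :=
    ⟨fun ⟨j, hj, e⟩ => by rwa [← show j = ⟨k, hk⟩ from Fin.ext e], fun h => ⟨_, h, rfl⟩⟩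
  simp [charSeq, List.range_succ, this]

theorem getElem_charSeq {k i : ℕ} {K : Set (Fin n)} (hi : i < (charSeq k K).length) :
    (charSeq k K)[i] = true ↔ i ∈ Fin.val '' K := by
  simp [charSeq]

theorem inter_charSeq {k m : ℕ} (hkm : k ≤ m) (K L : Set (Fin n)) :
    inter (charSeq k K) (charSeq m L) = charSeq k (K ∩ L) := by
  refine List.ext_getElem (by simp [inter, length_charSeq, hkm]) fun i h₁ h₂ => ?_
  rw [Bool.eq_iff_iff, getElem_charSeq, Set.image_inter Fin.val_injective]
  simp only [inter, List.getElem_zipWith, Bool.and_eq_true]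
  rw [getElem_charSeq, getElem_charSeq, Set.mem_inter_iff]

theorem sub_iff {s t : BSet} (hlen : s.length = t.length) :
    sub s t = true ↔ ∀ i (hi : i < s.length), s[i] = true → t[i] = true := by
  rw [sub, List.all_eq_true]
  constructor
  · intro h i hi hs
    have := h (!s[i] || t[i]) (List.mem_iff_getElem.2 ⟨i, by simp; omega, by simp⟩)
    simpa [hs] using this
  · intro h x hx
    obtain ⟨i, hi, rfl⟩ := List.mem_iff_getElem.1 hx
    simp only [List.length_zipWith] at hi
    have := h i (by omega)
    rw [List.getElem_zipWith]
    cases hs : s[i] <;> simp_all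

theorem sub_refl (s : BSet) : sub s s = true :=
  (sub_iff rfl).2 fun _ _ h => h

theorem sub_trans {s t u : BSet} (h₁ : s.length = t.length) (h₂ : t.length = u.length)
    (hst : sub s t = true) (htu : sub t u = true) : sub s u = true :=
  (sub_iff (h₁.trans h₂)).2 fun i hi h =>
    (sub_iff h₂).1 htu i (h₁ ▸ hi) ((sub_iff h₁).1 hst i hi h)

theorem sub_charSeq {k : ℕ} {K L : Set (Fin n)} (hK : K ⊆ {j | j.1 < k}) :
    sub (charSeq k K) (charSeq k L) = true ↔ K ⊆ L := by
  rw [sub_iff (by simp [length_charSeq])]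
  simp only [getElem_charSeq]
  constructor
  · intro h j hj
    rw [length_charSeq] at h
    obtain ⟨j', hj', e⟩ := h j.1 (hK hj) ⟨j, hj, rfl⟩
    rwa [← Fin.ext e]
  · rintro h _ _ ⟨j, hj, rfl⟩
    exact ⟨j, h hj, rfl⟩

theorem charSeq_inj {k : ℕ} {K L : Set (Fin n)} (hK : K ⊆ {j | j.1 < k})
    (hL : L ⊆ {j | j.1 < k}) (h : charSeq k K = charSeq k L) : K = L :=
  Set.Subset.antisymm ((sub_charSeq hK).1 (h ▸ sub_refl _))
    ((sub_charSeq hL).1 (h ▸ sub_refl _))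

theorem subset_lt (K : Set (Fin n)) : K ⊆ {j | j.1 < n} := fun j _ => j.2

theorem sub_charSeq_self {K L : Set (Fin n)} :
    sub (charSeq n K) (charSeq n L) = true ↔ K ⊆ L :=
  sub_charSeq (subset_lt K)

theorem ssub_charSeq {K L : Set (Fin n)} : ssub (charSeq n K) (charSeq n L) = true ↔ K ⊂ L := by
  simp [ssub, sub_charSeq_self, ssubset_iff_subset_not_subset, ← Bool.not_eq_true]

theorem eqv_charSeq {K L : Set (Fin n)} : eqv (charSeq n K) (charSeq n L) = true ↔ K = L := by
  simp [eqv, sub_charSeq_self, Set.Subset.antisymm_iff]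

theorem big_charSeq {S : Set (Fin n)} : big (charSeq n S) = true ↔ 3 ≤ S.ncard := by
  classical
  have hlen : ((charSeq n S).filter id).length = S.ncard := by
    rw [charSeq, List.filter_map, List.length_map, ← Set.ncard_image_of_injective S Fin.val_injective,
      ← List.toFinset_card_of_nodup (List.nodup_range.filter _), ← Set.ncard_coe_finset]
    congr 1
    ext i
    simp only [List.coe_toFinset, List.mem_filter, List.mem_range, Set.mem_ofPred_eq,
      Function.comp_apply, id_eq, decide_eq_true_eq, and_iff_right_iff_imp]
    rintro ⟨j, -, rfl⟩
    exact j.2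
  rw [big, ← hlen]
  rcases (charSeq n S).filter id with _ | ⟨a, _ | ⟨b, _ | ⟨c, l⟩⟩⟩ <;> simp

/-- The outcome of the insertion of a list of sets into an antichain. -/
theorem foldl_insertMaximal {m : ℕ} (M : List BSet) (hM : ∀ x ∈ M, x.length = m) :
    ∀ acc : List BSet, (∀ x ∈ acc, x.length = m) →
      acc.Pairwise (fun a b => ¬ sub a b = true ∧ ¬ sub b a = true) →
      (∀ x ∈ M.foldl insertMaximal acc, x ∈ acc ∨ x ∈ M) ∧
      (∀ x, x ∈ acc ∨ x ∈ M → ∃ y ∈ M.foldl insertMaximal acc, sub x y = true) ∧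
      (M.foldl insertMaximal acc).Pairwise (fun a b => ¬ sub a b = true ∧ ¬ sub b a = true) := by
  induction M with
  | nil => exact fun acc _ hp => ⟨fun x hx => .inl hx,
      fun x hx => ⟨x, hx.resolve_right List.not_mem_nil, sub_refl x⟩, hp⟩
  | cons K M ih =>
    intro acc hacc hp
    have hK : K.length = m := hM K (by simp)
    have hlen : ∀ x ∈ insertMaximal acc K, x.length = m := by
      intro x hx
      unfold insertMaximal at hx
      split at hx
      · exact hacc x hx
      · rcases List.mem_cons.1 hx with rfl | hx
        · exact hK
        · exact hacc x (List.mem_of_mem_filter hx)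
    have hpair : (insertMaximal acc K).Pairwise
        (fun a b => ¬ sub a b = true ∧ ¬ sub b a = true) := by
      unfold insertMaximal
      split
      · exact hp
      · rename_i hany
        refine List.pairwise_cons.2 ⟨fun x hx => ?_, hp.filter _⟩
        rw [List.mem_filter] at hx
        exact ⟨fun h => hany (List.any_eq_true.2 ⟨x, hx.1, h⟩), by simpa using hx.2⟩
    have hsub : ∀ x ∈ insertMaximal acc K, x ∈ acc ∨ x = K := by
      intro x hx
      unfold insertMaximal at hx
      split at hx
      · exact .inl hx
      · rcases List.mem_cons.1 hx with rfl | hx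
        · exact .inr rfl
        · exact .inl (List.mem_of_mem_filter hx)
    have hcov : ∀ x, x ∈ acc ∨ x = K → ∃ y ∈ insertMaximal acc K, sub x y = true := by
      intro x hx
      unfold insertMaximal
      split
      · rename_i hany
        rcases hx with hx | rfl
        · exact ⟨x, hx, sub_refl x⟩
        · exact List.any_eq_true.1 hany
      · rcases hx with hx | rfl
        · by_cases h : sub x K = true
          · exact ⟨K, by simp, h⟩
          · exact ⟨x, List.mem_cons_of_mem _ (List.mem_filter.2 ⟨hx, by simpa using h⟩), sub_refl x⟩
        · exact ⟨x, by simp, sub_refl x⟩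
    obtain ⟨h1, h2, h3⟩ := ih (fun x hx => hM x (by simp [hx])) _ hlen hpair
    refine ⟨fun x hx => ?_, fun x hx => ?_, h3⟩
    · rcases h1 x hx with h | h
      · exact (hsub x h).imp_right fun e => by simp [e]
      · exact .inr (by simp [h])
    · have hx' : (x ∈ acc ∨ x = K) ∨ x ∈ M := by
        rcases hx with h | h
        · exact .inl (.inl h)
        · rcases List.mem_cons.1 h with h | h
          · exact .inl (.inr h)
          · exact .inr h
      rcases hx' with h | h
      · obtain ⟨y, hy, hxy⟩ := hcov x h
        obtain ⟨z, hz, hyz⟩ := h2 y (.inl hy)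
        have hxl : x.length = m := by
          rcases h with h | rfl
          · exact hacc x h
          · exact hK
        have hzl : z.length = m := by
          rcases h1 z hz with h | h
          · exact hlen z h
          · exact hM z (by simp [h])
        exact ⟨z, hz, sub_trans (hxl.trans (hlen y hy).symm) ((hlen y hy).trans hzl.symm) hxy hyz⟩
      · exact h2 x (.inr h)

/-- `K` is a maximal clique of the subgraph induced by the first `k` vertices. -/
def IsMaxCliqueBelow (G : SimpleGraph (Fin n)) (k : ℕ) (K : Set (Fin n)) : Prop :=
  Maximal (fun K => G.IsClique K ∧ K ⊆ {j | j.1 < k}) K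

/-- The list contains the characteristic sequences of the maximal cliques of the subgraph induced
by the first `k` vertices, without repetition. -/
def ListsMaxCliques (G : SimpleGraph (Fin n)) (k : ℕ) (cl : List BSet) : Prop :=
  cl.Nodup ∧ ∀ l, l ∈ cl ↔ ∃ K, IsMaxCliqueBelow G k K ∧ l = charSeq k K

theorem exists_isMaxCliqueBelow {G : SimpleGraph (Fin n)} {k : ℕ} {Q : Set (Fin n)}
    (hQ : G.IsClique Q) (hk : Q ⊆ {j | j.1 < k}) : ∃ K, Q ⊆ K ∧ IsMaxCliqueBelow G k K :=
  (Set.toFinite {K : Set (Fin n) | G.IsClique K ∧ K ⊆ {j | j.1 < k}}).exists_le_maximal ⟨hQ, hk⟩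

/-- With `K` ranging over the old maximal cliques and `v` the new vertex, the candidates `K` and
`insert v (K ∩ N(v))` are cliques, and every clique of the larger graph lies in one of them. So the
maximal candidates are the maximal cliques. -/
theorem listsMaxCliques_extend {G : SimpleGraph (Fin n)} {k : ℕ} (hk : k < n) {cl : List BSet}
    (hcl : ListsMaxCliques G k cl) :
    ListsMaxCliques G (k + 1) (extend cl (charSeq n (G.neighborSet ⟨k, hk⟩))) := by
  classical
  set v : Fin n := ⟨k, hk⟩ with hv
  set M := cl.map (fun K => K ++ [false]) ++
    cl.map (fun K => inter K (charSeq n (G.neighborSet v)) ++ [true]) with hM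
  -- the candidates
  have hmemM : ∀ l, l ∈ M ↔ ∃ A, (IsMaxCliqueBelow G k A ∨
      ∃ K, IsMaxCliqueBelow G k K ∧ A = insert v (K ∩ G.neighborSet v)) ∧
      l = charSeq (k + 1) A := by
    intro l
    have h1 : ∀ K, IsMaxCliqueBelow G k K → charSeq (k + 1) K = charSeq k K ++ [false] := by
      intro K hK
      rw [charSeq_succ hk, decide_eq_false]
      exact fun h => absurd (hK.prop.2 h) (lt_irrefl k)
    have h2 : ∀ K, charSeq (k + 1) (insert v (K ∩ G.neighborSet v)) =
        inter (charSeq k K) (charSeq n (G.neighborSet v)) ++ [true] := by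
      intro K
      rw [charSeq_succ hk, inter_charSeq hk.le, decide_eq_true (Set.mem_insert v _)]
      congr 1
      refine List.map_congr_left fun i hi => ?_
      have : i ≠ v.1 := (List.mem_range.1 hi).ne
      simp [Set.image_insert_eq, this]
    rw [hM, List.mem_append, List.mem_map, List.mem_map]
    constructor
    · rintro (⟨_, hl, rfl⟩ | ⟨_, hl, rfl⟩) <;> obtain ⟨K, hK, rfl⟩ := (hcl.2 _).1 hl
      · exact ⟨K, .inl hK, (h1 K hK).symm⟩
      · exact ⟨_, .inr ⟨K, hK, rfl⟩, (h2 K).symm⟩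
    · rintro ⟨A, hA | ⟨K, hK, rfl⟩, rfl⟩
      · exact .inl ⟨_, (hcl.2 _).2 ⟨A, hA, rfl⟩, (h1 A hA).symm⟩
      · exact .inr ⟨_, (hcl.2 _).2 ⟨K, hK, rfl⟩, (h2 K).symm⟩
  have hclique : ∀ A, (IsMaxCliqueBelow G k A ∨
      ∃ K, IsMaxCliqueBelow G k K ∧ A = insert v (K ∩ G.neighborSet v)) →
      G.IsClique A ∧ A ⊆ {j | j.1 < k + 1} := by
    rintro A (hA | ⟨K, hK, rfl⟩)
    · exact ⟨hA.prop.1, fun j hj => Nat.lt_succ_of_lt (hA.prop.2 hj)⟩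
    · refine ⟨(hK.prop.1.subset Set.inter_subset_left).insert fun b hb _ => hb.2, ?_⟩
      rintro j (rfl | hj)
      · exact Nat.lt_succ_self k
      · exact Nat.lt_succ_of_lt (hK.prop.2 hj.1)
  have hcover : ∀ B : Set (Fin n), G.IsClique B → B ⊆ {j | j.1 < k + 1} →
      ∃ A, (IsMaxCliqueBelow G k A ∨
        ∃ K, IsMaxCliqueBelow G k K ∧ A = insert v (K ∩ G.neighborSet v)) ∧ B ⊆ A := by
    intro B hB hBk
    obtain ⟨K, hBK, hK⟩ := exists_isMaxCliqueBelow (k := k) (hB.subset (Set.sdiff_subset (t := {v})))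
      fun j hj => lt_of_le_of_ne (Nat.lt_succ_iff.1 (hBk hj.1)) fun e => hj.2 (Fin.ext e)
    by_cases hvB : v ∈ B
    · refine ⟨_, .inr ⟨K, hK, rfl⟩, fun j hj => ?_⟩
      rcases eq_or_ne j v with rfl | hne
      · exact Set.mem_insert _ _
      · exact Set.mem_insert_of_mem _ ⟨hBK ⟨hj, hne⟩, hB hvB hj hne.symm⟩
    · exact ⟨K, .inl hK, fun j hj => hBK ⟨hj, fun (e : j = v) => hvB (e ▸ hj)⟩⟩
  have hlenM : ∀ x ∈ M, x.length = k + 1 := by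
    intro x hx
    obtain ⟨A, -, rfl⟩ := (hmemM x).1 hx
    exact length_charSeq _ _
  obtain ⟨h1, h2, h3⟩ := foldl_insertMaximal M hlenM [] (by simp) .nil
  change ListsMaxCliques G (k + 1) (M.foldl insertMaximal [])
  have h1' : ∀ x ∈ M.foldl insertMaximal [], x ∈ M := fun x hx =>
    (h1 x hx).resolve_left List.not_mem_nil
  refine ⟨h3.imp fun {a b} h (e : a = b) => h.1 (e ▸ sub_refl a), fun l => ⟨fun hl => ?_, ?_⟩⟩
  · obtain ⟨A, hA, rfl⟩ := (hmemM l).1 (h1' l hl)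
    refine ⟨A, ⟨hclique A hA, fun B hB hAB => ?_⟩, rfl⟩
    obtain ⟨C, hC, hBC⟩ := hcover B hB.1 hB.2
    obtain ⟨y, hy, hCy⟩ := h2 _ (.inr ((hmemM _).2 ⟨C, hC, rfl⟩))
    obtain ⟨D, hD, rfl⟩ := (hmemM y).1 (h1' y hy)
    have hCD := (sub_charSeq (hclique C hC).2).1 hCy
    have hAD : A ⊆ D := (show A ⊆ B from hAB).trans (hBC.trans hCD)
    have heq : charSeq (k + 1) A = charSeq (k + 1) D := by
      by_contra hne
      have : Std.Symm (fun a b : BSet => ¬ sub a b = true ∧ ¬ sub b a = true) := ⟨fun _ _ => And.symm⟩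
      exact (h3.forall hl hy hne).1 ((sub_charSeq (hclique A hA).2).2 hAD)
    rw [charSeq_inj (hclique A hA).2 (hclique D hD).2 heq]
    exact hBC.trans hCD
  · rintro ⟨K, hK, rfl⟩
    obtain ⟨C, hC, hKC⟩ := hcover K hK.prop.1 hK.prop.2
    obtain ⟨y, hy, hCy⟩ := h2 _ (.inr ((hmemM _).2 ⟨C, hC, rfl⟩))
    obtain ⟨D, hD, rfl⟩ := (hmemM y).1 (h1' y hy)
    have hKD := hKC.trans ((sub_charSeq (hclique C hC).2).1 hCy)
    rwa [hK.eq_of_subset (hclique D hD) hKD]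

/-- The adjacency matrix. -/
noncomputable def adjacency (G : SimpleGraph (Fin n)) : List BSet :=
  (List.finRange n).map fun i => charSeq n (G.neighborSet i)

theorem enc_adjacency (G : SimpleGraph (Fin n)) : Enc.enc (adjacency G) = encodeGraph G := by
  change encodeList (List.map Enc.enc (adjacency G)) = _
  rw [adjacency, List.map_map, encodeGraph]
  congr 1
  exact List.map_congr_left fun i _ => enc_charSeq _

theorem listsMaxCliques_take (G : SimpleGraph (Fin n)) {k : ℕ} (hk : k ≤ n) :
    ListsMaxCliques G k (maxCliques ((adjacency G).take k)) := by
  induction k with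
  | zero =>
    refine ⟨List.nodup_singleton _, fun l => ?_⟩
    change l ∈ [[]] ↔ _
    rw [List.mem_singleton]
    constructor
    · rintro rfl
      exact ⟨∅, ⟨⟨Set.pairwise_empty _, by simp⟩, fun K hK _ j hj => absurd (hK.2 hj) (by simp)⟩,
        rfl⟩
    · rintro ⟨K, -, rfl⟩
      rfl
  | succ k ih =>
    have hlen : k < (adjacency G).length := by simp [adjacency]; omega
    rw [List.take_succ_eq_append_getElem hlen, maxCliques, List.foldl_append, List.foldl_cons,
      List.foldl_nil]
    have : (adjacency G)[k] = charSeq n (G.neighborSet ⟨k, hk⟩) := by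
      simp [adjacency]
    rw [this]
    exact listsMaxCliques_extend hk (ih (by omega))

theorem isMaxCliqueBelow_iff {G : SimpleGraph (Fin n)} {K : Set (Fin n)} :
    IsMaxCliqueBelow G n K ↔ Maximal G.IsClique K := by
  unfold IsMaxCliqueBelow
  congr! 2 with K
  exact and_iff_left (subset_lt K)

theorem listsMaxCliques_adjacency (G : SimpleGraph (Fin n)) :
    (maxCliques (adjacency G)).Nodup ∧
      ∀ l, l ∈ maxCliques (adjacency G) ↔ ∃ K, Maximal G.IsClique K ∧ l = charSeq n K := by
  have h := listsMaxCliques_take G le_rfl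
  rw [List.take_of_length_le (by simp [adjacency])] at h
  simpa only [ListsMaxCliques, isMaxCliqueBelow_iff] using h

/-- A maximal clique on the first `k` vertices extends to a maximal clique of `G` and is recovered
from it by restriction, so the bound for `G` applies to every intermediate list. -/
theorem length_le_of_listsMaxCliques {G : SimpleGraph (Fin n)} (hG : IsChordal G) {k : ℕ}
    {cl : List BSet} (hcl : ListsMaxCliques G k cl) : cl.length ≤ n + 1 := by
  classical
  have hex : ∀ l : BSet, ∃ K : Set (Fin n), l ∈ cl →
      Maximal G.IsClique K ∧ l = charSeq k (K ∩ {j | j.1 < k}) := by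
    intro l
    by_cases hl : l ∈ cl
    · obtain ⟨K, hK, rfl⟩ := (hcl.2 l).1 hl
      obtain ⟨L, hKL, hL⟩ := exists_maximal_clique hK.prop.1
      refine ⟨L, fun _ => ⟨hL, congrArg _ ?_⟩⟩
      exact hK.eq_of_subset ⟨hL.prop.subset Set.inter_subset_left, Set.inter_subset_right⟩
        (Set.subset_inter hKL hK.prop.2)
    · exact ⟨∅, fun h => (hl h).elim⟩
  choose f hf using hex
  have h1 : ({l | l ∈ cl} : Set BSet).ncard ≤ {K | Maximal G.IsClique K}.ncard :=
    Set.ncard_le_ncard_of_injOn f (fun l hl => (hf l hl).1)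
      (fun l hl l' hl' e => by rw [(hf l hl).2, (hf l' hl').2, e]) (Set.toFinite _)
  have h2 : ({l | l ∈ cl} : Set BSet).ncard = cl.length := by
    rw [← List.toFinset_card_of_nodup hcl.1, ← Set.ncard_coe_finset, List.coe_toFinset]
  have h3 := hG.ncard_maximal_cliques_le
  rw [Nat.card_fin] at h3
  omega

theorem sz_bset_le (l : BSet) : sz l ≤ l.length * 4 + 1 :=
  sz_le_of_forall fun b _ => sz_bool_le b

theorem maxCliques_polyTimeOn :
    PolyTimeOn (fun g => ∃ (n : ℕ) (G : SimpleGraph (Fin n)), IsChordal G ∧ g = adjacency G)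
      maxCliques := by
  -- At most `n + 1` sequences of at most `n` bits; a bit costs at most `4` with its list node.
  refine maxCliques_poly ((.X + 1) * (.X * 4 + 1 + 1) + 1) ?_
  rintro _ ⟨n, G, hG, rfl⟩ m hm
  have hlen : (adjacency G).length = n := by simp [adjacency]
  have hmn : m.length ≤ n := hlen ▸ hm.length_le
  have hn : n ≤ sz (adjacency G) := hlen.ge.trans (length_le_sz (adjacency G))
  rw [List.prefix_iff_eq_take.1 hm]
  have h := listsMaxCliques_take G hmn
  refine (sz_le_of_forall (M := sz (adjacency G) * 4 + 1) fun l hl => ?_).trans ?_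
  · obtain ⟨K, -, rfl⟩ := (h.2 l).1 hl
    have := sz_bset_le (charSeq m.length K)
    rw [length_charSeq] at this
    omega
  · have := length_le_of_listsMaxCliques hG h
    simp only [Polynomial.eval_add, Polynomial.eval_mul, Polynomial.eval_X, Polynomial.eval_one,
      Polynomial.eval_ofNat]
    gcongr
    omega

theorem sz_adjacency_le (G : SimpleGraph (Fin n)) : sz (adjacency G) ≤ n * (n * 4 + 2) + 1 := by
  refine (sz_le_of_forall (M := n * 4 + 1) fun l hl => ?_).trans (by simp [adjacency])
  obtain ⟨i, -, rfl⟩ := List.mem_map.1 hl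
  have := sz_bset_le (charSeq n (G.neighborSet i))
  rwa [length_charSeq] at this

end CliqueTreeAlgorithm

/-! ## Correctness of the search -/

namespace ChordalGraph

/-- `x` may be visited next, as a son of `p`, when the nodes in `vs` have been visited and the pairs
of nodes and fathers in `es` have been recorded. -/
structure Extends {V X : Type*} [DecidableEq X] (k : X → Set V) (vs : List X) (es : List (X × X))
    (x p : X) : Prop where
  notMem : x ∉ vs
  mem : p ∈ vs
  inter_subset : ∀ a ∈ vs, k a ∩ k x ⊆ k p
  maximal : ∀ a ∈ vs, ∀ b, b ∉ vs → ¬ k x ∩ k p ⊂ k a ∩ k b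
  isHub : ∀ b, b ∉ vs → k x ∩ k p ⊆ k b →
    (∀ c d, c ∉ vs → d ∉ vs → c ≠ d → k x ∩ k p ⊂ k c ∩ k d → k c ∩ k d ⊆ k b) →
    ∀ c d, c ∉ vs → d ∉ vs → c ≠ d → k x ∩ k p ⊂ k c ∩ k d → k c ∩ k d ⊆ k x
  isCenter : 3 ≤ (k x ∩ k p).ncard →
    (∀ c d, c ∉ vs → d ∉ vs → c ≠ d → ¬ k x ∩ k p ⊂ k c ∩ k d) →
    ∀ c ∈ vs, k x ∩ k p ⊆ k c →
      (∀ e ∈ es, k x ∩ k p ⊂ k e.1 ∩ k e.2 → c = e.1 ∨ c = e.2) →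
      (∀ e ∈ es, k x ∩ k p ⊂ k e.1 ∩ k e.2 → p = e.1 ∨ p = e.2) ∧ vs.idxOf p ≤ vs.idxOf c
  isFirst : ¬ (3 ≤ (k x ∩ k p).ncard ∧
      (∀ c d, c ∉ vs → d ∉ vs → c ≠ d → ¬ k x ∩ k p ⊂ k c ∩ k d) ∧
      ∃ c ∈ vs, k x ∩ k p ⊆ k c ∧
        ∀ e ∈ es, k x ∩ k p ⊂ k e.1 ∩ k e.2 → c = e.1 ∨ c = e.2) →
    ∀ c ∈ vs, k x ∩ k p ⊆ k c → vs.idxOf p ≤ vs.idxOf c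

/-- The possible states of a search. -/
inductive Visits {V X : Type*} [DecidableEq X] (k : X → Set V) (root : X) :
    List X → List (X × X) → Prop
  | start : Visits k root [root] []
  | step {vs : List X} {es : List (X × X)} {x p : X} :
      Visits k root vs es → Extends k vs es x p → Visits k root (vs ++ [x]) ((x, p) :: es)

namespace Visits

variable {V X : Type*} [DecidableEq X] {k : X → Set V} {root : X} {vs : List X} {es : List (X × X)}

theorem exists_eq_cons (h : Visits k root vs es) : ∃ l, vs = root :: l := by
  induction h with
  | start => exact ⟨[], rfl⟩
  | step _ _ ih =>
    obtain ⟨l, rfl⟩ := ih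
    exact ⟨_, List.cons_append⟩

theorem root_mem (h : Visits k root vs es) : root ∈ vs := by
  obtain ⟨l, rfl⟩ := h.exists_eq_cons
  exact List.mem_cons_self

theorem exists_mem_iff (h : Visits k root vs es) (x : X) :
    (∃ p, (x, p) ∈ es) ↔ x ∈ vs ∧ x ≠ root := by
  induction h with
  | start => simp
  | step h hx ih =>
    rename_i vs es y p
    have hy : y ≠ root := by
      rintro rfl
      exact hx.notMem h.root_mem
    simp only [List.mem_cons, Prod.mk.injEq, List.mem_append, List.not_mem_nil, or_false, exists_or,
      ih]
    constructor
    · rintro (⟨_, rfl, -⟩ | h)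
      · exact ⟨.inr rfl, hy⟩
      · exact ⟨.inl h.1, h.2⟩
    · rintro ⟨h | rfl, hr⟩
      · exact .inr ⟨h, hr⟩
      · exact .inl ⟨p, rfl, rfl⟩

theorem father_unique (h : Visits k root vs es) {x p q : X} (hp : (x, p) ∈ es)
    (hq : (x, q) ∈ es) : p = q := by
  induction h with
  | start => simp at hp
  | step h hx ih =>
    have hnot : ∀ {y q}, (y, q) ∈ _ → y ∈ _ := fun hy => ((h.exists_mem_iff _).1 ⟨_, hy⟩).1
    simp only [List.mem_cons, Prod.mk.injEq] at hp hq
    rcases hp with ⟨rfl, rfl⟩ | hp <;> rcases hq with ⟨e, rfl⟩ | hq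
    · rfl
    · exact (hx.notMem (hnot hq)).elim
    · exact (hx.notMem (e ▸ hnot hp)).elim
    · exact ih hp hq

theorem nodup_arcs (h : Visits k root vs es) : es.Nodup := by
  induction h with
  | start => exact List.nodup_nil
  | step h hx ih =>
    exact List.nodup_cons.2 ⟨fun hmem => hx.notMem ((h.exists_mem_iff _).1 ⟨_, hmem⟩).1, ih⟩

/-- Rewinds the search to the moment at which the arc was recorded. -/
theorem exists_extends (h : Visits k root vs es) {x p : X} (hxp : (x, p) ∈ es) :
    ∃ vs₁ vs₂ es₁, vs = vs₁ ++ x :: vs₂ ∧ es₁ ⊆ es ∧ Visits k root vs₁ es₁ ∧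
      Extends k vs₁ es₁ x p := by
  induction h with
  | start => simp at hxp
  | step h hx ih =>
    rename_i vs es y q
    simp only [List.mem_cons, Prod.mk.injEq] at hxp
    rcases hxp with ⟨rfl, rfl⟩ | hxp
    · exact ⟨vs, [], es, rfl, List.subset_cons_self _ _, h, hx⟩
    · obtain ⟨vs₁, vs₂, es₁, rfl, hes, h₁, h₂⟩ := ih hxp
      exact ⟨vs₁, vs₂ ++ [y], es₁, by simp, fun e he => List.mem_cons_of_mem _ (hes he), h₁, h₂⟩

/-- A complete search gives a search order. -/
theorem searchOrder (h : Visits k root vs es) (hvs : ∀ x, x ∈ vs) :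
    ∃ par : X → X, SearchOrder k (fun x => vs.idxOf x) par root ∧
      ∀ x p, (x, p) ∈ es ↔ x ≠ root ∧ par x = p := by
  have hex : ∀ x, ∃ p, x ≠ root → (x, p) ∈ es := by
    intro x
    by_cases hx : x = root
    · exact ⟨x, fun h => (h hx).elim⟩
    · obtain ⟨p, hp⟩ := (h.exists_mem_iff x).2 ⟨hvs x, hx⟩
      exact ⟨p, fun _ => hp⟩
  choose par hpar using hex
  have hiff : ∀ x p, (x, p) ∈ es ↔ x ≠ root ∧ par x = p := by
    refine fun x p => ⟨fun hxp => ?_, ?_⟩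
    · have hx := ((h.exists_mem_iff x).1 ⟨p, hxp⟩).2
      exact ⟨hx, h.father_unique (hpar x hx) hxp⟩
    · rintro ⟨hx, rfl⟩
      exact hpar x hx
  -- Positions do not change when nodes are appended, so membership in the list before `x` amounts
  -- to a smaller index in the final list.
  have main : ∀ x, x ≠ root → ∃ (vs₁ : List X) (es₁ : List (X × X)), Extends k vs₁ es₁ x (par x) ∧
      (∀ a, vs.idxOf a < vs.idxOf x ↔ a ∈ vs₁) ∧
      (∀ a ∈ vs₁, vs.idxOf a = vs₁.idxOf a) ∧
      (∀ j q, (j, q) ∈ es₁ ↔ j ≠ root ∧ j ∈ vs₁ ∧ par j = q) := by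
    intro x hx
    obtain ⟨vs₁, vs₂, es₁, rfl, hes, h₁, h₂⟩ := h.exists_extends (hpar x hx)
    refine ⟨vs₁, es₁, h₂, fun a => ?_, fun a ha => List.idxOf_append_of_mem ha, fun j q => ?_⟩
    · have hxi : (vs₁ ++ x :: vs₂).idxOf x = vs₁.length := by
        rw [List.idxOf_append_of_notMem h₂.notMem, List.idxOf_cons_self, add_zero]
      rw [hxi]
      by_cases ha : a ∈ vs₁
      · rw [List.idxOf_append_of_mem ha]
        exact iff_of_true (List.idxOf_lt_length_of_mem ha) ha
      · rw [List.idxOf_append_of_notMem ha]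
        exact iff_of_false (by omega) ha
    · constructor
      · intro hj
        have := (h₁.exists_mem_iff j).1 ⟨q, hj⟩
        exact ⟨this.2, this.1, ((hiff j q).1 (hes hj)).2⟩
      · rintro ⟨hj, hjv, rfl⟩
        obtain ⟨q, hq⟩ := (h₁.exists_mem_iff j).2 ⟨hjv, hj⟩
        rwa [((hiff j q).1 (hes hq)).2]
  refine ⟨par, ⟨fun x y hxy => (List.idxOf_inj (hvs x)).1 hxy, ?_, ?_, ?_, ?_, ?_, ?_, ?_⟩, hiff⟩
  · obtain ⟨l, rfl⟩ := h.exists_eq_cons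
    exact List.idxOf_cons_self
  · intro x hx
    obtain ⟨vs₁, es₁, he, hlt, -, -⟩ := main x hx
    exact (hlt _).2 he.mem
  · intro x a hx ha
    obtain ⟨vs₁, es₁, he, hlt, -, -⟩ := main x hx
    exact he.inter_subset a ((hlt a).1 ha)
  · intro x a b hx ha hb
    obtain ⟨vs₁, es₁, he, hlt, -, -⟩ := main x hx
    exact he.maximal a ((hlt a).1 ha) b fun hb' => not_lt.2 hb ((hlt b).2 hb')
  · intro x b hx hb hS hub c d hc hd
    obtain ⟨vs₁, es₁, he, hlt, -, -⟩ := main x hx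
    simp only [IsHub, ← not_lt, hlt] at hb hub hc hd
    exact he.isHub b hb hS hub c d hc hd
  · intro x c hx hcard hexh hc
    obtain ⟨vs₁, es₁, he, hlt, hidx, hes⟩ := main x hx
    simp only [IsCenterBefore, Exhausted, ← not_lt, hlt] at hexh hc ⊢
    have hc₁ := hc.1
    have := he.isCenter hcard hexh c hc₁ hc.2.1 fun e hee hS => by
      obtain ⟨hj, hjv, e2⟩ := (hes e.1 e.2).1 hee
      rw [← e2] at hS ⊢
      exact hc.2.2 e.1 hj hjv hS
    refine ⟨⟨he.mem, Set.inter_subset_right, fun j hj hjv hS => ?_⟩, ?_⟩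
    · exact this.1 (j, par j) ((hes _ _).2 ⟨hj, hjv, rfl⟩) hS
    · rw [hidx _ he.mem, hidx _ hc₁, not_lt]
      exact this.2
  · intro x c hx hcond hS
    obtain ⟨vs₁, es₁, he, hlt, hidx, hes⟩ := main x hx
    by_cases hc : c ∈ vs₁
    · rw [hidx _ he.mem, hidx _ hc]
      refine he.isFirst (fun ⟨hcard, hexh, b, hb, hSb, hbe⟩ => hcond ⟨hcard, ?_, b, ?_⟩) c hc hS
      · simp only [Exhausted, ← not_lt, hlt]
        exact hexh
      · simp only [IsCenterBefore, hlt]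
        exact ⟨hb, hSb, fun j hj hjv hS => hbe (j, par j) ((hes _ _).2 ⟨hj, hjv, rfl⟩) hS⟩
    · have h1 := (hlt _).2 he.mem
      have h2 := mt (hlt c).1 hc
      omega

end Visits

/-- The field `Extends.maximal` is the hypothesis under which `Explored.insert` preserves the
invariant. -/
theorem Visits.explored {V : Type*} [Finite V] {G : SimpleGraph V} [DecidableEq (MaxClique G)]
    (hG : IsChordal G) {root : MaxClique G} {vs : List (MaxClique G)}
    {es : List (MaxClique G × MaxClique G)}
    (h : Visits (fun K : MaxClique G => K.1) root vs es) :
    Explored G {A | ∃ K ∈ vs, K.1 = A} := by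
  induction h with
  | start =>
    convert explored_singleton root.2
    simp [eq_comm]
  | step h hx ih =>
    rename_i vs es x p
    have hnot : x.1 ∉ {A | ∃ K ∈ vs, K.1 = A} := fun ⟨K, hK, e⟩ => hx.notMem (Subtype.ext e ▸ hK)
    convert ih.insert hG x.2 hnot ⟨p, hx.mem, rfl⟩ ?_ using 1
    · ext A
      simp only [List.mem_append, List.mem_singleton, Set.mem_ofPred_eq, Set.mem_insert_iff]
      constructor
      · rintro ⟨K, hK | rfl, rfl⟩
        · exact .inr ⟨K, hK, rfl⟩
        · exact .inl rfl
      · rintro (rfl | ⟨K, hK, rfl⟩)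
        · exact ⟨x, .inr rfl, rfl⟩
        · exact ⟨K, .inl hK, rfl⟩
    · rintro _ ⟨a, ha, rfl⟩ Y hY hYA
      rw [Set.inter_comm p.1]
      exact hx.maximal a ha ⟨Y, hY⟩ fun hmem => hYA ⟨_, hmem, rfl⟩

end ChordalGraph

/-! ### The computation on characteristic sequences follows `Visits`. -/

namespace CliqueTreeAlgorithm

open TreeMachine ChordalGraph

variable {n : ℕ} {G : SimpleGraph (Fin n)}

/-- The characteristic sequence of a maximal clique. -/
noncomputable def cliqueSeq (K : MaxClique G) : BSet := charSeq n K.1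

theorem cliqueSeq_injective : Function.Injective (cliqueSeq (G := G)) := fun _ _ h =>
  Subtype.ext (charSeq_inj (subset_lt _) (subset_lt _) h)

theorem inter_cliqueSeq (K L : MaxClique G) :
    inter (cliqueSeq K) (cliqueSeq L) = charSeq n (K.1 ∩ L.1) :=
  inter_charSeq le_rfl _ _

/-- The running set only grows, so a set that was refused because it did not contain the running set
cannot contain the final one. -/
theorem foldl_sub_maximal {m : ℕ} (M : List BSet) (hM : ∀ x ∈ M, x.length = m) :
    ∀ c : BSet, c.length = m →
      (M.foldl (fun c x => if sub c x then x else c) c ∈ c :: M) ∧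
      sub c (M.foldl (fun c x => if sub c x then x else c) c) = true ∧
      ∀ x ∈ c :: M, sub (M.foldl (fun c x => if sub c x then x else c) c) x = true →
        sub x (M.foldl (fun c x => if sub c x then x else c) c) = true := by
  induction M with
  | nil =>
    intro c _
    refine ⟨by simp, sub_refl c, fun x hx _ => ?_⟩
    rw [List.mem_singleton.1 hx]
    exact sub_refl c
  | cons a M ih =>
    intro c hc
    have ha : a.length = m := hM a (by simp)
    have hM' : ∀ x ∈ M, x.length = m := fun x hx => hM x (by simp [hx])
    rw [List.foldl_cons]
    by_cases h : sub c a = true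
    · rw [if_pos h]
      obtain ⟨h1, h2, h3⟩ := ih hM' a ha
      have hr : (M.foldl (fun c x => if sub c x then x else c) a).length = m := by
        rcases List.mem_cons.1 h1 with e | e
        · rw [e]; exact ha
        · exact hM' _ e
      have hcr := sub_trans (hc.trans ha.symm) (ha.trans hr.symm) h h2
      refine ⟨List.mem_cons_of_mem _ h1, hcr, fun x hx hxr => ?_⟩
      rcases List.mem_cons.1 hx with rfl | hx
      · exact hcr
      · exact h3 x hx hxr
    · rw [if_neg h]
      obtain ⟨h1, h2, h3⟩ := ih hM' c hc
      have hr : (M.foldl (fun c x => if sub c x then x else c) c).length = m := by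
        rcases List.mem_cons.1 h1 with e | e
        · rw [e]; exact hc
        · exact hM' _ e
      refine ⟨?_, h2, fun x hx hxr => ?_⟩
      · rcases List.mem_cons.1 h1 with e | e
        · rw [e]; simp
        · simp [e]
      · rcases List.mem_cons.1 hx with rfl | hx
        · exact h3 x (by simp) hxr
        · rcases List.mem_cons.1 hx with rfl | hx
          · exact (h (sub_trans (hc.trans hr.symm) (hr.trans ha.symm) h2 hxr)).elim
          · exact h3 x (by simp [hx]) hxr

theorem exists_maxLabel {vs us : List (MaxClique G)} (hvs : vs ≠ []) (hus : us ≠ []) :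
    ∃ P ∈ vs, ∃ K ∈ us, maxLabel (vs.map cliqueSeq) (us.map cliqueSeq) = charSeq n (P.1 ∩ K.1) ∧
      ∀ a ∈ vs, ∀ b ∈ us, ¬ P.1 ∩ K.1 ⊂ a.1 ∩ b.1 := by
  set M := (vs.map cliqueSeq).flatMap fun P => (us.map cliqueSeq).map fun K => inter P K with hMdef
  have hM : ∀ l, l ∈ M ↔ ∃ P ∈ vs, ∃ K ∈ us, l = charSeq n (P.1 ∩ K.1) := by
    intro l
    simp only [hMdef, List.mem_flatMap, List.mem_map]
    constructor
    · rintro ⟨_, ⟨P, hP, rfl⟩, _, ⟨K, hK, rfl⟩, rfl⟩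
      exact ⟨P, hP, K, hK, inter_cliqueSeq P K⟩
    · rintro ⟨P, hP, K, hK, rfl⟩
      exact ⟨_, ⟨P, hP, rfl⟩, _, ⟨K, hK, rfl⟩, inter_cliqueSeq P K⟩
  have hlen : ∀ x ∈ M, x.length = n := by
    intro x hx
    obtain ⟨P, -, K, -, rfl⟩ := (hM x).1 hx
    exact length_charSeq _ _
  have hmax : maxLabel (vs.map cliqueSeq) (us.map cliqueSeq) ∈ M ∧ ∀ x ∈ M,
      sub (maxLabel (vs.map cliqueSeq) (us.map cliqueSeq)) x = true →
        sub x (maxLabel (vs.map cliqueSeq) (us.map cliqueSeq)) = true := by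
    change M.foldl (fun c x => if sub c x then x else c) [] ∈ M ∧ ∀ x ∈ M,
      sub (M.foldl (fun c x => if sub c x then x else c) []) x = true →
        sub x (M.foldl (fun c x => if sub c x then x else c) []) = true
    obtain ⟨P, hP⟩ := List.exists_mem_of_ne_nil vs hvs
    obtain ⟨K, hK⟩ := List.exists_mem_of_ne_nil us hus
    have hne : charSeq n (P.1 ∩ K.1) ∈ M := (hM _).2 ⟨P, hP, K, hK, rfl⟩
    rcases hMe : M with _ | ⟨a, M'⟩
    · rw [hMe] at hne
      simp at hne
    · rw [hMe] at hlen
      -- The initial value `[]` does not have length `n`, but the first intersection replaces it at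
      -- once.
      have hnil : sub [] a = true := rfl
      rw [List.foldl_cons, if_pos hnil]
      have := foldl_sub_maximal M' (fun x hx => hlen x (by simp [hx])) a (hlen a (by simp))
      exact ⟨this.1, this.2.2⟩
  obtain ⟨P, hP, K, hK, e⟩ := (hM _).1 hmax.1
  refine ⟨P, hP, K, hK, e, fun a ha b hb hlt => ?_⟩
  have := hmax.2 _ ((hM _).2 ⟨a, ha, b, hb, rfl⟩)
  rw [e, sub_charSeq_self, sub_charSeq_self] at this
  exact hlt.2 (this hlt.1)

theorem hub_iff {us : List (MaxClique G)} {S : Set (Fin n)} {C : MaxClique G} :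
    hub (us.map cliqueSeq) (charSeq n S) (cliqueSeq C) = true ↔
      ∀ c ∈ us, ∀ d ∈ us, c ≠ d → S ⊂ c.1 ∩ d.1 → c.1 ∩ d.1 ⊆ C.1 := by
  simp only [hub, List.all_map, List.all_eq_true, Function.comp_apply, Bool.or_eq_true,
    Bool.not_eq_true', inter_cliqueSeq, ← Bool.not_eq_true, ssub_charSeq]
  simp only [cliqueSeq, eqv_charSeq, sub_charSeq_self, Subtype.val_inj]
  refine forall₂_congr fun c _ => forall₂_congr fun d _ => ?_
  tauto

theorem exhausted_iff {us : List (MaxClique G)} {S : Set (Fin n)} :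
    exhausted (us.map cliqueSeq) (charSeq n S) = true ↔
      ∀ c ∈ us, ∀ d ∈ us, c ≠ d → ¬ S ⊂ c.1 ∩ d.1 := by
  simp only [exhausted, List.all_map, List.all_eq_true, Function.comp_apply, Bool.or_eq_true,
    Bool.not_eq_true', inter_cliqueSeq, ← Bool.not_eq_true, ssub_charSeq]
  simp only [cliqueSeq, eqv_charSeq, Subtype.val_inj]
  refine forall₂_congr fun c _ => forall₂_congr fun d _ => ?_
  tauto

/-- The encoding of a list of arcs. -/
noncomputable def arcSeq (es : List (MaxClique G × MaxClique G)) : List (BSet × BSet) :=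
  es.map fun e => (cliqueSeq e.1, cliqueSeq e.2)

theorem center_iff {es : List (MaxClique G × MaxClique G)} {S : Set (Fin n)} {C : MaxClique G} :
    center (arcSeq es) (charSeq n S) (cliqueSeq C) = true ↔
      S ⊆ C.1 ∧ ∀ e ∈ es, S ⊂ e.1.1 ∩ e.2.1 → C = e.1 ∨ C = e.2 := by
  simp only [center, arcSeq, Bool.and_eq_true, List.all_map, List.all_eq_true, Function.comp_apply,
    Bool.or_eq_true, Bool.not_eq_true', inter_cliqueSeq, ← Bool.not_eq_true, ssub_charSeq]
  simp only [cliqueSeq, eqv_charSeq, sub_charSeq_self, Subtype.val_inj]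
  refine and_congr_right fun _ => forall₂_congr fun e _ => ?_
  tauto

theorem headD_mem {α : Type*} {l : List α} (h : l ≠ []) (d : α) : l.headD d ∈ l := by
  cases l with
  | nil => exact (h rfl).elim
  | cons a l => exact List.mem_cons_self

/-- If the list of hubs is nonempty, its head is taken; if it is empty, the last clause is vacuous.
-/
theorem exists_next {us : List (MaxClique G)} {S : Set (Fin n)} {K : MaxClique G} (hK : K ∈ us)
    (hS : S ⊆ K.1) : ∃ x ∈ us, next (us.map cliqueSeq) (charSeq n S) = cliqueSeq x ∧ S ⊆ x.1 ∧
      ∀ b ∈ us, S ⊆ b.1 → (∀ c ∈ us, ∀ d ∈ us, c ≠ d → S ⊂ c.1 ∩ d.1 → c.1 ∩ d.1 ⊆ b.1) →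
        ∀ c ∈ us, ∀ d ∈ us, c ≠ d → S ⊂ c.1 ∩ d.1 → c.1 ∩ d.1 ⊆ x.1 := by
  unfold next
  set A := (us.map cliqueSeq).filter fun K =>
    sub (charSeq n S) K && hub (us.map cliqueSeq) (charSeq n S) K with hA
  set B := (us.map cliqueSeq).filter fun K => sub (charSeq n S) K with hB
  have hAmem : ∀ l, l ∈ A ↔ ∃ x ∈ us, (S ⊆ x.1 ∧
      ∀ c ∈ us, ∀ d ∈ us, c ≠ d → S ⊂ c.1 ∩ d.1 → c.1 ∩ d.1 ⊆ x.1) ∧ cliqueSeq x = l := by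
    intro l
    rw [hA, List.mem_filter, List.mem_map]
    constructor
    · rintro ⟨⟨x, hx, rfl⟩, h⟩
      rw [Bool.and_eq_true, hub_iff] at h
      exact ⟨x, hx, ⟨sub_charSeq_self.1 h.1, h.2⟩, rfl⟩
    · rintro ⟨x, hx, h, rfl⟩
      refine ⟨⟨x, hx, rfl⟩, ?_⟩
      rw [Bool.and_eq_true, hub_iff]
      exact ⟨sub_charSeq_self.2 h.1, h.2⟩
  by_cases hne : A = []
  · rw [hne, List.nil_append]
    have hmem : cliqueSeq K ∈ B :=
      List.mem_filter.2 ⟨List.mem_map_of_mem hK, sub_charSeq_self.2 hS⟩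
    have := headD_mem (List.ne_nil_of_mem hmem) []
    rw [hB, List.mem_filter, List.mem_map] at this
    obtain ⟨⟨x, hx, e⟩, hxS⟩ := this
    rw [← hB, ← e] at hxS
    refine ⟨x, hx, e.symm, sub_charSeq_self.1 hxS, fun b hb hbS hbh => ?_⟩
    have := (hAmem _).2 ⟨b, hb, ⟨hbS, hbh⟩, rfl⟩
    rw [hne] at this
    simp at this
  · have hhead : (A ++ B).headD [] = A.headD [] := by
      cases h : A with
      | nil => exact (hne h).elim
      | cons a A => rfl
    rw [hhead]
    obtain ⟨x, hx, ⟨hxS, hxh⟩, e⟩ := (hAmem _).1 (headD_mem hne [])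
    exact ⟨x, hx, e.symm, hxS, fun _ _ _ _ => hxh⟩

/-- The fallback `l` is not reached, and the head of a filtered list is its earliest element in
`vs`. -/
theorem headD_filter_map {X : Type*} [DecidableEq X] {f : X → BSet} (P : BSet → Bool)
    {vs : List X} (hne : ∃ c ∈ vs, P (f c) = true) (l : List BSet) :
    ∃ p ∈ vs, ((vs.map f).filter P ++ l).headD [] = f p ∧ P (f p) = true ∧
      ∀ c ∈ vs, P (f c) = true → vs.idxOf p ≤ vs.idxOf c := by
  induction vs with
  | nil => simp at hne
  | cons a vs ih =>
    by_cases ha : P (f a) = true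
    · exact ⟨a, by simp, by simp [ha], ha, fun c _ _ => by simp⟩
    · obtain ⟨c, hc, hPc⟩ := hne
      have hc' : c ∈ vs := (List.mem_cons.1 hc).resolve_left fun e => ha (e ▸ hPc)
      obtain ⟨p, hp, h1, h2, h3⟩ := ih ⟨c, hc', hPc⟩
      refine ⟨p, List.mem_cons_of_mem _ hp, by simpa [ha] using h1, h2, fun c hc hPc => ?_⟩
      have hc' : c ∈ vs := (List.mem_cons.1 hc).resolve_left fun e => ha (e ▸ hPc)
      rw [List.idxOf_cons_ne _ fun (e : a = p) => ha (e ▸ h2),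
        List.idxOf_cons_ne _ fun (e : a = c) => ha (e ▸ hPc)]
      exact Nat.succ_le_succ (h3 c hc' hPc)

/-- The position of the first occurrence in a list. -/
abbrev position {X : Type*} [DecidableEq X] (l : List X) (x : X) : ℕ := l.idxOf x

theorem exists_father [DecidableEq (MaxClique G)] {vs us : List (MaxClique G)} {es : List (MaxClique G × MaxClique G)}
    {S : Set (Fin n)} {P : MaxClique G} (hP : P ∈ vs) (hS : S ⊆ P.1) :
    ∃ p ∈ vs, father (vs.map cliqueSeq) (arcSeq es) (us.map cliqueSeq) (charSeq n S) =
        cliqueSeq p ∧ S ⊆ p.1 ∧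
      (3 ≤ S.ncard → (∀ c ∈ us, ∀ d ∈ us, c ≠ d → ¬ S ⊂ c.1 ∩ d.1) →
        ∀ c ∈ vs, S ⊆ c.1 → (∀ e ∈ es, S ⊂ e.1.1 ∩ e.2.1 → c = e.1 ∨ c = e.2) →
          (∀ e ∈ es, S ⊂ e.1.1 ∩ e.2.1 → p = e.1 ∨ p = e.2) ∧ position vs p ≤ position vs c) ∧
      (¬ (3 ≤ S.ncard ∧ (∀ c ∈ us, ∀ d ∈ us, c ≠ d → ¬ S ⊂ c.1 ∩ d.1) ∧
          ∃ c ∈ vs, S ⊆ c.1 ∧ ∀ e ∈ es, S ⊂ e.1.1 ∩ e.2.1 → c = e.1 ∨ c = e.2) →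
        ∀ c ∈ vs, S ⊆ c.1 → position vs p ≤ position vs c) := by
  unfold father
  by_cases hcond : 3 ≤ S.ncard ∧ (∀ c ∈ us, ∀ d ∈ us, c ≠ d → ¬ S ⊂ c.1 ∩ d.1) ∧
      ∃ c ∈ vs, S ⊆ c.1 ∧ ∀ e ∈ es, S ⊂ e.1.1 ∩ e.2.1 → c = e.1 ∨ c = e.2
  · obtain ⟨hcard, hex, c₀, hc₀, hc₀'⟩ := hcond
    rw [if_pos (by rw [Bool.and_eq_true, big_charSeq, exhausted_iff]; exact ⟨hcard, hex⟩)]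
    obtain ⟨p, hp, h1, h2, h3⟩ := headD_filter_map (f := cliqueSeq)
      (fun C => center (arcSeq es) (charSeq n S) C) ⟨c₀, hc₀, center_iff.2 hc₀'⟩
      ((vs.map cliqueSeq).filter fun C => sub (charSeq n S) C)
    rw [center_iff] at h2
    exact ⟨p, hp, h1, h2.1, fun _ _ c hc hcS hce => ⟨h2.2, h3 c hc (center_iff.2 ⟨hcS, hce⟩)⟩,
      fun hn => (hn ⟨hcard, hex, c₀, hc₀, hc₀'⟩).elim⟩
  · have hnil : (if (big (charSeq n S) && exhausted (us.map cliqueSeq) (charSeq n S)) = true then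
        (vs.map cliqueSeq).filter (fun C => center (arcSeq es) (charSeq n S) C) else []) = [] := by
      split
      · rename_i h
        rw [Bool.and_eq_true, big_charSeq, exhausted_iff] at h
        rw [List.filter_eq_nil_iff]
        rintro _ hl hc
        obtain ⟨c, hc', rfl⟩ := List.mem_map.1 hl
        exact hcond ⟨h.1, h.2, c, hc', center_iff.1 hc⟩
      · rfl
    rw [hnil, List.nil_append, ← List.append_nil (List.filter _ _)]
    obtain ⟨p, hp, h1, h2, h3⟩ := headD_filter_map (f := cliqueSeq)
      (fun C => sub (charSeq n S) C) ⟨P, hP, sub_charSeq_self.2 hS⟩ []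
    exact ⟨p, hp, h1, sub_charSeq_self.1 h2,
      fun hcard hex c hc hcS hce => (hcond ⟨hcard, hex, c, hc, hcS, hce⟩).elim,
      fun _ c hc hcS => h3 c hc (sub_charSeq_self.2 hcS)⟩

/-- One step of the search. -/
theorem exists_step [DecidableEq (MaxClique G)] (hG : IsChordal G) {root : MaxClique G} {vs us : List (MaxClique G)}
    {es : List (MaxClique G × MaxClique G)}
    (h : Visits (fun K : MaxClique G => K.1) root vs es) (hus : ∀ K, K ∈ us ↔ K ∉ vs)
    (hne : us ≠ []) :
    ∃ x ∈ us, ∃ p, Extends (fun K : MaxClique G => K.1) vs es x p ∧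
      step (vs.map cliqueSeq, arcSeq es, us.map cliqueSeq) =
        ((vs ++ [x]).map cliqueSeq, arcSeq ((x, p) :: es),
          (us.filter fun K => K ≠ x).map cliqueSeq) := by
  obtain ⟨P, hP, K, hK, hlab, hmax⟩ := exists_maxLabel (List.ne_nil_of_mem h.root_mem) hne
  obtain ⟨x, hx, hnext, hxS, hub⟩ := exists_next hK (Set.inter_subset_right (s := P.1) (t := K.1))
  obtain ⟨p, hp, hfather, hpS, hcenter, hfirst⟩ := exists_father (us := us) (es := es) hP
    (Set.inter_subset_left (s := P.1) (t := K.1))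
  have hxvs : x ∉ vs := (hus x).1 hx
  -- The clique `x` need not be the `K` that realized the maximal intersection, but it contains that
  -- intersection, so it realizes it too.
  have hPx : P.1 ∩ x.1 = P.1 ∩ K.1 := by
    by_contra hcon
    exact hmax P hP x hx ((Set.subset_inter Set.inter_subset_left hxS).ssubset_of_ne
      (Ne.symm hcon))
  have hinter : ∀ a ∈ vs, a.1 ∩ x.1 ⊆ P.1 ∩ K.1 := by
    intro a ha
    rw [← hPx]
    refine (h.explored hG).inter_subset hG x.2
      (fun ⟨L, hL, e⟩ => hxvs (Subtype.ext e ▸ hL)) ⟨P, hP, rfl⟩ ?_ ⟨a, ha, rfl⟩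
    rintro _ ⟨b, hb, rfl⟩ Y hY hYA
    rw [hPx]
    exact hmax b hb ⟨Y, hY⟩ ((hus _).2 fun hm => hYA ⟨_, hm, rfl⟩)
  -- Likewise the father `p` may differ from `P`; the running intersection property keeps the label
  -- the same.
  have hS : x.1 ∩ p.1 = P.1 ∩ K.1 :=
    Set.Subset.antisymm (by rw [Set.inter_comm]; exact hinter p hp) (Set.subset_inter hxS hpS)
  refine ⟨x, hx, p, ⟨hxvs, hp, fun a ha => (hinter a ha).trans hpS, ?_, ?_, ?_, ?_⟩, ?_⟩
  · rw [hS]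
    exact fun a ha b hb => hmax a ha b ((hus b).2 hb)
  · rw [hS]
    simp only [← hus]
    exact fun b hb hbS hbh c d hc hd =>
      hub b hb hbS (fun c hc d hd => hbh c d hc hd) c hc d hd
  · rw [hS]
    simp only [← hus]
    exact fun hcard hex => hcenter hcard fun c hc d hd => hex c d hc hd
  · rw [hS]
    simp only [← hus]
    exact fun hn => hfirst fun ⟨h1, h2, h3⟩ => hn ⟨h1, fun c d hc hd => h2 c hc d hd, h3⟩
  · have hfilter : (us.map cliqueSeq).filter (fun L => !eqv L (cliqueSeq x)) =
        (us.filter fun K => K ≠ x).map cliqueSeq := by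
      rw [List.filter_map]
      congr 1
      refine List.filter_congr fun K _ => ?_
      rw [Bool.eq_iff_iff]
      simp only [Function.comp_apply, Bool.not_eq_true', ← Bool.not_eq_true, decide_eq_true_eq]
      rw [cliqueSeq, cliqueSeq, eqv_charSeq, Subtype.val_inj]
    simp only [step, hlab, hnext, visit, hfather, hfilter]
    simp [arcSeq]

/-- Each step removes exactly one unvisited clique, so a counter of length `us.length` ends with all
cliques visited. -/
theorem exists_foldl_step [DecidableEq (MaxClique G)] (hG : IsChordal G) {root : MaxClique G} :
    ∀ (l : List BSet) (vs us : List (MaxClique G)) (es : List (MaxClique G × MaxClique G)),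
      Visits (fun K : MaxClique G => K.1) root vs es → (∀ K, K ∈ us ↔ K ∉ vs) → us.Nodup →
      us.length = l.length →
      ∃ vs' es', Visits (fun K : MaxClique G => K.1) root vs' es' ∧ (∀ K, K ∈ vs') ∧
        l.foldl (fun st _ => step st) (vs.map cliqueSeq, arcSeq es, us.map cliqueSeq) =
          (vs'.map cliqueSeq, arcSeq es', []) := by
  intro l
  induction l with
  | nil =>
    intro vs us es h hus _ hlen
    obtain rfl := List.length_eq_zero_iff.1 hlen
    exact ⟨vs, es, h, fun K => by simpa using hus K, rfl⟩
  | cons a l ih =>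
    intro vs us es h hus hnd hlen
    obtain ⟨x, hx, p, hext, hstep⟩ := exists_step hG h hus (by rintro rfl; simp at hlen)
    rw [List.foldl_cons, hstep]
    refine ih _ _ _ (h.step hext) (fun K => ?_) (hnd.filter _) ?_
    · simp [hus]
    · have : (us.filter fun K => K ≠ x) = us.erase x := by
        rw [hnd.erase_eq_filter]
        exact List.filter_congr fun K _ => by rw [Bool.eq_iff_iff]; simp
      rw [this, List.length_erase_of_mem hx, hlen]
      rfl

/-- The algorithm computes a clique-tree with the desired properties. -/
theorem exists_treeOf_eq (hG : IsChordal G) :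
    ∃ T : RootedCliqueTree G, T.IsEncodedBy (Enc.enc (treeOf (maxCliques (adjacency G)))) ∧
      ∀ K P : MaxClique G, T.IsParent P K →
        (T.WeaklyConvergent (K.1 ∩ P.1) → 3 ≤ (K.1 ∩ P.1).ncard → T.Convergent (K.1 ∩ P.1)) ∧
        ∀ S : Set (Fin n), IsMinimalSeparatorOn G (T.below K) S → S ⊆ K.1 ∩ P.1 →
          T.Convergent S ∧ 3 ≤ S.ncard ∧
          ∃ S' : Set (Fin n), IsMinimalSeparatorOn G (T.below K) S' ∧ S ⊂ S' := by
  classical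
  obtain ⟨hnd, hmem⟩ := listsMaxCliques_adjacency G
  obtain ⟨xs, hxs⟩ : maxCliques (adjacency G) ∈ Set.range (List.map (cliqueSeq (G := G))) := by
    rw [Set.range_list_map]
    intro l hl
    obtain ⟨K, hK, rfl⟩ := (hmem l).1 hl
    exact ⟨⟨K, hK⟩, rfl⟩
  rw [← hxs] at hnd hmem ⊢
  have hall : ∀ K : MaxClique G, K ∈ xs := by
    intro K
    obtain ⟨L, hL, e⟩ := List.mem_map.1 ((hmem _).2 ⟨K.1, K.2, rfl⟩)
    rwa [← cliqueSeq_injective e]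
  have hxnd : xs.Nodup := hnd.of_map _
  rcases xs with _ | ⟨root, us⟩
  · obtain ⟨K, -, hK⟩ := exists_maximal_clique (G := G) (Set.pairwise_empty _)
    simpa using hall ⟨K, hK⟩
  obtain ⟨hroot, husnd⟩ := List.nodup_cons.1 hxnd
  obtain ⟨vs, es, h, hvs, hfold⟩ := exists_foldl_step hG (us.map cliqueSeq) [root] us [] .start
    (fun K => ⟨fun hK e => hroot (List.mem_singleton.1 e ▸ hK), fun hK =>
      (List.mem_cons.1 (hall K)).resolve_left fun e => hK (List.mem_singleton.2 e)⟩)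
    husnd (List.length_map _).symm
  obtain ⟨par, ho, hpar⟩ := h.searchOrder hvs
  refine ⟨ho.cliqueTree, ⟨es, h.nodup_arcs, fun K P => ?_, ?_⟩, fun K P hKP => ho.cliqueTree_spec hKP⟩
  · rw [hpar, ho.cliqueTree_isParent_iff]
    rfl
  · have hsearch : search ((root :: us).map cliqueSeq) = (vs.map cliqueSeq, arcSeq es, []) := hfold
    rw [treeOf, hsearch]
    change Data.cons (Enc.enc (charSeq n root.1)) (encodeList (List.map Enc.enc (arcSeq es))) = _
    rw [enc_charSeq, arcSeq, List.map_map]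
    congr 2
    refine List.map_congr_left fun e _ => ?_
    change Data.cons (Enc.enc (charSeq n e.1.1)) (Enc.enc (charSeq n e.2.1)) = _
    rw [enc_charSeq, enc_charSeq]

end CliqueTreeAlgorithm

/-! ### Enumeration and search combined. -/

theorem theorem5p6 :
    ∃ (A : TreeMachine.Prog) (p : Polynomial ℕ),
      ∀ (n : ℕ) (G : SimpleGraph (Fin n)), G.Connected → ChordalGraph.IsChordal G →
        ∃ (T : ChordalGraph.RootedCliqueTree G) (d : TreeMachine.Data) (t : ℕ),
          TreeMachine.Runs A (TreeMachine.encodeGraph G) d t ∧ t ≤ p.eval n ∧ T.IsEncodedBy d ∧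
          ∀ K P : ChordalGraph.MaxClique G, T.IsParent P K →
            (T.WeaklyConvergent (K.1 ∩ P.1) → 3 ≤ (K.1 ∩ P.1).ncard →
              T.Convergent (K.1 ∩ P.1)) ∧
            (∀ S : Set (Fin n), ChordalGraph.IsMinimalSeparatorOn G (T.below K) S →
              S ⊆ K.1 ∩ P.1 →
                T.Convergent S ∧ 3 ≤ S.ncard ∧
                ∃ S' : Set (Fin n),
                  ChordalGraph.IsMinimalSeparatorOn G (T.below K) S' ∧ S ⊂ S') := by
  obtain ⟨A, p, hA⟩ := CliqueTreeAlgorithm.treeOf_poly.comp CliqueTreeAlgorithm.maxCliques_polyTimeOn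
  -- The inner polynomial bounds the size of the adjacency matrix, so a bound in the input size
  -- becomes one in `n`.
  refine ⟨A, p.comp (.X * (.X * 4 + 2) + 1), fun n G _ hG => ?_⟩
  obtain ⟨t, hrun, ht⟩ := hA (CliqueTreeAlgorithm.adjacency G) ⟨n, G, hG, rfl⟩
  obtain ⟨T, hT, hspec⟩ := CliqueTreeAlgorithm.exists_treeOf_eq hG
  rw [CliqueTreeAlgorithm.enc_adjacency] at hrun
  refine ⟨T, _, t, hrun, ht.trans ?_, hT, hspec⟩
  have := TreeMachine.eval_mono p (CliqueTreeAlgorithm.sz_adjacency_le G)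
  simpa using this
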